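/- **Setting.** Let $u:\mathbb R^d\to\mathbb R$ be differentiable with $h=\nabla u$, and let $m,L,l>0$ be such that for all $x,y\in\mathbb R^d$ $$\langle h(x)-h(y),x-y\rangle\ge 2m|x-y|^2,\qquad |h(x)-h(y)|\le L(1+|x|+|y|)^l|x-y| .$$ For a step size $\lambda>0$ put $g(x)=h(x)-mx$, $r_\lambda=(L+m)\,(1/\sqrt\lambda)^{1/(l+2)}$, $R_\lambda=\sup_{|x|<r_\lambda}|g(x)|$ and define the tamed drift $$h_\lambda(x)=t(x)g(x)+R_\lambda s(x)x+mx,$$ where $t(x)=1$ if $|x|\le r_\lambda-1$, $t(x)=r_\lambda-|x|$ if $r_\lambda-1<|x|<r_\lambda$, $t(x)=0$ if $|x|\ge r_\lambda$; and $s(x)=0$ if $|x|\le r_\lambda-2$, $s(x)=|x|-r_\lambda+2$ if $r_\lambda-2<|x|<r_\lambda-1$, $s(x)=1$ if $r_\lambda-1\le|x|\le r_\lambda$, $s(x)=r_\lambda/|x|$ if $|x|\ge r_\lambda$. Let $\gamma>0$ and $\eta=e^{-\lambda\gamma/2}$. The tamed OBABO chain $(x_n,v_n)_{n\ge0}$ on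 $\mathbb R^d\times\mathbb R^d$ is given by $$\begin{aligned}x_{n+1}&=x_n+\lambda\big(\eta v_n+\sqrt{1-\eta^2}\,G_n\big)-\tfrac{\lambda^2}{2}h_\lambda(x_n),\\ v_{n+1}&=\eta^2v_n-\tfrac{\lambda\eta}{2}\big(h_\lambda(x_n)+h_\lambda(x_{n+1})\big)+\sqrt{1-\eta^2}\,\big(\eta G_n+G_n'\big),\end{aligned}$$ where $G_0,G_0',G_1,G_1',\dots$ are independent standard Gaussian vectors in $\mathbb R^d$, independent of $(x_0,v_0)$. A probability measure $\mu$ on $\mathbb R^{2d}$ satisfies an LSI with constant $C$ if for all bounded $f\in C^1(\mathbb R^{2d})$ with bounded gradient $$\int f^2\log f^2\,d\mu-\Big(\int f^2\,d\mu\Big)\log\Big(\int f^2\,d\mu\Big)\le C\int|\nabla f|^2\,d\mu$$ (so the standard Gaussian has constant $2$). **Theorem.** Let $M_\lambda\ge2$ be a Lipschitz constant of $h_\lambda$ (any number at least as large as its least Lipschitz constant), and suppose $\gamma\ge2\sqrt{M_\lambda}$ and $\lambda\le m/(33\gamma^3)$. Set $a=1/M_\lambda$, $b=1/\gamma$, $\kappa=m/(3\gamma)$,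 $r=\sqrt{1-\lambda\kappa}$, $C_1=8\sqrt{1-e^{-2\lambda\gamma}}$ and $S(x,v)=(x+bv,\sqrt{a-b^2}\,v)$. If the law of $(x_0,v_0)$ satisfies an LSI with constant $C_{LSI,0}$, then for every $n\in\mathbb N$ the law of $S(x_n,v_n)$ satisfies an LSI with constant at most $$(1-\lambda\kappa)^n\sqrt{1+a}\;C_{LSI,0}+\frac{1-r^{2n}}{1-r^2}\,C_1 .$$ -/

import Mathlib

open MeasureTheory ProbabilityTheory
open scoped NNReal

noncomputable section

/-- Position or velocity space `ℝᵈ` with the Euclidean norm. -/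
abbrev Vec (d : ℕ) : Type := EuclideanSpace ℝ (Fin d)

/-- Phase space `ℝᵈ × ℝᵈ ≅ ℝ²ᵈ` with the Euclidean norm (hence `WithLp 2`). -/
abbrev Phase (d : ℕ) : Type := WithLp 2 (Vec d × Vec d)

/-- Logarithmic Sobolev inequality with constant `C`, in the normalization in which the standard
Gaussian has constant `2`: for every bounded `C¹` function `f` with bounded derivative,
`Ent_μ(f²) = ∫ f² log f² dμ - (∫ f² dμ) log (∫ f² dμ) ≤ C ∫ |∇f|² dμ`.
For a probability measure all these integrals converge. -/
def SatisfiesLSI {E : Type*} [NormedAddCommGroup E] [NormedSpace ℝ E] [MeasurableSpace E]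
    (μ : Measure E) (C : ℝ) : Prop :=
  ∀ f : E → ℝ, ContDiff ℝ 1 f → (∃ K : ℝ, ∀ z, |f z| ≤ K ∧ ‖fderiv ℝ f z‖ ≤ K) →
    ∫ z, f z ^ 2 * Real.log (f z ^ 2) ∂μ - (∫ z, f z ^ 2 ∂μ) * Real.log (∫ z, f z ^ 2 ∂μ)
      ≤ C * ∫ z, ‖fderiv ℝ f z‖ ^ 2 ∂μ

/-- The (least) Lipschitz constant of a map. -/
def lipConst {E F : Type*} [PseudoEMetricSpace E] [PseudoEMetricSpace F] (f : E → F) : ℝ≥0 :=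
  sInf {K : ℝ≥0 | LipschitzWith K f}

/-- The taming radius `r_λ = (L + m) (1/√λ)^{1/(l+2)}`. -/
def tamingRadius (m L l lam : ℝ) : ℝ :=
  (L + m) * (1 / √lam) ^ (1 / (l + 2))

/-- The cut-off factor `t`, as a function of `ρ = |x|` and of the radius `R = r_λ`. -/
def cutT (R ρ : ℝ) : ℝ :=
  if ρ ≤ R - 1 then 1 else if ρ < R then R - ρ else 0

/-- The factor `s`, as a function of `ρ = |x|` and of the radius `R = r_λ`. -/
def cutS (R ρ : ℝ) : ℝ :=
  if ρ ≤ R - 2 then 0 else if ρ < R - 1 then ρ - R + 2 else if ρ ≤ R then 1 else R / ρ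

/-- `g(x) = h(x) - m x`. -/
def shifted {d : ℕ} (h : Vec d → Vec d) (m : ℝ) (x : Vec d) : Vec d :=
  h x - m • x

/-- `R_λ`, the supremum of `|g|` over the ball `B(0, r_λ)`. -/
def tamingSup {d : ℕ} (h : Vec d → Vec d) (m L l lam : ℝ) : ℝ :=
  sSup ((fun x => ‖shifted h m x‖) '' Metric.ball (0 : Vec d) (tamingRadius m L l lam))

/-- The tamed drift `h_λ(x) = t(x) g(x) + R_λ s(x) x + m x`. -/
def tamedDrift {d : ℕ} (h : Vec d → Vec d) (m L l lam : ℝ) (x : Vec d) : Vec d :=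
  cutT (tamingRadius m L l lam) ‖x‖ • shifted h m x
    + (tamingSup h m L l lam * cutS (tamingRadius m L l lam) ‖x‖) • x + m • x

/-- One step of the OBABO scheme with drift `b`, step size `lam` and friction `gam`, started at
`z = (x₀, v₀)` and driven by the Gaussian inputs `g` and `g'`. -/
def obaboStep {d : ℕ} (b : Vec d → Vec d) (lam gam : ℝ) (z : Phase d) (g g' : Vec d) : Phase d :=
  let η : ℝ := Real.exp (-(lam * gam / 2))
  let v₀' : Vec d := η • z.snd + √(1 - η ^ 2) • g
  let vhalf : Vec d := v₀' - (lam / 2) • b z.fst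
  let x₁ : Vec d := z.fst + lam • vhalf
  let v₁' : Vec d := vhalf - (lam / 2) • b x₁
  let v₁ : Vec d := η • v₁' + √(1 - η ^ 2) • g'
  WithLp.toLp 2 (x₁, v₁)

/-- The OBABO chain `z_n = (x_n, v_n)` started at `z₀` and driven by the inputs `(G_n, G'_n)`. -/
def obaboChain {d : ℕ} {Ω : Type*} (b : Vec d → Vec d) (lam gam : ℝ) (z₀ : Ω → Phase d)
    (G G' : ℕ → Ω → Vec d) : ℕ → Ω → Phase d
  | 0 => z₀
  | n + 1 => fun ω => obaboStep b lam gam (obaboChain b lam gam z₀ G G' n ω) (G n ω) (G' n ω)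

/-- The linear map `S(x, v) = (x + b v, √(a - b²) v)`. -/
def shear {d : ℕ} (a b : ℝ) (z : Phase d) : Phase d :=
  WithLp.toLp 2 (z.fst + b • z.snd, √(a - b ^ 2) • z.snd)

end

/-! Write |S(x, v)|² = |x|² + 2b⟨x, v⟩ + a|v|². Two chains driven by the same noise contract in this
twisted norm: one step multiplies squared distances by at most 1 - λκ. A logarithmic Sobolev
inequality passes to a C¹ function of independent variables, each constant being weighted by the
square of the Lipschitz constant in that variable (`SatisfiesLSI.map_prod`). In the coordinates S
one step therefore turns C into r²C + 4(1 - η²), each of the two Gaussian inputs costing 2(1 - η²).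
Iteration gives a geometric series, 4(1 - η²) is below C₁, and √(1 + a) bounds the squared Lipschitz
constant of S, which accounts for the initial term.

The contraction is an expansion in the half-step velocity w, since v = η⁻¹(w + λy₀/2) and v₁ = η(w -
λy₁/2) for differences of two chains. The choice b = 1/γ cancels the ⟨x, w⟩ terms up to third order
in λγ; friction yields a multiple of -aγ|w|² and the drift yields multiples of -b⟨yᵢ, xᵢ⟩. The
remaining cross terms a⟨yᵢ, w⟩ are absorbed by Young's inequality once the drift is cocoercive: |y|²
≤ (2M - m)⟨y, x⟩ for its increments.

Cocoercivity is the delicate point, because the tamed drift is not a gradient. In the shell where t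
decreases, its derivative contains the nonsymmetric rank-one term ξ ↦ -⟨n, ξ⟩g with n = x/|x|. Since
|g| ≤ R_λ, its skew part is small relative to the symmetric part (`norm_skew_sq_le`), and this
yields the constant 2M - m (`norm_sq_le_of_rank_one`). In the other regions the derivative is
symmetric.

The drift is only Lipschitz, while transport of the inequality needs C¹ maps. Rademacher's theorem
gives the derivative bounds almost everywhere. They are convex conditions on the derivative, so
mollification preserves them; the theorem holds for the mollified chains with constants independent
of the mollification, and passes to the pointwise limit.

The Gaussian inequality is proved by cutting a Gaussian vector into k + 1 independent small ones,
using subadditivity of entropy and letting k tend to infinity. -/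

/-! ### Scalar inequalities behind the contraction of one step. -/

theorem mul_mul_le_of_sq_le {R P Q y w : ℝ} (hP : 0 ≤ P) (hQ : 0 ≤ Q) (hR : R ^ 2 ≤ 4 * (P * Q)) :
    R * y * w ≤ P * y ^ 2 + Q * w ^ 2 := by
  rcases hP.eq_or_lt with h | h
  · have : R = 0 := by
      have : R ^ 2 ≤ 0 := by rw [← h] at hR; linarith
      exact pow_eq_zero_iff two_ne_zero |>.1 (le_antisymm this (sq_nonneg R))
    subst this; nlinarith [mul_nonneg hP (sq_nonneg y), mul_nonneg hQ (sq_nonneg w)]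
  · have h1 : 0 ≤ (2 * P * y - R * w) ^ 2 + (4 * (P * Q) - R ^ 2) * w ^ 2 := by
      have := mul_nonneg (sub_nonneg.2 hR) (sq_nonneg w)
      positivity
    have h2 : 0 ≤ 4 * P * (P * y ^ 2 + Q * w ^ 2 - R * y * w) := by nlinarith
    have := nonneg_of_mul_nonneg_right h2 (by positivity)
    linarith

/-- Elementary bounds on `e^{-δ}` for small `δ`. -/
theorem exp_neg_bounds {δ : ℝ} (h0 : 0 ≤ δ) (h1 : δ ≤ 1 / 264) :
    let e := Real.exp (-δ)
    0 < e ∧ e ≤ 1 ∧ 1 - δ ≤ e ∧ 1 / e ≤ 1 + 2 * δ ∧ 1 / e ^ 2 ≤ 1 + 3 * δ ∧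
      2 * δ ≤ 1 / e - e ∧ 1 / e - e ≤ 2 * δ + δ ^ 3 ∧ 4 * δ ≤ 1 / e ^ 2 - e ^ 2 := by
  intro e
  have he : e * Real.exp δ = 1 := by simp [e, ← Real.exp_add]
  have he0 : 0 < e := Real.exp_pos _
  have hinv : 1 / e = Real.exp δ := by rw [div_eq_iff he0.ne']; linarith
  have hinv2 : 1 / e ^ 2 = Real.exp (2 * δ) := by
    rw [show 2 * δ = δ + δ by ring, Real.exp_add, ← hinv]; ring
  have he2 : e ^ 2 = Real.exp (-(2 * δ)) := by
    rw [show -(2 * δ) = -δ + -δ by ring, Real.exp_add]; ring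
  have hs : ∀ t : ℝ, 0 ≤ t → 2 * t ≤ Real.exp t - Real.exp (-t) := by
    intro t ht
    have := Real.self_le_sinh_iff.2 ht
    rw [Real.sinh_eq] at this
    linarith
  have b1 := Real.abs_exp_sub_one_sub_id_le (x := δ) (by rw [abs_le]; constructor <;> linarith)
  have b2 := Real.exp_bound (x := δ) (by rw [abs_le]; constructor <;> linarith) (n := 4) (by norm_num)
  have b3 := Real.exp_bound (x := -δ) (by rw [abs_le]; constructor <;> linarith) (n := 4) (by norm_num)
  have b4 := Real.abs_exp_sub_one_sub_id_le (x := 2 * δ) (by rw [abs_le]; constructor <;> linarith)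
  rw [abs_le] at b1 b2 b3 b4
  simp [Finset.sum_range_succ, Nat.factorial, abs_of_nonneg h0] at b2 b3
  have d2 : δ ^ 2 ≤ δ / 264 := by nlinarith
  have d4 : δ ^ 4 ≤ δ ^ 3 / 264 := by
    have : 0 ≤ δ ^ 3 := by positivity
    nlinarith
  refine ⟨he0, ?_, ?_, ?_, ?_, ?_, ?_, ?_⟩
  · simpa [e] using h0
  · have := Real.add_one_le_exp (-δ); simp only [e]; linarith
  · rw [hinv]; nlinarith
  · rw [hinv2]; nlinarith
  · rw [hinv]; exact hs δ h0
  · rw [hinv]; simp only [e]; nlinarith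
  · rw [hinv2, he2]; linarith [hs (2 * δ) (by linarith)]

/-- The scalar inequality behind the contraction of one OBABO step. -/
theorem obabo_scalar_bound {a b γ m M δ X W q₀ q₁ Y₀ Y₁ : ℝ}
    (hm : 0 < m) (hmM : m ≤ M) (haM : a * M = 1) (hbγ : b * γ = 1) (hγ : 0 < γ)
    (hab : 4 * b ≤ a * γ) (hδ : 0 ≤ δ) (hδm : 66 * δ ≤ m * b ^ 2)
    (hX : 0 ≤ X) (hW : 0 ≤ W) (hY₀ : 0 ≤ Y₀)
    (hq₀ : m * X ^ 2 ≤ q₀) (hq₁ : 0 ≤ q₁)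
    (hc₀ : Y₀ ^ 2 ≤ (2 * M - m) * q₀) (hc₁ : Y₁ ^ 2 ≤ (2 * M - m) * q₁) :
    (δ ^ 2 + 2 / 3 * (m * b ^ 2) * (1 + 2 * δ)) * X * W + a * W * Y₁
      + a * W * Y₀ * (1 + 3.2 * δ)
      ≤ b * q₁ * (1 - 2 * δ) + b * q₀ * (2 / 3 - δ / 5 - δ ^ 2)
        + a * γ * W ^ 2 * (3 / 2 - δ / 2 - m * b ^ 2 / 3 * (1 + 3 * δ)) := by
  have hM : 0 < M := by linarith
  have ha : 0 < a := by
    rcases lt_or_ge 0 a with h | h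
    · exact h
    · nlinarith
  have hb : 0 < b := by
    rcases lt_or_ge 0 b with h | h
    · exact h
    · nlinarith
  have hc : 0 < 2 * M - m := by linarith
  set c := 2 * M - m with hcdef
  -- The deficit a m in a c = 2 - a m is what later pays for the terms in μ.
  have hac : a * c = 2 - a * m := by rw [hcdef]; linear_combination 2 * haM
  have hν : a * m ≤ 1 := by nlinarith
  have hν0 : 0 < a * m := by positivity
  -- `m b² ≤ a m / 4`
  have hb2 : b ^ 2 ≤ a / 4 := by nlinarith
  have hμ : m * b ^ 2 ≤ a * m / 4 := by nlinarith
  have hμ0 : 0 < m * b ^ 2 := by positivity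
  set μ := m * b ^ 2 with hμdef
  have hδ1 : δ ≤ 1 / 264 := by linarith
  have hδ2 : δ ^ 2 ≤ δ / 264 := by nlinarith
  have hq₀0 : 0 ≤ q₀ := le_trans (by positivity) hq₀
  -- The three Young inequalities share out the dissipation: the weight on q₁ stays below 1, those
  -- on q₀ add up to 0.665 < 2/3, and those on a γ W² add up to 0.68 a c + 0.58 μ. Each pair of
  -- weights has 4PQ just above the squared cross coefficient.
  have i1 : a * W * Y₁ ≤ b * q₁ * (99 / 100) + 0.26 * (a * c) * (a * γ) * W ^ 2 := by
    have h := mul_mul_le_of_sq_le (R := a) (P := 99 / 100 * b / c) (Q := 0.26 * (a * c) * (a * γ))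
      (y := Y₁) (w := W) (by positivity) (by positivity) (by
        have : 99 / 100 * b / c * (0.26 * (a * c) * (a * γ)) = 99 / 100 * 0.26 * a ^ 2 * (b * γ) := by
          field_simp
        rw [this, hbγ]; linarith [sq_nonneg a])
    have h2 : 99 / 100 * b / c * Y₁ ^ 2 ≤ 99 / 100 * b * q₁ := by
      calc 99 / 100 * b / c * Y₁ ^ 2 ≤ 99 / 100 * b / c * (c * q₁) := by gcongr
        _ = _ := by field_simp
    linarith
  -- The factor 1.0122 bounds 1 + 3.2 δ for δ ≤ 1/264.
  have i2 : 1.0122 * (a * W * Y₀) ≤ b * q₀ * 0.615 + 0.42 * (a * c) * (a * γ) * W ^ 2 := by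
    have h := mul_mul_le_of_sq_le (R := 1.0122 * a) (P := 0.615 * b / c)
      (Q := 0.42 * (a * c) * (a * γ))
      (y := Y₀) (w := W) (by positivity) (by positivity) (by
        have : 0.615 * b / c * (0.42 * (a * c) * (a * γ)) = 0.615 * 0.42 * a ^ 2 * (b * γ) := by
          field_simp
        rw [this, hbγ]; linarith [sq_nonneg a])
    have h2 : 0.615 * b / c * Y₀ ^ 2 ≤ 0.615 * b * q₀ := by
      calc 0.615 * b / c * Y₀ ^ 2 ≤ 0.615 * b / c * (c * q₀) := by gcongr
        _ = _ := by field_simp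
    linarith
  have i3 : 0.68 * μ * X * W ≤ 0.05 * (b * q₀) + 0.58 * μ * (a * γ) * W ^ 2 := by
    have h := mul_mul_le_of_sq_le (R := 0.68 * μ) (P := 0.05 * b * m) (Q := 0.58 * μ * (4 * b))
      (y := X) (w := W) (by positivity) (by positivity) (by
        have : 0.05 * b * m * (0.58 * μ * (4 * b)) = 0.116 * μ ^ 2 := by rw [hμdef]; ring
        rw [this]; linarith [sq_nonneg μ])
    have h2 : 0.05 * b * m * X ^ 2 ≤ 0.05 * b * q₀ := by
      calc 0.05 * b * m * X ^ 2 = 0.05 * b * (m * X ^ 2) := by ring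
        _ ≤ _ := by gcongr
    have h3 : 0.58 * μ * (4 * b) * W ^ 2 ≤ 0.58 * μ * (a * γ) * W ^ 2 := by gcongr
    linarith
  have j1 : (δ ^ 2 + 2 / 3 * μ * (1 + 2 * δ)) * X * W ≤ 0.68 * μ * X * W := by
    have : μ * δ ≤ μ * (1 / 264) := by gcongr
    gcongr
    linarith
  have j2 : a * W * Y₀ * (1 + 3.2 * δ) ≤ 1.0122 * (a * W * Y₀) := by
    have : a * W * Y₀ * δ ≤ a * W * Y₀ * (1 / 264) := by gcongr
    have : 0 ≤ a * W * Y₀ := by positivity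
    linarith
  have j3 : b * q₁ * (99 / 100) ≤ b * q₁ * (1 - 2 * δ) := by gcongr; linarith
  have j4 : b * q₀ * 0.615 + 0.05 * (b * q₀) ≤ b * q₀ * (2 / 3 - δ / 5 - δ ^ 2) := by
    have h1 : 0.615 + 0.05 ≤ 2 / 3 - δ / 5 - δ ^ 2 := by linarith
    calc b * q₀ * 0.615 + 0.05 * (b * q₀) = b * q₀ * (0.615 + 0.05) := by ring
      _ ≤ _ := by gcongr
  have j5 : a * γ * W ^ 2 * (0.68 * (a * c) + 0.58 * μ)
      ≤ a * γ * W ^ 2 * (3 / 2 - δ / 2 - μ / 3 * (1 + 3 * δ)) := by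
    gcongr
    rw [hac]
    have : μ * δ ≤ μ * (1 / 264) := by gcongr
    linarith
  linarith

theorem mul_le_mul_of_abs_le {u U k K : ℝ} (hu : 0 ≤ u) (huU : u ≤ U) (hk : |k| ≤ K) :
    u * k ≤ U * K :=
  calc u * k ≤ u * |k| := by gcongr; exact le_abs_self k
    _ ≤ U * K := by gcongr; exact hu.trans huU

/-- Here e = η, δ = λγ/2, p = ⟨x, w⟩, kᵢ = ⟨yᵢ, w⟩ and qᵢ = ⟨yᵢ, xᵢ⟩. The `t` estimates bound the
difference between the new and the old twisted norm, and the `u` estimates bound λκ times the old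
one. Their sum is `key` multiplied by λ. -/
theorem obabo_scalar_step {a b γ m M δ lam κ e X W q₀ q₁ Y₀ Y₁ p k₀ k₁ : ℝ}
    (hm : 0 < m) (haM : a * M = 1) (hbγ : b * γ = 1) (hb : 0 < b)
    (ha : 0 < a) (hab : 4 * b ≤ a * γ) (hδ : 0 ≤ δ) (hδ1 : δ ≤ 1 / 264) (hμ : m * b ^ 2 ≤ 1 / 4)
    (hlamδ : lam = 2 * δ * b) (hlam : 0 < lam) (hκ : κ = m * b / 3)
    (he0 : 0 < e) (he1 : e ≤ 1) (he2 : 1 - δ ≤ e) (he3 : 1 / e ≤ 1 + 2 * δ)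
    (he4 : 1 / e ^ 2 ≤ 1 + 3 * δ) (he5 : 2 * δ ≤ 1 / e - e) (he6 : 1 / e - e ≤ 2 * δ + δ ^ 3)
    (he7 : 4 * δ ≤ 1 / e ^ 2 - e ^ 2)
    (hW : 0 ≤ W) (hY₀ : 0 ≤ Y₀)
    (hp : |p| ≤ X * W) (hk₀ : |k₀| ≤ Y₀ * W) (hk₁ : |k₁| ≤ Y₁ * W)
    (hq₀ : m * X ^ 2 ≤ q₀) (hq₁ : 0 ≤ q₁)
    (hc₀ : Y₀ ^ 2 ≤ (2 * M - m) * q₀) (hc₁ : Y₁ ^ 2 ≤ (2 * M - m) * q₁)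
    (key : (δ ^ 2 + 2 / 3 * (m * b ^ 2) * (1 + 2 * δ)) * X * W + a * W * Y₁
      + a * W * Y₀ * (1 + 3.2 * δ)
      ≤ b * q₁ * (1 - 2 * δ) + b * q₀ * (2 / 3 - δ / 5 - δ ^ 2)
        + a * γ * W ^ 2 * (3 / 2 - δ / 2 - m * b ^ 2 / 3 * (1 + 3 * δ))) :
    X ^ 2 + 2 * lam * p + lam ^ 2 * W ^ 2 + 2 * b * (e * (p + lam * W ^ 2 - lam / 2 * q₁))
      + a * (e ^ 2 * (W ^ 2 - lam * k₁ + lam ^ 2 / 4 * Y₁ ^ 2))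
      ≤ (1 - lam * κ) * (X ^ 2 + 2 * b * (1 / e * (p + lam / 2 * q₀))
        + a * (1 / e ^ 2 * (W ^ 2 + lam * k₀ + lam ^ 2 / 4 * Y₀ ^ 2))) := by
  have hf0 : 0 < 1 / e := by positivity
  have hg0 : 0 < 1 / e ^ 2 := by positivity
  have hf1 : 1 ≤ 1 / e := by rw [le_div_iff₀ he0]; linarith
  have hee : e ^ 2 ≤ 1 := pow_le_one₀ he0.le he1
  have hee0 : 0 < e ^ 2 := by positivity
  set f := 1 / e
  set g := 1 / e ^ 2
  set s := e ^ 2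
  have hq₀0 : 0 ≤ q₀ := le_trans (by positivity) hq₀
  have hκ0 : 0 < κ := by rw [hκ]; positivity
  have hκl : κ * lam ≤ δ / 6 := by
    have h1 : κ * lam = 2 / 3 * (m * b ^ 2) * δ := by rw [hκ, hlamδ]; ring
    have h2 : m * b ^ 2 * δ ≤ 1 / 4 * δ := by gcongr
    linarith
  have hlγ : lam * γ = 2 * δ := by rw [hlamδ]; linear_combination 2 * δ * hbγ
  -- As λ = 2δb, only the cubic remainder of 1/e - e - 2δ is left in front of p.
  have t1 : (2 * lam + 2 * b * e - 2 * b * f) * p ≤ lam * δ ^ 2 * (X * W) := by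
    calc (2 * lam + 2 * b * e - 2 * b * f) * p = 2 * b * ((f - e - 2 * δ) * (-p)) := by
          rw [hlamδ]; ring
      _ ≤ 2 * b * (δ ^ 3 * (X * W)) := by
          have := mul_le_mul_of_abs_le (u := f - e - 2 * δ) (U := δ ^ 3) (k := -p) (K := X * W)
            (by linarith) (by linarith) (by rwa [abs_neg])
          gcongr
      _ = lam * δ ^ 2 * (X * W) := by rw [hlamδ]; ring
  have t2 : W ^ 2 * (lam ^ 2 + 2 * b * lam * e + a * (s - g))
      ≤ lam * (a * γ * W ^ 2 * ((1 + δ) / 2 - 2)) := by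
    have h1 : lam ^ 2 = 2 * δ * b * lam := by rw [sq]; nth_rw 1 [hlamδ]
    have h2 : 2 * b * lam * e ≤ 2 * b * lam * 1 := by gcongr
    have h3 : a * (4 * δ) ≤ a * (g - s) := by gcongr
    have h4 : a * (4 * δ) = 2 * lam * (a * γ) := by linear_combination (-2 * a) * hlγ
    have h5 : (1 + δ) / 2 * lam * (4 * b) ≤ (1 + δ) / 2 * lam * (a * γ) := by gcongr
    calc W ^ 2 * (lam ^ 2 + 2 * b * lam * e + a * (s - g))
        ≤ W ^ 2 * (lam * (a * γ) * ((1 + δ) / 2 - 2)) := by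
          gcongr
          linarith
      _ = _ := by ring
  have t3 : b * lam * (1 - δ) * q₁ ≤ b * lam * e * q₁ := by gcongr
  have t4 : b * lam * 1 * q₀ ≤ b * lam * f * q₀ := by gcongr
  have t5 : a * lam * (s * (-k₁)) ≤ a * lam * (1 * (Y₁ * W)) := by
    have := mul_le_mul_of_abs_le hee0.le hee (k := -k₁) (K := Y₁ * W) (by rwa [abs_neg])
    gcongr
  have t6 : a * lam * (g * (-k₀)) ≤ a * lam * ((1 + 3 * δ) * (Y₀ * W)) := by
    have := mul_le_mul_of_abs_le hg0.le he4 (k := -k₀) (K := Y₀ * W) (by rwa [abs_neg])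
    gcongr
  have hY2 : ∀ {Y q : ℝ}, 0 ≤ q → Y ^ 2 ≤ (2 * M - m) * q → a * Y ^ 2 ≤ 2 * q := by
    intro Y q hq h
    have h1 : a * Y ^ 2 ≤ a * ((2 * M - m) * q) := by gcongr
    have h2 : a * ((2 * M - m) * q) = 2 * q - a * m * q := by linear_combination 2 * q * haM
    have h3 : 0 ≤ a * m * q := by positivity
    linarith
  have t7 : lam ^ 2 / 4 * (s * (a * Y₁ ^ 2)) ≤ lam * (δ * b) * q₁ := by
    calc lam ^ 2 / 4 * (s * (a * Y₁ ^ 2)) ≤ lam ^ 2 / 4 * (1 * (2 * q₁)) := by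
          have := hY2 hq₁ hc₁
          gcongr
      _ = lam * (lam / 2) * q₁ := by ring
      _ = _ := by rw [show lam / 2 = δ * b by rw [hlamδ]; ring]
  have t8 : 0 ≤ a * (g * (lam ^ 2 / 4 * Y₀ ^ 2)) := by positivity
  have u1 : lam * κ * X ^ 2 ≤ lam * (b * q₀ / 3) := by
    calc lam * κ * X ^ 2 = lam * (b * (m * X ^ 2) / 3) := by rw [hκ]; ring
      _ ≤ _ := by gcongr
  have u2 : lam * κ * (2 * b * (f * p)) ≤ lam * (2 / 3 * (m * b ^ 2)) * ((1 + 2 * δ) * (X * W)) := by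
    calc lam * κ * (2 * b * (f * p)) = lam * (2 / 3 * (m * b ^ 2)) * (f * p) := by rw [hκ]; ring
      _ ≤ _ := by
        have := mul_le_mul_of_abs_le hf0.le he3 hp
        gcongr
  have hκ5 : κ * lam * (1 + 3 * δ) ≤ δ / 5 := by
    calc κ * lam * (1 + 3 * δ) ≤ δ / 6 * (1 + 3 * (1 / 264)) := by gcongr
      _ ≤ δ / 5 := by linarith
  have hκ5' : κ * lam * (1 + 2 * δ) ≤ δ / 5 :=
    le_trans (by gcongr; norm_num) hκ5
  have u3 : lam * κ * (2 * b * (f * (lam / 2 * q₀))) ≤ lam * (b * q₀) * (δ / 5) := by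
    calc lam * κ * (2 * b * (f * (lam / 2 * q₀))) = lam * (b * q₀) * (κ * lam * f) := by ring
      _ ≤ lam * (b * q₀) * (κ * lam * (1 + 2 * δ)) := by gcongr
      _ ≤ _ := by gcongr
  have u4 : lam * κ * (a * (g * W ^ 2)) ≤ lam * (a * γ * W ^ 2 * (m * b ^ 2 / 3 * (1 + 3 * δ))) := by
    calc lam * κ * (a * (g * W ^ 2)) ≤ lam * κ * (a * ((1 + 3 * δ) * W ^ 2)) := by gcongr
      _ = _ := by rw [hκ]; linear_combination (-(lam * m * b * a * (1 + 3 * δ) * W ^ 2) / 3) * hbγ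
  have u5 : lam * κ * (a * (g * (lam * k₀))) ≤ lam * a * (Y₀ * W) * (δ / 5) := by
    calc lam * κ * (a * (g * (lam * k₀))) = lam * a * (κ * lam) * (g * k₀) := by ring
      _ ≤ lam * a * (κ * lam) * ((1 + 3 * δ) * (Y₀ * W)) := by
        have := mul_le_mul_of_abs_le hg0.le he4 hk₀
        gcongr
      _ = lam * a * (Y₀ * W) * (κ * lam * (1 + 3 * δ)) := by ring
      _ ≤ _ := by gcongr
  have u6 : lam * κ * (a * (g * (lam ^ 2 / 4 * Y₀ ^ 2))) ≤ lam * (b * q₀) * δ ^ 2 := by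
    calc lam * κ * (a * (g * (lam ^ 2 / 4 * Y₀ ^ 2)))
        = lam * (lam / 4) * (κ * lam * g) * (a * Y₀ ^ 2) := by ring
      _ ≤ lam * (lam / 4) * (κ * lam * (1 + 3 * δ)) * (2 * q₀) := by
        have := hY2 hq₀0 hc₀
        gcongr
      _ ≤ lam * (lam / 4) * (δ / 5) * (2 * q₀) := by gcongr
      _ = lam * (b * q₀) * δ ^ 2 / 5 := by
        rw [show lam / 4 = δ * b / 2 by rw [hlamδ]; ring]; ring
      _ ≤ _ := by
        have : 0 ≤ lam * (b * q₀) * δ ^ 2 := by positivity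
        linarith
  have key' := mul_le_mul_of_nonneg_left key hlam.le
  clear_value f g s
  clear he3 he4 he5 he6 he7 hee hee0 hf0 hg0 hf1 hc₀ hc₁ hY2 key
  linarith

/-- The vectors are differences of two chains with the same inputs, so the noise has cancelled: w is
the half-step velocity, and y₀, y₁ are the drift increments before and after the position update. -/
theorem obabo_contraction_scalars {E : Type*} [NormedAddCommGroup E] [InnerProductSpace ℝ E]
    {a b γ m M lam κ : ℝ} (hm : 0 < m) (hmM : m ≤ M) (haM : a * M = 1) (hbγ : b * γ = 1)
    (hγ : 0 < γ) (hab : 4 * b ≤ a * γ) (hlam : 0 < lam) (hstep : 33 * (lam * γ) ≤ m * b ^ 2)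
    (hκ : κ = m * b / 3) (x w y₀ y₁ : E)
    (hq₀ : m * ‖x‖ ^ 2 ≤ inner ℝ y₀ x) (hq₁ : 0 ≤ inner ℝ y₁ (x + lam • w))
    (hc₀ : ‖y₀‖ ^ 2 ≤ (2 * M - m) * inner ℝ y₀ x)
    (hc₁ : ‖y₁‖ ^ 2 ≤ (2 * M - m) * inner ℝ y₁ (x + lam • w)) (v : E)
    (hv : Real.exp (-(lam * γ / 2)) • v = w + (lam / 2) • y₀) :
    let e := Real.exp (-(lam * γ / 2))
    let x₁ := x + lam • w
    let v₁ := e • (w - (lam / 2) • y₁)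
    ‖x₁‖ ^ 2 + 2 * b * inner ℝ x₁ v₁ + a * ‖v₁‖ ^ 2
      ≤ (1 - lam * κ) * (‖x‖ ^ 2 + 2 * b * inner ℝ x v + a * ‖v‖ ^ 2) := by
  intro e x₁ v₁
  have hM : 0 < M := by linarith
  have ha : 0 < a := by
    rcases lt_or_ge 0 a with h | h
    · exact h
    · nlinarith
  have hb : 0 < b := by
    rcases lt_or_ge 0 b with h | h
    · exact h
    · nlinarith
  obtain ⟨δ, hδ⟩ : ∃ δ, δ = lam * γ / 2 := ⟨_, rfl⟩
  have hδ0 : 0 ≤ δ := by rw [hδ]; positivity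
  have hδm : 66 * δ ≤ m * b ^ 2 := by rw [hδ]; linarith
  have hlamδ : lam = 2 * δ * b := by rw [hδ]; linear_combination (-lam) * hbγ
  have hb2 : b ^ 2 ≤ a / 4 := by nlinarith
  have hμ : m * b ^ 2 ≤ 1 / 4 := by nlinarith
  have hδ1 : δ ≤ 1 / 264 := by linarith
  have heδ : e = Real.exp (-δ) := by simp only [e]; rw [hδ]
  obtain ⟨he0, he1, he2, he3, he4, he5, he6, he7⟩ := exp_neg_bounds hδ0 hδ1
  rw [← heδ] at he0 he1 he2 he3 he4 he5 he6 he7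
  have hv' : v = (1 / e) • (w + (lam / 2) • y₀) := by
    rw [← hv, smul_smul, one_div, inv_mul_cancel₀ he0.ne', one_smul]
  have key := obabo_scalar_bound (X := ‖x‖) (W := ‖w‖) (Y₀ := ‖y₀‖) (Y₁ := ‖y₁‖)
    hm hmM haM hbγ hγ hab hδ0 hδm (norm_nonneg _) (norm_nonneg _) (norm_nonneg _)
    hq₀ hq₁ hc₀ hc₁
  have p1 : |inner ℝ x w| ≤ ‖x‖ * ‖w‖ := abs_real_inner_le_norm _ _
  have p2 : |inner ℝ y₀ w| ≤ ‖y₀‖ * ‖w‖ := abs_real_inner_le_norm _ _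
  have p3 : |inner ℝ y₁ w| ≤ ‖y₁‖ * ‖w‖ := abs_real_inner_le_norm _ _
  have e1 : inner ℝ x₁ v₁ = e * (inner ℝ x w + lam * ‖w‖ ^ 2 - lam / 2 * inner ℝ y₁ (x + lam • w)) := by
    simp only [x₁, v₁, inner_smul_right, inner_sub_right]
    rw [inner_add_left, inner_smul_left, real_inner_self_eq_norm_sq, real_inner_comm (x + lam • w) y₁]
    simp
  have e2 : ‖v₁‖ ^ 2 = e ^ 2 * (‖w‖ ^ 2 - lam * inner ℝ y₁ w + lam ^ 2 / 4 * ‖y₁‖ ^ 2) := by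
    simp only [v₁, norm_smul, mul_pow, norm_sub_sq_real, inner_smul_right, Real.norm_eq_abs, sq_abs]
    rw [real_inner_comm w y₁]; ring
  have e3 : ‖x₁‖ ^ 2 = ‖x‖ ^ 2 + 2 * lam * inner ℝ x w + lam ^ 2 * ‖w‖ ^ 2 := by
    simp only [x₁, norm_smul, mul_pow, norm_add_sq_real, inner_smul_right, Real.norm_eq_abs, sq_abs]
    ring
  have e4 : inner ℝ x v = 1 / e * (inner ℝ x w + lam / 2 * inner ℝ y₀ x) := by
    rw [hv', inner_smul_right, inner_add_right, inner_smul_right, real_inner_comm x y₀]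
  have e5 : ‖v‖ ^ 2 = 1 / e ^ 2 * (‖w‖ ^ 2 + lam * inner ℝ y₀ w + lam ^ 2 / 4 * ‖y₀‖ ^ 2) := by
    rw [hv', norm_smul, mul_pow, norm_add_sq_real, inner_smul_right, Real.norm_eq_abs, sq_abs,
      norm_smul, mul_pow, Real.norm_eq_abs, sq_abs, real_inner_comm w y₀]
    ring
  rw [e1, e2, e3, e4, e5]
  exact obabo_scalar_step hm haM hbγ hb ha hab hδ0 hδ1 hμ hlamδ hlam hκ he0 he1 he2 he3 he4
    he5 he6 he7 (norm_nonneg _) (norm_nonneg _) p1 p2 p3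
    hq₀ hq₁ hc₀ hc₁ key

/-! ### Entropy, its variational bound and its subadditivity. -/

open Filter Topology

/-- The entropy functional `Ent_μ(F) = ∫ F log F dμ - (∫ F dμ) log (∫ F dμ)`. -/
noncomputable def ent {E : Type*} [MeasurableSpace E] (μ : Measure E) (F : E → ℝ) : ℝ :=
  ∫ z, F z * Real.log (F z) ∂μ - (∫ z, F z ∂μ) * Real.log (∫ z, F z ∂μ)

/-- The Bregman divergence of `x log x`. -/
noncomputable def bregman (x c : ℝ) : ℝ := x * Real.log x - x * Real.log c - x + c

theorem bregman_nonneg {x c : ℝ} (hx : 0 < x) (hc : 0 < c) : 0 ≤ bregman x c := by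
  have h := Real.log_le_sub_one_of_pos (div_pos hc hx)
  rw [Real.log_div hc.ne' hx.ne'] at h
  have h2 : x * (Real.log c - Real.log x) ≤ x * (c / x - 1) := by gcongr
  have h3 : x * (c / x - 1) = c - x := by field_simp
  unfold bregman; nlinarith

/-- The right side minus the left has derivative (t - 1)³/t, hence its minimum 0 at t = 1. -/
theorem log_le_cubic {t : ℝ} (ht : 0 < t) :
    Real.log t ≤ (t - 1) - (t - 1) ^ 2 / 2 + (t - 1) ^ 3 / 3 := by
  set φ : ℝ → ℝ := fun t => (t - 1) - (t - 1) ^ 2 / 2 + (t - 1) ^ 3 / 3 - Real.log t with hφ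
  have hd : ∀ s : ℝ, 0 < s → HasDerivAt φ ((s - 1) ^ 3 / s) s := by
    intro s hs
    have h1 : HasDerivAt (fun t : ℝ => t - 1) 1 s := (hasDerivAt_id s).sub_const 1
    have := ((h1.sub ((h1.pow 2).div_const 2)).add ((h1.pow 3).div_const 3)).sub
      (Real.hasDerivAt_log hs.ne')
    refine this.congr_deriv ?_
    have hs' := hs.ne'
    simp only [Nat.cast_ofNat, Nat.add_one_sub_one]
    field_simp
    ring
  have h1 : φ 1 = 0 := by simp [hφ]
  suffices 0 ≤ φ t by simp only [hφ] at this; linarith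
  rcases le_total 1 t with h | h
  · have mono : MonotoneOn φ (Set.Ici 1) := by
      apply monotoneOn_of_deriv_nonneg (convex_Ici 1)
      · exact fun s hs => (hd s (lt_of_lt_of_le one_pos hs)).continuousAt.continuousWithinAt
      · intro s hs
        rw [interior_Ici] at hs
        exact (hd s (one_pos.trans hs)).differentiableAt.differentiableWithinAt
      · intro s hs
        rw [interior_Ici] at hs
        have hs' : (1 : ℝ) < s := hs
        rw [(hd s (one_pos.trans hs)).deriv]
        have : 0 ≤ s - 1 := by linarith
        positivity
    rw [← h1]; exact mono Set.self_mem_Ici h h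
  · have anti : AntitoneOn φ (Set.Icc t 1) := by
      apply antitoneOn_of_deriv_nonpos (convex_Icc t 1)
      · exact fun s hs => (hd s (ht.trans_le hs.1)).continuousAt.continuousWithinAt
      · intro s hs
        rw [interior_Icc] at hs
        exact (hd s (ht.trans hs.1)).differentiableAt.differentiableWithinAt
      · intro s hs
        rw [interior_Icc] at hs
        rw [(hd s (ht.trans hs.1)).deriv]
        have h2 : 0 ≤ 1 - s := by linarith [hs.2]
        have h3 : (s - 1) ^ 3 = -(1 - s) ^ 3 := by ring
        rw [h3, neg_div]
        have := ht.trans hs.1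
        have : 0 ≤ (1 - s) ^ 3 / s := by positivity
        linarith
    rw [← h1]; exact anti ⟨le_rfl, h⟩ ⟨h, le_rfl⟩ h

/-- The leading coefficient 1/(2c) fixes the Gaussian constant: for F = f² one has |∇F|²/(2F) =
2|∇f|². The remaining terms vanish as x tends to c. -/
theorem bregman_le {x c : ℝ} (hx : 0 < x) (hc : 0 < c) :
    bregman x c ≤ (x - c) ^ 2 * (1 / (2 * c) - (x - c) / (6 * c ^ 2) + (x - c) ^ 2 / (3 * c ^ 3)) := by
  have h := log_le_cubic (div_pos hx hc)
  rw [Real.log_div hx.ne' hc.ne'] at h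
  have h2 := mul_le_mul_of_nonneg_left h hx.le
  have : x * ((x / c - 1) - (x / c - 1) ^ 2 / 2 + (x / c - 1) ^ 3 / 3) - x + c
      = (x - c) ^ 2 * (1 / (2 * c) - (x - c) / (6 * c ^ 2) + (x - c) ^ 2 / (3 * c ^ 3)) := by
    field_simp; ring
  unfold bregman; linarith

theorem abs_log_le_of_mem {δ K x : ℝ} (hδ : 0 < δ) (h1 : δ ≤ x) (h2 : x ≤ K) :
    |Real.log x| ≤ |Real.log δ| + |Real.log K| := by
  have a1 := Real.log_le_log hδ h1
  have a2 := Real.log_le_log (hδ.trans_le h1) h2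
  rw [abs_le]
  constructor
  · linarith [neg_abs_le (Real.log δ), abs_nonneg (Real.log K)]
  · linarith [le_abs_self (Real.log K), abs_nonneg (Real.log δ)]

theorem integrable_of_bounds {E : Type*} [MeasurableSpace E] {μ : Measure E} [IsFiniteMeasure μ]
    {F : E → ℝ} (hF : Measurable F) {δ K : ℝ} (h : ∀ z, δ ≤ F z ∧ F z ≤ K) : Integrable F μ :=
  Integrable.of_bound hF.aestronglyMeasurable (max |δ| |K|) (Eventually.of_forall fun z => by
    rw [Real.norm_eq_abs]; exact abs_le_max_abs_abs (h z).1 (h z).2)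

theorem integrable_mul_log {E : Type*} [MeasurableSpace E] {μ : Measure E} [IsFiniteMeasure μ]
    {F H : E → ℝ} (hF : Measurable F) (hH : Measurable H) {δ K : ℝ} (hδ : 0 < δ)
    (h : ∀ z, δ ≤ F z ∧ F z ≤ K) (h' : ∀ z, δ ≤ H z ∧ H z ≤ K) :
    Integrable (fun z => F z * Real.log (H z)) μ := by
  refine Integrable.of_bound (hF.mul hH.log).aestronglyMeasurable
    (K * (|Real.log δ| + |Real.log K|)) (Eventually.of_forall fun z => ?_)
  rw [norm_mul, Real.norm_eq_abs, Real.norm_eq_abs]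
  have h0 : 0 ≤ F z := hδ.le.trans (h z).1
  rw [abs_of_nonneg h0]
  exact mul_le_mul (h z).2 (abs_log_le_of_mem hδ (h' z).1 (h' z).2) (abs_nonneg _) (h0.trans (h z).2)

theorem integral_mem_bounds {E : Type*} [MeasurableSpace E] {μ : Measure E} [IsProbabilityMeasure μ]
    {F : E → ℝ} (hF : Measurable F) {δ K : ℝ} (h : ∀ z, δ ≤ F z ∧ F z ≤ K) :
    δ ≤ ∫ z, F z ∂μ ∧ ∫ z, F z ∂μ ≤ K := by
  have hi := integrable_of_bounds (μ := μ) hF h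
  constructor
  · have := integral_mono (integrable_const δ) hi (fun z => (h z).1)
    simpa using this
  · have := integral_mono hi (integrable_const K) (fun z => (h z).2)
    simpa using this

/-- The variational bound for the entropy. -/
theorem ent_le_integral_bregman {E : Type*} [MeasurableSpace E] {μ : Measure E}
    [IsProbabilityMeasure μ] {F : E → ℝ} (hF : Measurable F) {δ K : ℝ} (hδ : 0 < δ)
    (h : ∀ z, δ ≤ F z ∧ F z ≤ K) {c : ℝ} (hc : 0 < c) :
    ent μ F ≤ ∫ z, bregman (F z) c ∂μ := by
  have hi := integrable_of_bounds (μ := μ) hF h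
  have hl := integrable_mul_log (μ := μ) hF hF hδ h h
  have hm := (integral_mem_bounds (μ := μ) hF h).1
  -- The gap between the two sides is the Bregman divergence of ∫ F from c.
  have hb := bregman_nonneg (hδ.trans_le hm) hc
  have : ∫ z, bregman (F z) c ∂μ
      = ∫ z, F z * Real.log (F z) ∂μ - (∫ z, F z ∂μ) * Real.log c - ∫ z, F z ∂μ + c := by
    unfold bregman
    rw [integral_add (by fun_prop) (by fun_prop), integral_sub (by fun_prop) (by fun_prop),
      integral_sub (by fun_prop) (by fun_prop), integral_mul_const]
    simp
  rw [this]
  unfold ent bregman at *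
  linarith

theorem ent_map {E E' : Type*} [MeasurableSpace E] [MeasurableSpace E'] {μ : Measure E}
    {T : E → E'} (hT : Measurable T) {F : E' → ℝ} (hF : Measurable F) :
    ent (μ.map T) F = ent μ (fun z => F (T z)) := by
  unfold ent
  rw [integral_map hT.aemeasurable (by fun_prop), integral_map hT.aemeasurable (by fun_prop)]

/-- Subadditivity of the entropy on a product of two probability spaces. -/
theorem ent_prod_le {E W : Type*} [MeasurableSpace E] [MeasurableSpace W] {μ : Measure E}
    {ν : Measure W} [IsProbabilityMeasure μ] [IsProbabilityMeasure ν] {F : E × W → ℝ}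
    (hF : Measurable F) {δ K : ℝ} (hδ : 0 < δ) (h : ∀ z, δ ≤ F z ∧ F z ≤ K) :
    ent (μ.prod ν) F ≤ ∫ y, ent μ (fun x => F (x, y)) ∂ν + ∫ x, ent ν (fun y => F (x, y)) ∂μ := by
  set A : E → ℝ := fun x => ∫ y, F (x, y) ∂ν with hA
  set B : W → ℝ := fun y => ∫ x, F (x, y) ∂μ with hB
  have hAm : Measurable A := hF.stronglyMeasurable.integral_prod_right'.measurable
  have hBm : Measurable B := hF.stronglyMeasurable.integral_prod_left'.measurable
  have hAb : ∀ x, δ ≤ A x ∧ A x ≤ K := fun x =>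
    integral_mem_bounds (F := fun y => F (x, y)) (by fun_prop) (fun y => h _)
  have hBb : ∀ y, δ ≤ B y ∧ B y ≤ K := fun y =>
    integral_mem_bounds (F := fun x => F (x, y)) (by fun_prop) (fun y => h _)
  set I := ∫ z, F z * Real.log (F z) ∂(μ.prod ν) with hI
  set m := ∫ z, F z ∂(μ.prod ν) with hm
  have hFi : Integrable F (μ.prod ν) := integrable_of_bounds hF h
  have hFl : Integrable (fun z => F z * Real.log (F z)) (μ.prod ν) :=
    integrable_mul_log hF hF hδ h h
  have hFA : Integrable (fun z => F z * Real.log (A z.1)) (μ.prod ν) :=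
    integrable_mul_log hF (by fun_prop) hδ h (fun z => hAb _)
  have hFB : Integrable (fun z => F z * Real.log (B z.2)) (μ.prod ν) :=
    integrable_mul_log hF (by fun_prop) hδ h (fun z => hBb _)
  have hAB : Integrable (fun z : E × W => A z.1 * B z.2) (μ.prod ν) :=
    (integrable_of_bounds (μ := μ) hAm hAb).mul_prod (integrable_of_bounds (μ := ν) hBm hBb)
  have hm0 : 0 < m := hδ.trans_le (integral_mem_bounds hF h).1
  have mA : ∫ x, A x ∂μ = m := (integral_prod _ hFi).symm
  have mB : ∫ y, B y ∂ν = m := (integral_prod_symm _ hFi).symm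
  have iA : ∫ z, F z * Real.log (A z.1) ∂(μ.prod ν) = ∫ x, A x * Real.log (A x) ∂μ := by
    rw [integral_prod _ hFA]
    simp only [integral_mul_const, hA]
  have iB : ∫ z, F z * Real.log (B z.2) ∂(μ.prod ν) = ∫ y, B y * Real.log (B y) ∂ν := by
    rw [integral_prod_symm _ hFB]
    simp only [integral_mul_const, hB]
  have e1 : ∫ x, ent ν (fun y => F (x, y)) ∂μ = I - ∫ x, A x * Real.log (A x) ∂μ := by
    unfold ent
    rw [integral_sub hFl.integral_prod_left (integrable_mul_log hAm hAm hδ hAb hAb),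
      ← integral_prod _ hFl]
  have e2 : ∫ y, ent μ (fun x => F (x, y)) ∂ν = I - ∫ y, B y * Real.log (B y) ∂ν := by
    unfold ent
    rw [integral_sub hFl.integral_prod_right (integrable_mul_log hBm hBm hδ hBb hBb),
      ← integral_prod_symm _ hFl]
  -- The defect of subadditivity is the relative entropy of F with respect to the product A B / m of
  -- its marginals; the integrand is the Bregman divergence of F from that product.
  have pos : 0 ≤ ∫ z, (F z * Real.log (F z) - F z * Real.log (A z.1) - F z * Real.log (B z.2)
      + F z * Real.log m - F z + A z.1 * B z.2 / m) ∂(μ.prod ν) := by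
    refine integral_nonneg fun z => ?_
    have a0 := hδ.trans_le (hAb z.1).1
    have b0 := hδ.trans_le (hBb z.2).1
    have f0 := hδ.trans_le (h z).1
    have := bregman_nonneg f0 (div_pos (mul_pos a0 b0) hm0)
    unfold bregman at this
    rw [Real.log_div (by positivity) hm0.ne', Real.log_mul a0.ne' b0.ne'] at this
    simp only [Pi.zero_apply]
    linarith
  rw [integral_add (by fun_prop) (by fun_prop), integral_sub (by fun_prop) (by fun_prop),
    integral_add (by fun_prop) (by fun_prop), integral_sub (by fun_prop) (by fun_prop),
    integral_sub (by fun_prop) (by fun_prop), iA, iB, integral_mul_const, integral_div,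
    integral_prod_mul (f := A) (g := B), mA, mB, mul_div_assoc, div_self hm0.ne'] at pos
  rw [e1, e2]
  unfold ent
  simp only [← hI, ← hm] at *
  linarith

theorem exists_abs_mul_log_le (K : ℝ) : ∃ B : ℝ, ∀ t, 0 ≤ t → t ≤ K → |t * Real.log t| ≤ B := by
  obtain ⟨B, hB⟩ := (isCompact_Icc (a := (0 : ℝ)) (b := K)).exists_bound_of_continuousOn
    Real.continuous_mul_log.continuousOn
  exact ⟨B, fun t h0 h1 => hB t ⟨h0, h1⟩⟩

/-- Bounded convergence. The functions may vanish, because t log t is bounded on bounded intervals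
and continuous at 0. -/
theorem tendsto_ent {E : Type*} [MeasurableSpace E] {μ : Measure E} [IsFiniteMeasure μ]
    {F : ℕ → E → ℝ} {F' : E → ℝ} (hF : ∀ n, Measurable (F n)) {K : ℝ}
    (hb : ∀ n z, 0 ≤ F n z ∧ F n z ≤ K) (hlim : ∀ z, Tendsto (fun n => F n z) atTop (𝓝 (F' z))) :
    Tendsto (fun n => ent μ (F n)) atTop (𝓝 (ent μ F')) := by
  obtain ⟨B, hB⟩ := exists_abs_mul_log_le K
  have h1 : Tendsto (fun n => ∫ z, F n z ∂μ) atTop (𝓝 (∫ z, F' z ∂μ)) := by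
    refine tendsto_integral_of_dominated_convergence (fun _ => K)
      (fun n => (hF n).aestronglyMeasurable) (integrable_const K) (fun n => ?_)
      (Eventually.of_forall hlim)
    exact Eventually.of_forall fun z => by
      rw [Real.norm_eq_abs, abs_of_nonneg (hb n z).1]; exact (hb n z).2
  have h2 : Tendsto (fun n => ∫ z, F n z * Real.log (F n z) ∂μ) atTop
      (𝓝 (∫ z, F' z * Real.log (F' z) ∂μ)) := by
    refine tendsto_integral_of_dominated_convergence (fun _ => B)
      (fun n => ((hF n).mul (hF n).log).aestronglyMeasurable) (integrable_const B) (fun n => ?_)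
      (Eventually.of_forall fun z => (Real.continuous_mul_log.tendsto _).comp (hlim z))
    exact Eventually.of_forall fun z => hB _ (hb n z).1 (hb n z).2
  exact h2.sub ((Real.continuous_mul_log.tendsto _).comp h1)

/-! ### Reduction of the inequality to functions bounded below. -/

section LSI

variable {E : Type*} [NormedAddCommGroup E] [NormedSpace ℝ E] [MeasurableSpace E]

theorem satisfiesLSI_iff {μ : Measure E} {C : ℝ} : SatisfiesLSI μ C ↔
    ∀ f : E → ℝ, ContDiff ℝ 1 f → (∃ K : ℝ, ∀ z, |f z| ≤ K ∧ ‖fderiv ℝ f z‖ ≤ K) →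
      ent μ (fun z => f z ^ 2) ≤ C * ∫ z, ‖fderiv ℝ f z‖ ^ 2 ∂μ := Iff.rfl

theorem SatisfiesLSI.mono {μ : Measure E} {C C' : ℝ} (h : SatisfiesLSI μ C) (hC : C ≤ C') :
    SatisfiesLSI μ C' := fun f hf hK =>
  (h f hf hK).trans (mul_le_mul_of_nonneg_right hC (integral_nonneg fun _ => by positivity))

theorem hasFDerivAt_sqrt_sq_add {E : Type*} [NormedAddCommGroup E] [NormedSpace ℝ E] {f : E → ℝ} (hf : ContDiff ℝ 1 f) {δ : ℝ} (hδ : 0 < δ) (z : E) :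
    HasFDerivAt (fun z => √(f z ^ 2 + δ ^ 2)) ((f z / √(f z ^ 2 + δ ^ 2)) • fderiv ℝ f z) z := by
  have h1 := (hf.differentiable one_ne_zero z).hasFDerivAt
  have h2 : HasFDerivAt (fun z => f z ^ 2 + δ ^ 2) ((2 * f z) • fderiv ℝ f z) z := by
    have := (h1.pow 2).add_const (δ ^ 2)
    refine this.congr_fderiv ?_
    ext y
    simp
  have := h2.sqrt (by positivity)
  convert this using 1
  rw [smul_smul]
  congr 1
  field_simp

/-- It suffices to check the logarithmic Sobolev inequality on functions bounded away from `0`. -/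
theorem satisfiesLSI_of_pos {μ : Measure E} [IsProbabilityMeasure μ] {C : ℝ} (hC : 0 ≤ C)
    [BorelSpace E]
    (h : ∀ f : E → ℝ, ContDiff ℝ 1 f → ∀ δ K : ℝ, 0 < δ → (∀ z, δ ≤ f z ∧ f z ≤ K) →
      (∀ z, ‖fderiv ℝ f z‖ ≤ K) → ent μ (fun z => f z ^ 2) ≤ C * ∫ z, ‖fderiv ℝ f z‖ ^ 2 ∂μ) :
    SatisfiesLSI μ C := by
  rw [satisfiesLSI_iff]
  rintro f hf ⟨K, hK⟩
  -- Replace f by √(f² + δ²): it is at least δ, its gradient is no longer than that of f, and its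
  -- square tends to f² as δ tends to 0.
  set δ : ℕ → ℝ := fun n => 1 / (n + 1) with hδ
  have hδ0 : ∀ n, 0 < δ n := fun n => by positivity
  have hδ1 : ∀ n, δ n ≤ 1 := fun n => by
    simp only [hδ]; rw [div_le_one (by positivity)]; linarith [(Nat.cast_nonneg n : (0 : ℝ) ≤ n)]
  have hδl : Tendsto δ atTop (𝓝 0) := tendsto_one_div_add_atTop_nhds_zero_nat
  have hK0 : 0 ≤ K := (abs_nonneg _).trans (hK 0).1
  have hle : ∀ n z, |f z / √(f z ^ 2 + δ n ^ 2)| ≤ 1 := by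
    intro n z
    have h0 : 0 < √(f z ^ 2 + δ n ^ 2) := by have := hδ0 n; positivity
    rw [abs_div, abs_of_pos h0, div_le_one h0]
    exact Real.abs_le_sqrt (by nlinarith [sq_nonneg (δ n)])
  have hfd : ∀ n z, ‖fderiv ℝ (fun z => √(f z ^ 2 + δ n ^ 2)) z‖ ≤ ‖fderiv ℝ f z‖ := by
    intro n z
    rw [(hasFDerivAt_sqrt_sq_add hf (hδ0 n) z).fderiv, norm_smul, Real.norm_eq_abs]
    exact mul_le_of_le_one_left (norm_nonneg _) (hle n z)
  have hfm : Continuous fun z => ‖fderiv ℝ f z‖ := (hf.continuous_fderiv one_ne_zero).norm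
  have hInt : Integrable (fun z => ‖fderiv ℝ f z‖ ^ 2) μ :=
    integrable_of_bounds (hfm.pow 2).measurable (δ := 0) (K := K ^ 2) fun z =>
      ⟨by positivity, by gcongr; exact (hK z).2⟩
  have main : ∀ n, ent μ (fun z => f z ^ 2 + δ n ^ 2) ≤ C * ∫ z, ‖fderiv ℝ f z‖ ^ 2 ∂μ := by
    intro n
    have hsq : ∀ z, √(f z ^ 2 + δ n ^ 2) ^ 2 = f z ^ 2 + δ n ^ 2 := fun z =>
      Real.sq_sqrt (by positivity)
    have hcd : ContDiff ℝ 1 (fun z => √(f z ^ 2 + δ n ^ 2)) :=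
      ((hf.pow 2).add contDiff_const).sqrt fun z => by have := hδ0 n; positivity
    have := h (fun z => √(f z ^ 2 + δ n ^ 2)) hcd (δ n) (K + 1) (hδ0 n)
      (fun z => ⟨Real.le_sqrt_of_sq_le (by nlinarith [sq_nonneg (f z)]), by
        rw [Real.sqrt_le_left (by positivity)]
        have h1 := sq_le_sq' (neg_le_of_abs_le (hK z).1) (le_of_abs_le (hK z).1)
        have h2 : δ n ^ 2 ≤ 1 := pow_le_one₀ (hδ0 n).le (hδ1 n)
        nlinarith⟩)
      (fun z => (hfd n z).trans ((hK z).2.trans (by linarith)))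
    simp only [hsq] at this
    refine this.trans (mul_le_mul_of_nonneg_left ?_ hC)
    refine integral_mono_of_nonneg (Eventually.of_forall fun z => by positivity) hInt
      (Eventually.of_forall fun z => ?_)
    have := hfd n z
    simp only
    gcongr
  refine le_of_tendsto' (tendsto_ent (K := K ^ 2 + 1) (fun n => ?_) (fun n z => ⟨by positivity, ?_⟩)
    fun z => ?_) main
  · have := hf.continuous.measurable
    fun_prop
  · have h1 := sq_le_sq' (neg_le_of_abs_le (hK z).1) (le_of_abs_le (hK z).1)
    have h2 : δ n ^ 2 ≤ 1 := pow_le_one₀ (hδ0 n).le (hδ1 n)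
    linarith
  · have := (tendsto_const_nhds (x := f z ^ 2)).add (hδl.pow 2)
    simpa using this

end LSI

/-! ### Entropy of a Gaussian as a sum of small independent increments. -/

section Convolution

variable {W : Type*} [NormedAddCommGroup W] [InnerProductSpace ℝ W] [MeasurableSpace W]
  [BorelSpace W] [FiniteDimensional ℝ W]

theorem stdGaussian_smul_conv (α β : ℝ) :
    (((stdGaussian W).map (α • ·)).prod ((stdGaussian W).map (β • ·))).map (fun p => p.1 + p.2)
      = (stdGaussian W).map (√(α ^ 2 + β ^ 2) • ·) := by
  have p1 : IsProbabilityMeasure ((stdGaussian W).map (α • ·)) :=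
    Measure.isProbabilityMeasure_map (by fun_prop)
  have p2 : IsProbabilityMeasure ((stdGaussian W).map (β • ·)) :=
    Measure.isProbabilityMeasure_map (by fun_prop)
  have p3 : IsProbabilityMeasure ((stdGaussian W).map (√(α ^ 2 + β ^ 2) • ·)) :=
    Measure.isProbabilityMeasure_map (by fun_prop)
  change Measure.conv _ _ = _
  apply Measure.ext_of_charFun
  ext t
  rw [charFun_conv, charFun_map_smul, charFun_map_smul, charFun_map_smul, charFun_stdGaussian,
    charFun_stdGaussian, charFun_stdGaussian, ← Complex.exp_add]
  congr 1
  have hn : ∀ c : ℝ, ((‖c • t‖ : ℝ) : ℂ) ^ 2 = ((c ^ 2 * ‖t‖ ^ 2 : ℝ) : ℂ) := fun c => by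
    rw [← Complex.ofReal_pow, norm_smul, mul_pow, Real.norm_eq_abs, sq_abs]
  rw [hn, hn, hn, Real.sq_sqrt (by positivity)]
  push_cast
  ring

theorem bregman_bound {δ K x c : ℝ} (hδ : 0 < δ) (hx : δ ≤ x ∧ x ≤ K) (hc : δ ≤ c ∧ c ≤ K) :
    0 ≤ bregman x c ∧ bregman x c ≤ 2 * K * (|Real.log δ| + |Real.log K|) + K := by
  have x0 := hδ.trans_le hx.1
  have c0 := hδ.trans_le hc.1
  refine ⟨bregman_nonneg x0 c0, ?_⟩
  set L := |Real.log δ| + |Real.log K|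
  have l1 := abs_le.1 (abs_log_le_of_mem hδ hx.1 hx.2)
  have l2 := abs_le.1 (abs_log_le_of_mem hδ hc.1 hc.2)
  have hL : 0 ≤ L := by positivity
  have h1 : x * Real.log x ≤ K * L := mul_le_mul_of_abs_le x0.le hx.2 (abs_le.2 l1)
  have h2 : x * (-Real.log c) ≤ K * L :=
    mul_le_mul_of_abs_le x0.le hx.2 (by rw [abs_neg]; exact abs_le.2 l2)
  unfold bregman
  linarith [hc.2]

theorem Measurable.bregman {α : Type*} [MeasurableSpace α] {f g : α → ℝ} (hf : Measurable f)
    (hg : Measurable g) : Measurable fun z => bregman (f z) (g z) := by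
  unfold _root_.bregman; fun_prop

/-- The entropy with respect to a `k`-fold convolution power is controlled by `k` times the
average relative increment of the last factor. -/
theorem ent_conv_pow_le {ν : Measure W} [IsProbabilityMeasure ν] (ρ : ℕ → Measure W)
    [∀ k, IsProbabilityMeasure (ρ k)] (h0 : ρ 0 = Measure.dirac 0)
    (hρ : ∀ k, ρ (k + 1) = ((ρ k).prod ν).map (fun p => p.1 + p.2)) (k : ℕ) {δ K : ℝ}
    (hδ : 0 < δ) : ∀ {F : W → ℝ}, Measurable F → (∀ z, δ ≤ F z ∧ F z ≤ K) →
    ent (ρ (k + 1)) F ≤ (k + 1) * ∫ x, ∫ g, bregman (F (x + g)) (F x) ∂ν ∂(ρ k) := by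
  -- Subadditivity splits off the last increment. Its conditional entropy is bounded by the
  -- divergence centred at F x, the value before the increment, so that no conditional mean has to
  -- be computed.
  have step : ∀ k, ∀ {F : W → ℝ}, Measurable F → (∀ z, δ ≤ F z ∧ F z ≤ K) →
      ent (ρ (k + 1)) F ≤ ∫ y, ent (ρ k) (fun x => F (x + y)) ∂ν
        + ∫ x, ∫ g, bregman (F (x + g)) (F x) ∂ν ∂(ρ k) := by
    intro k F hF hb
    rw [hρ, ent_map (by fun_prop) hF]
    refine (ent_prod_le (F := fun p : W × W => F (p.1 + p.2)) (by fun_prop) hδ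
      (fun z => hb _)).trans ?_
    refine add_le_add le_rfl ?_
    have hjm : Measurable fun p : W × W => bregman (F (p.1 + p.2)) (F p.1) :=
      (hF.comp (by fun_prop)).bregman (hF.comp (by fun_prop))
    have hm : Measurable fun x => ∫ g, bregman (F (x + g)) (F x) ∂ν :=
      hjm.stronglyMeasurable.integral_prod_right'.measurable
    have hD : Integrable (fun x => ∫ g, bregman (F (x + g)) (F x) ∂ν) (ρ k) := by
      refine integrable_of_bounds hm (fun x => ?_)
        (δ := 0) (K := 2 * K * (|Real.log δ| + |Real.log K|) + K)
      exact integral_mem_bounds (hjm.comp (measurable_prodMk_left (x := x))) fun g => bregman_bound hδ (hb _) (hb _)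
    have hjm2 : Measurable fun p : W × W => F (p.1 + p.2) := by fun_prop
    refine integral_mono ?_ hD fun x => ent_le_integral_bregman (by fun_prop) hδ (fun z => hb _)
      (hδ.trans_le (hb x).1)
    · unfold ent
      have i1 := (integrable_mul_log (μ := (ρ k).prod ν) hjm2 hjm2 hδ
        (fun z => hb _) (fun z => hb _)).integral_prod_left
      have hA : Measurable fun x => ∫ g, F (x + g) ∂ν :=
        hjm2.stronglyMeasurable.integral_prod_right'.measurable
      have hAb : ∀ x, δ ≤ ∫ g, F (x + g) ∂ν ∧ ∫ g, F (x + g) ∂ν ≤ K := fun x =>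
        integral_mem_bounds (by fun_prop) fun g => hb _
      exact i1.sub (integrable_mul_log hA hA hδ hAb hAb)
  induction k with
  | zero =>
    intro F hF hb
    refine (step 0 hF hb).trans ?_
    have : ∀ y, ent (ρ 0) (fun x => F (x + y)) = 0 := by
      intro y
      rw [h0]; unfold ent
      rw [integral_dirac' _ _ (Measurable.stronglyMeasurable (by fun_prop)),
        integral_dirac' _ _ (Measurable.stronglyMeasurable (by fun_prop))]
      simp
    simp [this]
  | succ k ih =>
    intro F hF hb
    refine (step (k + 1) hF hb).trans ?_
    set D : W → ℝ := fun x => ∫ g, bregman (F (x + g)) (F x) ∂ν with hDdef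
    have hjm : Measurable fun p : W × W => bregman (F (p.1 + p.2)) (F p.1) :=
      (hF.comp (by fun_prop)).bregman (hF.comp (by fun_prop))
    have hm : Measurable D := hjm.stronglyMeasurable.integral_prod_right'.measurable
    have hDb : ∀ x, 0 ≤ D x ∧ D x ≤ 2 * K * (|Real.log δ| + |Real.log K|) + K := fun x =>
      integral_mem_bounds (hjm.comp (measurable_prodMk_left (x := x))) fun g => bregman_bound hδ (hb _) (hb _)
    have hDi : Integrable (fun p : W × W => D (p.1 + p.2)) ((ρ k).prod ν) :=
      integrable_of_bounds (hm.comp (by fun_prop)) fun p => hDb _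
    -- Averaging the translates over y turns `ρ k` into `ρ (k + 1)`, so the bound for each earlier
    -- increment becomes the same as that for the last.
    have e1 : ∫ y, ((k : ℝ) + 1) * ∫ x, D (x + y) ∂(ρ k) ∂ν = (k + 1) * ∫ x, D x ∂(ρ (k + 1)) := by
      rw [integral_const_mul, hρ, integral_map (by fun_prop) hm.aestronglyMeasurable,
        integral_prod_symm _ hDi]
    have e2 : ∫ y, ent (ρ (k + 1)) (fun x => F (x + y)) ∂ν
        ≤ ∫ y, ((k : ℝ) + 1) * ∫ x, D (x + y) ∂(ρ k) ∂ν := by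
      have hjm2 : Measurable fun p : W × W => F (p.1 + p.2) := by fun_prop
      refine integral_mono ?_ (hDi.integral_prod_right.const_mul _) fun y => ?_
      · unfold ent
        have i1 := (integrable_mul_log (μ := (ρ (k + 1)).prod ν) hjm2 hjm2 hδ
          (fun z => hb _) (fun z => hb _)).integral_prod_right
        have hA : Measurable fun y => ∫ x, F (x + y) ∂(ρ (k + 1)) :=
          hjm2.stronglyMeasurable.integral_prod_left'.measurable
        have hAb : ∀ y, δ ≤ ∫ x, F (x + y) ∂(ρ (k + 1)) ∧ ∫ x, F (x + y) ∂(ρ (k + 1)) ≤ K := fun y =>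
          integral_mem_bounds (by fun_prop) fun g => hb _
        exact i1.sub (integrable_mul_log hA hA hδ hAb hAb)
      · have := ih (F := fun x => F (x + y)) (by fun_prop) (fun z => hb _)
        simp only [add_right_comm _ _ y] at this
        exact this
    rw [e1] at e2
    push_cast
    linarith

/-- The Gaussian entropy is bounded by rescaled small Gaussian increments. -/
theorem ent_stdGaussian_le (k : ℕ) {δ K : ℝ} (hδ : 0 < δ) {F : W → ℝ} (hF : Measurable F)
    (hb : ∀ z, δ ≤ F z ∧ F z ≤ K) :
    ent (stdGaussian W) F ≤ (k + 1) * ∫ p, bregman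
      (F (√(k / (k + 1)) • p.1 + (1 / √(k + 1)) • p.2)) (F (√(k / (k + 1)) • p.1))
        ∂((stdGaussian W).prod (stdGaussian W)) := by
  set ν := (stdGaussian W).map ((1 / √((k : ℝ) + 1)) • ·) with hν
  -- `ρ j` is the centred Gaussian with covariance j/(k + 1); it starts at the Dirac mass and is
  -- standard at j = k + 1.
  set ρ : ℕ → Measure W := fun j => (stdGaussian W).map (√((j : ℝ) / (k + 1)) • ·) with hρ
  have pν : IsProbabilityMeasure ν := Measure.isProbabilityMeasure_map (by fun_prop)
  have pρ : ∀ j, IsProbabilityMeasure (ρ j) := fun j =>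
    Measure.isProbabilityMeasure_map (by fun_prop)
  have h0 : ρ 0 = Measure.dirac 0 := by
    simp [hρ]
  have hs : ∀ j, ρ (j + 1) = ((ρ j).prod ν).map (fun p => p.1 + p.2) := by
    intro j
    simp only [hρ, hν]
    rw [stdGaussian_smul_conv]
    congr 2
    ext x
    congr 2
    rw [Real.sq_sqrt (by positivity), div_pow, Real.sq_sqrt (by positivity)]
    push_cast
    ring
  have := ent_conv_pow_le ρ h0 hs k hδ hF hb
  have hid : ρ (k + 1) = stdGaussian W := by
    simp only [hρ]
    push_cast
    rw [div_self (by positivity)]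
    simp
  rw [hid] at this
  refine this.trans (le_of_eq ?_)
  congr 1
  have hjm : Measurable fun p : W × W => bregman (F (p.1 + p.2)) (F p.1) :=
    (hF.comp (by fun_prop)).bregman (hF.comp (by fun_prop))
  have hjm' : Measurable fun p : W × W => bregman
      (F (√(k / (k + 1)) • p.1 + (1 / √(k + 1)) • p.2)) (F (√(k / (k + 1)) • p.1)) :=
    (hF.comp (by fun_prop)).bregman (hF.comp (by fun_prop))
  rw [integral_prod _ (integrable_of_bounds hjm' fun p => bregman_bound hδ (hb _) (hb _))]
  simp only [hρ]
  rw [integral_map (by fun_prop) hjm.stronglyMeasurable.integral_prod_right'.aestronglyMeasurable]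
  congr 1
  ext x
  exact integral_map (by fun_prop)
    (hjm.comp (measurable_prodMk_left (x := √(k / (k + 1)) • x))).aestronglyMeasurable
end Convolution

/-! ### The Gaussian logarithmic Sobolev inequality in the limit of small increments. -/

section Gaussian

variable {W : Type*} [NormedAddCommGroup W] [InnerProductSpace ℝ W] [MeasurableSpace W]
  [BorelSpace W] [FiniteDimensional ℝ W]

theorem integral_sq_stdGaussian (ℓ : StrongDual ℝ W) :
    ∫ g, (ℓ g) ^ 2 ∂(stdGaussian W) = ‖ℓ‖ ^ 2 := by
  rw [← variance_dual_stdGaussian ℓ, variance_of_integral_eq_zero (by fun_prop)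
    (integral_strongDual_stdGaussian ℓ)]

theorem integrable_norm_sq_stdGaussian : Integrable (fun g : W => ‖g‖ ^ 2) (stdGaussian W) := by
  have := (IsGaussian.memLp_two_id (μ := stdGaussian W)).integrable_norm_pow two_ne_zero
  simpa using this

theorem norm_sub_le_of_norm_fderiv_le {E F : Type*} [NormedAddCommGroup E] [NormedSpace ℝ E]
    [NormedAddCommGroup F] [NormedSpace ℝ F] {f : E → F} (hf : Differentiable ℝ f) {K : ℝ}
    (h : ∀ z, ‖fderiv ℝ f z‖ ≤ K) (x y : E) : ‖f y - f x‖ ≤ K * ‖y - x‖ :=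
  convex_univ.norm_image_sub_le_of_norm_fderiv_le (fun z _ => hf z) (fun z _ => h z)
    (Set.mem_univ x) (Set.mem_univ y)

/-- Difference quotients of a `C¹` function along moving base points. -/
theorem tendsto_strict_quotient {W : Type*} [NormedAddCommGroup W] [NormedSpace ℝ W] {F : W → ℝ} (hF : ContDiff ℝ 1 F) {p : ℕ → W} {x : W}
    (hp : Tendsto p atTop (𝓝 x)) {s : ℕ → ℝ} (hs : Tendsto s atTop (𝓝 0)) (hs0 : ∀ n, 0 < s n)
    (g : W) :
    Tendsto (fun n => (1 / s n) * (F (p n + s n • g) - F (p n))) atTop (𝓝 (fderiv ℝ F x g)) := by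
  -- The base points move with n, so differentiability at x alone would not suffice.
  have hd := (hF.contDiffAt (x := x)).hasStrictFDerivAt one_ne_zero
  have h2 : Tendsto (fun n => p n + s n • g) atTop (𝓝 x) := by
    simpa using hp.add (hs.smul_const g)
  have h3 := hd.isLittleO.comp_tendsto (h2.prodMk_nhds hp)
  have h4 : (fun n => F (p n + s n • g) - F (p n) - s n * fderiv ℝ F x g) =o[atTop] s := by
    have : (fun n => (p n + s n • g) - p n) =O[atTop] s := by
      simp only [add_sub_cancel_left]
      refine Asymptotics.IsBigO.of_bound ‖g‖ (Eventually.of_forall fun n => ?_)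
      rw [norm_smul, mul_comm]
    refine (h3.trans_isBigO this).congr_left fun n => ?_
    simp
  have h5 := h4.tendsto_div_nhds_zero
  have h6 := h5.add_const (fderiv ℝ F x g)
  rw [zero_add] at h6
  refine h6.congr fun n => ?_
  have := (hs0 n).ne'
  field_simp
  ring

/-- With s = 1/√(k + 1), the factor k + 1 turns the squared increments of F = f² into squared
difference quotients. Their limit in direction g is (∂_g F)²/(2F) = 2(∂_g f)², whose Gaussian
average over g is 2|∇f|². -/
theorem ent_stdGaussian_sq_le {f : W → ℝ} (hf : ContDiff ℝ 1 f) {δ K : ℝ} (hδ : 0 < δ)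
    (hb : ∀ z, δ ≤ f z ∧ f z ≤ K) (hd : ∀ z, ‖fderiv ℝ f z‖ ≤ K) :
    ent (stdGaussian W) (fun z => f z ^ 2) ≤ 2 * ∫ z, ‖fderiv ℝ f z‖ ^ 2 ∂(stdGaussian W) := by
  set γ := stdGaussian W
  have hK : 0 < K := hδ.trans_le ((hb 0).1.trans (hb 0).2)
  set F : W → ℝ := fun z => f z ^ 2 with hF
  have hFc : ContDiff ℝ 1 F := hf.pow 2
  have hFm : Measurable F := hFc.continuous.measurable
  have hFb : ∀ z, δ ^ 2 ≤ F z ∧ F z ≤ K ^ 2 := fun z =>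
    ⟨by have := (hb z).1; simp only [hF]; gcongr,
      by have h1 := (hb z).1; have h2 := (hb z).2; simp only [hF]; have h0 := hδ.le.trans h1; gcongr⟩
  set s : ℕ → ℝ := fun k => 1 / √((k : ℝ) + 1) with hs
  set q : ℕ → ℝ := fun k => √((k : ℝ) / (k + 1)) with hq
  have hs0 : ∀ k, 0 < s k := fun k => by positivity
  have hs2 : ∀ k, (1 / s k) ^ 2 = (k : ℝ) + 1 := fun k => by
    simp only [hs, one_div, inv_inv]; rw [Real.sq_sqrt (by positivity)]
  have hsl : Tendsto s atTop (𝓝 0) := by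
    have := (tendsto_one_div_add_atTop_nhds_zero_nat (𝕜 := ℝ)).sqrt
    simpa [hs] using this
  have hql : Tendsto q atTop (𝓝 1) := by
    have := (tendsto_natCast_div_add_atTop (1 : ℝ)).sqrt
    simpa [hq] using this
  set U : ℕ → W × W → ℝ := fun k p =>
    ((1 / s k) * (F (q k • p.1 + s k • p.2) - F (q k • p.1))) ^ 2
      * (1 / (2 * F (q k • p.1)) - (F (q k • p.1 + s k • p.2) - F (q k • p.1)) / (6 * F (q k • p.1) ^ 2)
        + (F (q k • p.1 + s k • p.2) - F (q k • p.1)) ^ 2 / (3 * F (q k • p.1) ^ 3)) with hU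
  have hUm : ∀ k, Measurable (U k) := fun k => by simp only [hU]; fun_prop
  have hle : ∀ (k : ℕ) (p : W × W), ((k : ℝ) + 1) * bregman (F (q k • p.1 + s k • p.2)) (F (q k • p.1)) ≤ U k p := by
    intro k p
    have := bregman_le (x := F (q k • p.1 + s k • p.2)) (c := F (q k • p.1))
      (lt_of_lt_of_le (by positivity) (hFb _).1) (lt_of_lt_of_le (by positivity) (hFb _).1)
    simp only [hU]
    rw [mul_pow, hs2, mul_assoc]
    gcongr
  set B : ℝ := 1 / (2 * δ ^ 2) + K ^ 2 / (6 * (δ ^ 2) ^ 2) + (K ^ 2) ^ 2 / (3 * (δ ^ 2) ^ 3) with hB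
  -- A majorant independent of k: increments of F are at most 2K² s |g|, so the squared quotients
  -- grow at most like |g|².
  have hUb : ∀ k p, ‖U k p‖ ≤ (2 * K ^ 2) ^ 2 * ‖p.2‖ ^ 2 * B := by
    intro k p
    set x := F (q k • p.1 + s k • p.2) with hx
    set c := F (q k • p.1) with hc
    have hcb : δ ^ 2 ≤ c := (hFb _).1
    have hc0 : 0 < c := lt_of_lt_of_le (by positivity) hcb
    have hxc : |x - c| ≤ K ^ 2 := by
      have h1 := hFb (q k • p.1 + s k • p.2)
      have h2 := hFb (q k • p.1)
      have : 0 < δ ^ 2 := by positivity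
      rw [abs_le]; constructor <;> linarith
    have hxc2 : |x - c| ≤ 2 * K ^ 2 * (s k * ‖p.2‖) := by
      have h1 := norm_sub_le_of_norm_fderiv_le (hf.differentiable one_ne_zero) hd (q k • p.1)
        (q k • p.1 + s k • p.2)
      rw [add_sub_cancel_left, norm_smul, Real.norm_eq_abs, Real.norm_eq_abs, abs_of_pos (hs0 k)] at h1
      have h2 := hb (q k • p.1 + s k • p.2)
      have h3 := hb (q k • p.1)
      have e : x - c = (f (q k • p.1 + s k • p.2) + f (q k • p.1))
          * (f (q k • p.1 + s k • p.2) - f (q k • p.1)) := by simp only [hx, hc, hF]; ring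
      rw [e, abs_mul, abs_of_nonneg (by linarith)]
      calc _ ≤ (2 * K) * (K * (s k * ‖p.2‖)) := by gcongr; linarith
        _ = _ := by ring
    have a1 : |1 / s k * (x - c)| ≤ 2 * K ^ 2 * ‖p.2‖ := by
      rw [abs_mul, abs_of_pos (by have := hs0 k; positivity)]
      calc 1 / s k * |x - c| ≤ 1 / s k * (2 * K ^ 2 * (s k * ‖p.2‖)) := by
            have := hs0 k; gcongr
        _ = _ := by have := (hs0 k).ne'; field_simp
    have a2 : |1 / (2 * c) - (x - c) / (6 * c ^ 2) + (x - c) ^ 2 / (3 * c ^ 3)| ≤ B := by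
      refine (abs_add_le _ _).trans (add_le_add ((abs_sub _ _).trans (add_le_add ?_ ?_)) ?_)
      · rw [abs_of_pos (by positivity)]; gcongr
      · rw [abs_div, abs_of_pos (show 0 < 6 * c ^ 2 by positivity)]; gcongr
      · rw [abs_div, abs_of_pos (show 0 < 3 * c ^ 3 by positivity), abs_pow]; gcongr
    rw [Real.norm_eq_abs]
    simp only [hU, ← hx, ← hc]
    rw [abs_mul, abs_pow]
    calc _ ≤ (2 * K ^ 2 * ‖p.2‖) ^ 2 * B := by gcongr
      _ = _ := by ring
  have hBi : Integrable (fun p : W × W => (2 * K ^ 2) ^ 2 * ‖p.2‖ ^ 2 * B) (γ.prod γ) := by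
    have := (integrable_norm_sq_stdGaussian (W := W)).comp_snd γ
    exact (this.const_mul _).mul_const _
  have hUi : ∀ k, Integrable (U k) (γ.prod γ) := fun k =>
    hBi.mono' (hUm k).aestronglyMeasurable (Eventually.of_forall (hUb k))
  have hfd : ∀ x, fderiv ℝ F x = (2 * f x) • fderiv ℝ f x := by
    intro x
    have := ((hf.differentiable one_ne_zero x).hasFDerivAt.pow 2).fderiv
    simp only [hF]
    rw [this]; ext y; simp
  have hlim : ∀ p : W × W, Tendsto (fun k => U k p) atTop (𝓝 (2 * (fderiv ℝ f p.1 p.2) ^ 2)) := by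
    intro p
    have hp : Tendsto (fun k => q k • p.1) atTop (𝓝 p.1) := by
      simpa using hql.smul_const p.1
    have hpp : Tendsto (fun k => q k • p.1 + s k • p.2) atTop (𝓝 p.1) := by
      simpa using hp.add (hsl.smul_const p.2)
    have h1 := tendsto_strict_quotient hFc hp hsl hs0 p.2
    have hc := (hFc.continuous.tendsto p.1).comp hp
    have hx := (hFc.continuous.tendsto p.1).comp hpp
    have hF0 : 0 < F p.1 := lt_of_lt_of_le (by positivity) (hFb _).1
    have hdiff := hx.sub hc
    rw [sub_self] at hdiff
    have h2 := (h1.pow 2).mul ((((tendsto_const_nhds (x := (1 : ℝ))).div (hc.const_mul 2)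
      (by positivity)).sub (hdiff.div ((hc.pow 2).const_mul 6) (by positivity))).add
      ((hdiff.pow 2).div ((hc.pow 3).const_mul 3) (by positivity)))
    have e : (fderiv ℝ F p.1 p.2) ^ 2 * (1 / (2 * F p.1) - 0 / (6 * F p.1 ^ 2)
        + 0 ^ 2 / (3 * F p.1 ^ 3)) = 2 * (fderiv ℝ f p.1 p.2) ^ 2 := by
      have hf0 : f p.1 ≠ 0 := (hδ.trans_le (hb p.1).1).ne'
      rw [hfd]
      simp only [smul_apply, smul_eq_mul, hF]
      field_simp
      ring
    rw [e] at h2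
    exact h2
  have hconv := tendsto_integral_of_dominated_convergence _
    (fun k => (hUm k).aestronglyMeasurable) hBi (fun k => Eventually.of_forall (hUb k))
    (Eventually.of_forall hlim)
  have hfin : ∫ p : W × W, 2 * (fderiv ℝ f p.1 p.2) ^ 2 ∂(γ.prod γ)
      = 2 * ∫ z, ‖fderiv ℝ f z‖ ^ 2 ∂γ := by
    have hInt : Integrable (fun p : W × W => (fderiv ℝ f p.1 p.2) ^ 2) (γ.prod γ) := by
      have hi := ((integrable_norm_sq_stdGaussian (W := W)).comp_snd γ).const_mul (K ^ 2)
      refine hi.mono' ?_ (Eventually.of_forall fun p => ?_)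
      · have : Continuous fun p : W × W => fderiv ℝ f p.1 p.2 :=
          ((hf.continuous_fderiv one_ne_zero).comp continuous_fst).clm_apply continuous_snd
        exact (this.pow 2).aestronglyMeasurable
      · rw [norm_pow, ← mul_pow]
        gcongr
        exact (ContinuousLinearMap.le_opNorm _ _).trans (by gcongr; exact hd _)
    rw [integral_const_mul, integral_prod _ hInt]
    simp only [γ, integral_sq_stdGaussian]
  rw [← hfin]
  refine ge_of_tendsto' hconv fun k => ?_
  refine (ent_stdGaussian_le k (by positivity) hFm hFb).trans ?_
  rw [← integral_const_mul]
  refine integral_mono_of_nonneg (Eventually.of_forall fun p => ?_) (hUi k)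
    (Eventually.of_forall fun p => hle k p)
  have := (bregman_bound (by positivity) (hFb (q k • p.1 + s k • p.2)) (hFb (q k • p.1))).1
  simp only [Pi.zero_apply]
  positivity

/-- **Gross' logarithmic Sobolev inequality** for the standard Gaussian measure. -/
theorem satisfiesLSI_stdGaussian : SatisfiesLSI (stdGaussian W) 2 :=
  satisfiesLSI_of_pos (by norm_num) fun _ hf _ _ hδ hb hd => ent_stdGaussian_sq_le hf hδ hb hd

end Gaussian

/-! ### Stability of logarithmic Sobolev inequalities. -/

/-- Propagation of logarithmic Sobolev inequalities through maps of two independent variables. -/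
theorem SatisfiesLSI.map_prod {E W E' : Type*} [NormedAddCommGroup E] [NormedSpace ℝ E]
    [MeasurableSpace E] [BorelSpace E] [SecondCountableTopology E]
    [NormedAddCommGroup W] [NormedSpace ℝ W] [MeasurableSpace W] [BorelSpace W]
    [SecondCountableTopology W] [NormedAddCommGroup E'] [NormedSpace ℝ E'] [MeasurableSpace E']
    [BorelSpace E'] {μ : Measure E} {ν : Measure W} [IsProbabilityMeasure μ]
    [IsProbabilityMeasure ν] {C C' : ℝ} (hμ : SatisfiesLSI μ C) (hν : SatisfiesLSI ν C')
    (hC : 0 ≤ C) (hC' : 0 ≤ C') {T : E × W → E'} (hT : ContDiff ℝ 1 T) {r s : ℝ≥0}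
    (hr : ∀ y, LipschitzWith r (fun x => T (x, y))) (hs : ∀ x, LipschitzWith s (fun y => T (x, y))) :
    SatisfiesLSI ((μ.prod ν).map T) (r ^ 2 * C + s ^ 2 * C') := by
  have hTm : Measurable T := hT.continuous.measurable
  have : IsProbabilityMeasure ((μ.prod ν).map T) :=
    Measure.isProbabilityMeasure_map hTm.aemeasurable
  refine satisfiesLSI_of_pos (by positivity) fun f hf δ K hδ hb hd => ?_
  have hK : 0 ≤ K := (norm_nonneg _).trans (hd 0)
  have hfm : Measurable f := hf.continuous.measurable
  have hgc : Continuous fun z => ‖fderiv ℝ f z‖ ^ 2 :=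
    (hf.continuous_fderiv one_ne_zero).norm.pow 2
  rw [ent_map hTm (by fun_prop), integral_map hTm.aemeasurable hgc.aestronglyMeasurable]
  have hsec1 : ∀ y, ContDiff ℝ 1 fun x => T (x, y) := fun y =>
    hT.comp (contDiff_id.prodMk contDiff_const)
  have hsec2 : ∀ x, ContDiff ℝ 1 fun y => T (x, y) := fun x =>
    hT.comp (contDiff_const.prodMk contDiff_id)
  have d1 : ∀ x y, ‖fderiv ℝ (fun x => f (T (x, y))) x‖ ≤ ‖fderiv ℝ f (T (x, y))‖ * r := by
    intro x y
    have := fderiv_comp (g := f) (f := fun x => T (x, y)) x (hf.differentiable one_ne_zero _)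
      ((hsec1 y).differentiable one_ne_zero _)
    change ‖fderiv ℝ (f ∘ fun x => T (x, y)) x‖ ≤ _
    rw [this]
    exact (ContinuousLinearMap.opNorm_comp_le _ _).trans
      (by gcongr; exact norm_fderiv_le_of_lipschitz ℝ (hr y))
  have d2 : ∀ x y, ‖fderiv ℝ (fun y => f (T (x, y))) y‖ ≤ ‖fderiv ℝ f (T (x, y))‖ * s := by
    intro x y
    have := fderiv_comp (g := f) (f := fun y => T (x, y)) y (hf.differentiable one_ne_zero _)
      ((hsec2 x).differentiable one_ne_zero _)
    change ‖fderiv ℝ (f ∘ fun y => T (x, y)) y‖ ≤ _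
    rw [this]
    exact (ContinuousLinearMap.opNorm_comp_le _ _).trans
      (by gcongr; exact norm_fderiv_le_of_lipschitz ℝ (hs x))
  have hb2 : ∀ z, δ ^ 2 ≤ f z ^ 2 ∧ f z ^ 2 ≤ K ^ 2 := fun z =>
    ⟨by have := (hb z).1; gcongr, by have h1 := (hb z).1; have h2 := (hb z).2; have h0 := hδ.le.trans h1; gcongr⟩
  have habs : ∀ z, |f z| ≤ K := fun z => by
    rw [abs_of_pos (hδ.trans_le (hb z).1)]; exact (hb z).2
  have hInt : Integrable (fun z => ‖fderiv ℝ f (T z)‖ ^ 2) (μ.prod ν) :=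
    integrable_of_bounds (hgc.measurable.comp hTm) (δ := 0) (K := K ^ 2) fun z =>
      ⟨by positivity, by have := hd (T z); gcongr⟩
  have hFm : Measurable fun p : E × W => f (T p) ^ 2 := by fun_prop
  -- By subadditivity each variable may be treated with the other frozen; the chain rule then bounds
  -- the gradient of the section by r or s times that of f.
  refine (ent_prod_le (F := fun p => f (T p) ^ 2) hFm (by positivity)
    (fun z => hb2 _)).trans ?_
  have iEnt := integrable_mul_log (μ := μ.prod ν) hFm hFm (by positivity) (fun z => hb2 _)
    (fun z => hb2 _)
  have s1 : ∫ y, ent μ (fun x => f (T (x, y)) ^ 2) ∂ν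
      ≤ ∫ y, r ^ 2 * C * ∫ x, ‖fderiv ℝ f (T (x, y))‖ ^ 2 ∂μ ∂ν := by
    refine integral_mono ?_ (hInt.integral_prod_right.const_mul _) fun y => ?_
    · unfold ent
      have hA : Measurable fun y => ∫ x, f (T (x, y)) ^ 2 ∂μ :=
        hFm.stronglyMeasurable.integral_prod_left'.measurable
      have hAb : ∀ y, δ ^ 2 ≤ ∫ x, f (T (x, y)) ^ 2 ∂μ ∧ ∫ x, f (T (x, y)) ^ 2 ∂μ ≤ K ^ 2 :=
        fun y => integral_mem_bounds (by fun_prop) fun g => hb2 _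
      exact iEnt.integral_prod_right.sub (integrable_mul_log hA hA (by positivity) hAb hAb)
    · refine (satisfiesLSI_iff.1 hμ (fun x => f (T (x, y))) (hf.comp (hsec1 y))
        ⟨max K (K * r), fun x => ⟨(habs _).trans (le_max_left _ _), ((d1 x y).trans
          (by gcongr; exact hd _)).trans (le_max_right _ _)⟩⟩).trans ?_
      rw [mul_comm ((r : ℝ) ^ 2), mul_assoc]
      refine mul_le_mul_of_nonneg_left ?_ hC
      rw [← integral_const_mul]
      refine integral_mono_of_nonneg (Eventually.of_forall fun x => by positivity) ?_
        (Eventually.of_forall fun x => ?_)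
      · refine Integrable.const_mul (integrable_of_bounds
          ((hgc.comp (hsec1 y).continuous).measurable) (δ := 0) (K := K ^ 2) fun z => ?_) _
        exact ⟨by simp only [Function.comp]; positivity, by have := hd (T (z, y)); simp only [Function.comp]; gcongr⟩
      · have := d1 x y
        calc ‖fderiv ℝ (fun x => f (T (x, y))) x‖ ^ 2 ≤ (‖fderiv ℝ f (T (x, y))‖ * r) ^ 2 := by
              gcongr
          _ = _ := by ring
  have s2 : ∫ x, ent ν (fun y => f (T (x, y)) ^ 2) ∂μ
      ≤ ∫ x, s ^ 2 * C' * ∫ y, ‖fderiv ℝ f (T (x, y))‖ ^ 2 ∂ν ∂μ := by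
    refine integral_mono ?_ (hInt.integral_prod_left.const_mul _) fun x => ?_
    · unfold ent
      have hA : Measurable fun x => ∫ y, f (T (x, y)) ^ 2 ∂ν :=
        hFm.stronglyMeasurable.integral_prod_right'.measurable
      have hAb : ∀ x, δ ^ 2 ≤ ∫ y, f (T (x, y)) ^ 2 ∂ν ∧ ∫ y, f (T (x, y)) ^ 2 ∂ν ≤ K ^ 2 :=
        fun y => integral_mem_bounds (by fun_prop) fun g => hb2 _
      exact iEnt.integral_prod_left.sub (integrable_mul_log hA hA (by positivity) hAb hAb)
    · refine (satisfiesLSI_iff.1 hν (fun y => f (T (x, y))) (hf.comp (hsec2 x))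
        ⟨max K (K * s), fun y => ⟨(habs _).trans (le_max_left _ _), ((d2 x y).trans
          (by gcongr; exact hd _)).trans (le_max_right _ _)⟩⟩).trans ?_
      rw [mul_comm ((s : ℝ) ^ 2), mul_assoc]
      refine mul_le_mul_of_nonneg_left ?_ hC'
      rw [← integral_const_mul]
      refine integral_mono_of_nonneg (Eventually.of_forall fun x => by positivity) ?_
        (Eventually.of_forall fun y => ?_)
      · refine Integrable.const_mul (integrable_of_bounds
          ((hgc.comp (hsec2 x).continuous).measurable) (δ := 0) (K := K ^ 2) fun z => ?_) _
        exact ⟨by simp only [Function.comp]; positivity, by have := hd (T (x, z)); simp only [Function.comp]; gcongr⟩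
      · have := d2 x y
        calc ‖fderiv ℝ (fun y => f (T (x, y))) y‖ ^ 2 ≤ (‖fderiv ℝ f (T (x, y))‖ * s) ^ 2 := by
              gcongr
          _ = _ := by ring
  rw [integral_const_mul, ← integral_prod_symm _ hInt] at s1
  rw [integral_const_mul, ← integral_prod _ hInt] at s2
  rw [add_mul]
  linarith

section

variable {E : Type*} [NormedAddCommGroup E] [NormedSpace ℝ E] [MeasurableSpace E] [BorelSpace E]

theorem satisfiesLSI_dirac (x : E) : SatisfiesLSI (Measure.dirac x) 0 := by
  rw [satisfiesLSI_iff]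
  intro f hf _
  have hm : Measurable f := hf.continuous.measurable
  unfold ent
  rw [integral_dirac' _ _ (Measurable.stronglyMeasurable (by fun_prop)),
    integral_dirac' _ _ (Measurable.stronglyMeasurable (by fun_prop))]
  simp

/-- The case of `SatisfiesLSI.map_prod` in which the second variable is a Dirac mass, whose constant
is 0. -/
theorem SatisfiesLSI.map_lipschitz {E' : Type*} [NormedAddCommGroup E'] [NormedSpace ℝ E']
    [MeasurableSpace E'] [BorelSpace E'] [SecondCountableTopology E] {μ : Measure E}
    [IsProbabilityMeasure μ] {C : ℝ} (hμ : SatisfiesLSI μ C) (hC : 0 ≤ C) {T : E → E'}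
    (hT : ContDiff ℝ 1 T) {r : ℝ≥0} (hr : LipschitzWith r T) :
    SatisfiesLSI (μ.map T) (r ^ 2 * C) := by
  have h := hμ.map_prod (satisfiesLSI_dirac (0 : ℝ)) hC le_rfl (T := fun p => T p.1)
    (hT.comp contDiff_fst) (fun _ => hr) (fun x => LipschitzWith.const (T x))
  have e : (μ.prod (Measure.dirac (0 : ℝ))).map (fun p => T p.1) = μ.map T := by
    change (μ.prod (Measure.dirac (0 : ℝ))).map (T ∘ Prod.fst) = μ.map T
    rw [← Measure.map_map hT.continuous.measurable measurable_fst, Measure.map_fst_prod]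
    simp
  rw [e] at h
  simpa using h

/-- Logarithmic Sobolev inequalities are stable under pointwise limits of random variables. -/
theorem satisfiesLSI_of_tendsto {Ω : Type*} [MeasurableSpace Ω] {P : Measure Ω}
    [IsProbabilityMeasure P] {X : ℕ → Ω → E} {Y : Ω → E} (hX : ∀ k, Measurable (X k))
    (hY : Measurable Y) (hlim : ∀ ω, Tendsto (fun k => X k ω) atTop (𝓝 (Y ω))) {C : ℝ}
    (h : ∀ k, SatisfiesLSI (P.map (X k)) C) : SatisfiesLSI (P.map Y) C := by
  rw [satisfiesLSI_iff]
  rintro f hf ⟨K, hK⟩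
  have hm : Measurable f := hf.continuous.measurable
  have hgc : Continuous fun z => ‖fderiv ℝ f z‖ ^ 2 :=
    (hf.continuous_fderiv one_ne_zero).norm.pow 2
  have h1 : Tendsto (fun k => ent P (fun ω => f (X k ω) ^ 2)) atTop
      (𝓝 (ent P (fun ω => f (Y ω) ^ 2))) := by
    refine tendsto_ent (K := K ^ 2) (fun k => by have := hX k; fun_prop)
      (fun k ω => ⟨by positivity, ?_⟩)
      fun ω => ((hf.continuous.tendsto _).comp (hlim ω)).pow 2
    exact sq_le_sq' (neg_le_of_abs_le (hK _).1) (le_of_abs_le (hK _).1)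
  have h2 : Tendsto (fun k => ∫ ω, ‖fderiv ℝ f (X k ω)‖ ^ 2 ∂P) atTop
      (𝓝 (∫ ω, ‖fderiv ℝ f (Y ω)‖ ^ 2 ∂P)) := by
    refine tendsto_integral_of_dominated_convergence (fun _ => K ^ 2)
      (fun k => (hgc.measurable.comp (hX k)).aestronglyMeasurable) (integrable_const _)
      (fun k => Eventually.of_forall fun ω => ?_)
      (Eventually.of_forall fun ω => (hgc.tendsto _).comp (hlim ω))
    rw [norm_pow, norm_norm]
    have := (hK (X k ω)).2
    gcongr
  rw [ent_map hY (by fun_prop), integral_map hY.aemeasurable hgc.aestronglyMeasurable]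
  refine le_of_tendsto_of_tendsto' h1 (h2.const_mul C) fun k => ?_
  have := satisfiesLSI_iff.1 (h k) f hf ⟨K, hK⟩
  rwa [ent_map (hX k) (by fun_prop), integral_map (hX k).aemeasurable hgc.aestronglyMeasurable]
    at this

theorem ent_nonneg {E : Type*} [MeasurableSpace E] {μ : Measure E} [IsProbabilityMeasure μ]
    {F : E → ℝ} (hF : Measurable F) {δ K : ℝ} (hδ : 0 < δ) (h : ∀ z, δ ≤ F z ∧ F z ≤ K) :
    0 ≤ ent μ F := by
  have hi := integrable_of_bounds (μ := μ) hF h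
  have hl := integrable_mul_log (μ := μ) hF hF hδ h h
  have hm := hδ.trans_le (integral_mem_bounds (μ := μ) hF h).1
  set m := ∫ z, F z ∂μ with hmdef
  have : 0 ≤ ∫ z, bregman (F z) m ∂μ :=
    integral_nonneg fun z => bregman_nonneg (hδ.trans_le (h z).1) hm
  unfold bregman at this
  rw [integral_add (by fun_prop) (by fun_prop), integral_sub (by fun_prop) (by fun_prop),
    integral_sub (by fun_prop) (by fun_prop), integral_mul_const] at this
  simp only [integral_const, probReal_univ, one_smul, ← hmdef] at this
  unfold ent
  linarith

/-- On a nontrivial space a logarithmic Sobolev constant is nonnegative. -/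
theorem SatisfiesLSI.nonneg [Nontrivial E] {μ : Measure E} [IsProbabilityMeasure μ] {C : ℝ}
    (h : SatisfiesLSI μ C) : 0 ≤ C := by
  obtain ⟨x, hx⟩ := exists_ne (0 : E)
  obtain ⟨ℓ, hℓ⟩ := exists_dual_vector ℝ x (norm_ne_zero_iff.2 hx)
  -- This test function is bounded, stays above 1 and has a nowhere vanishing derivative: its energy
  -- is positive, while the entropy of its square is nonnegative.
  have hd : ∀ z, HasFDerivAt (fun z => Real.arctan (ℓ z) + 3) ((1 / (1 + ℓ z ^ 2)) • ℓ) z :=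
    fun z => (ℓ.hasFDerivAt.arctan).add_const 3
  have hc : ContDiff ℝ 1 (fun z => Real.arctan (ℓ z) + 3) :=
    (ℓ.contDiff.arctan).add contDiff_const
  have hpi := Real.pi_lt_four
  have hb : ∀ z, 1 ≤ Real.arctan (ℓ z) + 3 ∧ Real.arctan (ℓ z) + 3 ≤ 5 := fun z => by
    have h1 := Real.neg_pi_div_two_lt_arctan (ℓ z)
    have h2 := Real.arctan_lt_pi_div_two (ℓ z)
    constructor <;> linarith
  have hfn : ∀ z, ‖fderiv ℝ (fun z => Real.arctan (ℓ z) + 3) z‖ = 1 / (1 + ℓ z ^ 2) := by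
    intro z
    rw [(hd z).fderiv, norm_smul, hℓ.1, mul_one, Real.norm_of_nonneg (by positivity)]
  have hle : ∀ z, 1 / (1 + ℓ z ^ 2) ≤ 1 := fun z => by
    rw [div_le_one (by positivity)]; nlinarith [sq_nonneg (ℓ z)]
  have hm : Measurable fun z => Real.arctan (ℓ z) + 3 := hc.continuous.measurable
  have key := satisfiesLSI_iff.1 h _ hc ⟨5, fun z => ⟨by
    rw [abs_of_nonneg (by linarith [(hb z).1])]; exact (hb z).2, by
    rw [hfn]; linarith [hle z]⟩⟩
  have h0 : 0 ≤ ent μ (fun z => (Real.arctan (ℓ z) + 3) ^ 2) :=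
    ent_nonneg (δ := 1) (K := 25) (by fun_prop) one_pos fun z => by
      have := hb z; constructor <;> nlinarith
  have hpos : 0 < ∫ z, ‖fderiv ℝ (fun z => Real.arctan (ℓ z) + 3) z‖ ^ 2 ∂μ := by
    simp only [hfn]
    have hcont : Continuous fun z => (1 / (1 + ℓ z ^ 2)) ^ 2 :=
      (continuous_const.div (by fun_prop) fun z => by positivity).pow 2
    have hsupp : Function.support (fun z => (1 / (1 + ℓ z ^ 2)) ^ 2) = Set.univ := by
      ext z; simp only [Function.mem_support, Set.mem_univ, iff_true]; positivity
    rw [integral_pos_iff_support_of_nonneg (fun z => by positivity)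
      (integrable_of_bounds hcont.measurable (δ := 0) (K := 1) fun z =>
        ⟨by positivity, pow_le_one₀ (by positivity) (hle z)⟩), hsupp]
    simp
  by_contra hC
  push Not at hC
  nlinarith

/-- This settles dimension 0, where the given initial constant may be negative. -/
theorem satisfiesLSI_of_subsingleton {E : Type*} [NormedAddCommGroup E] [NormedSpace ℝ E]
    [MeasurableSpace E] [Subsingleton E] (μ : Measure E) [IsProbabilityMeasure μ]
    (C : ℝ) : SatisfiesLSI μ C := by
  rw [satisfiesLSI_iff]
  intro f hf _
  have h1 : f = fun _ => f 0 := funext fun z => by rw [Subsingleton.elim z 0]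
  have h2 : ∀ z, fderiv ℝ f z = 0 := fun z => by rw [h1]; simp
  have h3 : (fun z => f z ^ 2) = fun _ => f 0 ^ 2 := funext fun z => by rw [Subsingleton.elim z 0]
  rw [h3]
  simp only [h2, ent]
  simp

end

/-! ### Cocoercivity of coercive operators with a small skew part. -/

section LinearAlgebra

variable {V : Type*} [NormedAddCommGroup V] [InnerProductSpace ℝ V]

/-- Cauchy–Schwarz for the inner product ⟨S x, y⟩. -/
theorem inner_map_sq_le_of_symm {S : V →L[ℝ] V} (hS : ∀ x y, inner ℝ (S x) y = inner ℝ (S y) x)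
    {m : ℝ} (hm : 0 < m) (hpos : ∀ x, m * ‖x‖ ^ 2 ≤ inner ℝ (S x) x) (x y : V) :
    inner ℝ (S x) y ^ 2 ≤ inner ℝ (S x) x * inner ℝ (S y) y := by
  have hq : ∀ z, 0 ≤ inner ℝ (S z) z := fun z => le_trans (by positivity) (hpos z)
  rcases eq_or_ne x 0 with rfl | hx
  · simp
  have hs : 0 < inner ℝ (S x) x :=
    lt_of_lt_of_le (by have := norm_pos_iff.2 hx; positivity) (hpos x)
  set t := inner ℝ (S x) y / inner ℝ (S x) x with ht
  have h := hq (y - t • x)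
  have e : inner ℝ (S (y - t • x)) (y - t • x)
      = inner ℝ (S y) y - 2 * t * inner ℝ (S x) y + t ^ 2 * inner ℝ (S x) x := by
    simp only [map_sub, map_smul, inner_sub_left, inner_sub_right, inner_smul_left,
      inner_smul_right, hS y x]
    simp
    ring
  rw [e] at h
  have e2 : t * inner ℝ (S x) x = inner ℝ (S x) y := by rw [ht]; field_simp
  have h2 : inner ℝ (S y) y - 2 * t * inner ℝ (S x) y + t ^ 2 * inner ℝ (S x) x
      = inner ℝ (S y) y - t * inner ℝ (S x) y := by linear_combination t * e2
  rw [h2] at h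
  have h3 := mul_nonneg hs.le h
  have h4 : inner ℝ (S x) x * (inner ℝ (S y) y - t * inner ℝ (S x) y)
      = inner ℝ (S x) x * inner ℝ (S y) y - inner ℝ (S x) y ^ 2 := by
    linear_combination (-inner ℝ (S x) y) * e2
  linarith

/-- Cocoercivity of the sum of a symmetric coercive operator and a relatively small
skew-symmetric one. -/
theorem norm_sq_symm_add_skew_le [FiniteDimensional ℝ V] {S K : V →L[ℝ] V}
    (hS : ∀ x y, inner ℝ (S x) y = inner ℝ (S y) x) (hK : ∀ x y, inner ℝ (K x) y = -inner ℝ (K y) x)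
    {m M R : ℝ} (hm : 0 < m) (hR : 0 ≤ R) (hpos : ∀ x, m * ‖x‖ ^ 2 ≤ inner ℝ (S x) x)
    (hM : ∀ x, inner ℝ (S x) x ≤ M * ‖x‖ ^ 2) (hKS : ∀ x, ‖K x‖ ^ 2 ≤ R * inner ℝ (S x) x) (x : V) :
    ‖S x + K x‖ ^ 2 ≤ (M + R) * inner ℝ (S x) x := by
  have hq : ∀ z, 0 ≤ inner ℝ (S z) z := fun z => le_trans (by positivity) (hpos z)
  have hinj : Function.Injective (S : V →ₗ[ℝ] V) := by
    rw [← LinearMap.ker_eq_bot, LinearMap.ker_eq_bot']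
    intro z hz
    have h1 := hpos z
    have hz' : S z = 0 := hz
    rw [hz', inner_zero_left] at h1
    have : ‖z‖ ^ 2 ≤ 0 := by
      by_contra hc; push Not at hc; nlinarith
    exact norm_eq_zero.1 (pow_eq_zero_iff two_ne_zero |>.1 (le_antisymm this (by positivity)))
  have hsurj := LinearMap.injective_iff_surjective.1 hinj
  set y := S x + K x with hy
  clear_value y
  -- Take w = -S⁻¹K y. Skewness gives |y|² = ⟨S x, y + w⟩ and makes y and w orthogonal for S. After
  -- Cauchy–Schwarz in that inner product, only ⟨S w, w⟩ ≤ R|y|² remains.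
  obtain ⟨w, hw⟩ := hsurj (-(K y))
  have hw' : S w = -(K y) := hw
  have e1 : ‖y‖ ^ 2 = inner ℝ (S x) (y + w) := by
    rw [inner_add_right, hS x w, hw', inner_neg_left, hK y x, neg_neg, ← inner_add_left, ← hy,
      real_inner_self_eq_norm_sq]
  have e2 : inner ℝ (S (y + w)) (y + w) = inner ℝ (S y) y + inner ℝ (S w) w := by
    have h0 : inner ℝ (K y) y = 0 := by have := hK y y; linarith
    have h1 : inner ℝ (S w) y = 0 := by rw [hw', inner_neg_left, h0, neg_zero]
    rw [map_add, inner_add_left, inner_add_right (S y), inner_add_right (S w), hS y w, h1]; ring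
  have hww : inner ℝ (S w) w ≤ R * ‖y‖ ^ 2 := by
    have h1 : inner ℝ (S w) w = inner ℝ (K w) y := by rw [hw', inner_neg_left, hK y w, neg_neg]
    have h2 : inner ℝ (S w) w ≤ ‖K w‖ * ‖y‖ := h1 ▸ real_inner_le_norm _ _
    have h3 := hKS w
    have h4 : inner ℝ (S w) w ^ 2 ≤ R * ‖y‖ ^ 2 * inner ℝ (S w) w := by
      calc inner ℝ (S w) w ^ 2 ≤ (‖K w‖ * ‖y‖) ^ 2 := by have := hq w; gcongr
        _ = ‖K w‖ ^ 2 * ‖y‖ ^ 2 := by ring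
        _ ≤ R * inner ℝ (S w) w * ‖y‖ ^ 2 := by gcongr
        _ = _ := by ring
    rcases (hq w).eq_or_lt with h | h
    · rw [← h]; positivity
    · rw [sq] at h4; exact le_of_mul_le_mul_right h4 h
  have cs := inner_map_sq_le_of_symm hS hm hpos x (y + w)
  rw [← e1, e2] at cs
  have h5 : ‖y‖ ^ 2 * ‖y‖ ^ 2 ≤ (M + R) * inner ℝ (S x) x * ‖y‖ ^ 2 := by
    calc ‖y‖ ^ 2 * ‖y‖ ^ 2 = (‖y‖ ^ 2) ^ 2 := by ring
      _ ≤ inner ℝ (S x) x * (inner ℝ (S y) y + inner ℝ (S w) w) := cs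
      _ ≤ inner ℝ (S x) x * (M * ‖y‖ ^ 2 + R * ‖y‖ ^ 2) := by
        have := hq x; have := hM y; gcongr
      _ = _ := by ring
  rcases (norm_nonneg y).eq_or_lt with h | h
  · have hMR : 0 ≤ (M + R) * inner ℝ (S x) x := by
      have a1 := hq x
      have a2 := hM x
      rcases eq_or_ne x 0 with rfl | hx
      · simp
      · have hx0 := norm_pos_iff.2 hx
        have hM0 : 0 ≤ M := by
          by_contra hc; push Not at hc; nlinarith [sq_pos_of_pos hx0]
        positivity
    rw [← h]; simpa using hMR
  · exact le_of_mul_le_mul_right h5 (by positivity)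

/-- Symmetric operators satisfy this with M alone; the larger 2M - m is the constant that also
serves the nonsymmetric case. -/
theorem norm_sq_le_of_symm [FiniteDimensional ℝ V] {A : V →L[ℝ] V}
    (hA : ∀ x y, inner ℝ (A x) y = inner ℝ (A y) x) {m M : ℝ} (hm : 0 < m)
    (hpos : ∀ x, m * ‖x‖ ^ 2 ≤ inner ℝ (A x) x) (hM : ∀ x, ‖A x‖ ≤ M * ‖x‖) (x : V) :
    ‖A x‖ ^ 2 ≤ (2 * M - m) * inner ℝ (A x) x := by
  have hM' : ∀ x, inner ℝ (A x) x ≤ M * ‖x‖ ^ 2 := fun x =>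
    (real_inner_le_norm _ _).trans (by have := hM x; nlinarith [norm_nonneg x])
  have h := norm_sq_symm_add_skew_le (K := 0) (R := 0) hA (by simp) hm le_rfl hpos hM' (by simp) x
  simp only [zero_apply, add_zero] at h
  refine h.trans ?_
  rcases eq_or_ne x 0 with rfl | hx
  · simp
  have hx0 := norm_pos_iff.2 hx
  have : m ≤ M := le_of_mul_le_mul_right ((hpos x).trans (hM' x)) (by positivity)
  have hq : 0 ≤ inner ℝ (A x) x := le_trans (by positivity) (hpos x)
  gcongr
  linarith

/-- The left side involves the skew part of w ↦ R w - ⟨n, w⟩g, the right side R times its quadratic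
form: exactly the relative smallness that `norm_sq_symm_add_skew_le` asks for. -/
theorem norm_skew_sq_le {n g w : V} {R : ℝ} (hn : ‖n‖ = 1) (hg : ‖g‖ ≤ R) :
    ‖(1 / 2 : ℝ) • (inner ℝ g w • n - inner ℝ n w • g)‖ ^ 2
      ≤ R * (R * ‖w‖ ^ 2 - inner ℝ g w * inner ℝ n w) := by
  set ρ := ‖g‖ with hρ
  set α := inner ℝ g w with hα
  set β := inner ℝ n w with hβ
  set Γ := inner ℝ g n with hΓ
  have hρ0 : 0 ≤ ρ := norm_nonneg g
  have e : ‖(1 / 2 : ℝ) • (α • n - β • g)‖ ^ 2 = (α ^ 2 + ρ ^ 2 * β ^ 2 - 2 * Γ * α * β) / 4 := by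
    rw [norm_smul, mul_pow, norm_sub_sq_real, norm_smul, norm_smul, mul_pow, mul_pow, hn,
      inner_smul_left, inner_smul_right, real_inner_comm g n, Real.norm_eq_abs, Real.norm_eq_abs,
      Real.norm_eq_abs, sq_abs, sq_abs, sq_abs]
    simp only [← hρ, ← hΓ, RCLike.conj_to_real]
    ring
  have hΓ1 : Γ ≤ ρ := by have := real_inner_le_norm g n; rwa [hn, mul_one] at this
  have hΓ2 : -ρ ≤ Γ := by
    have := neg_le_of_abs_le (abs_real_inner_le_norm g n); rwa [hn, mul_one] at this
  have hαb : |α| ≤ ρ * ‖w‖ := abs_real_inner_le_norm g w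
  have hβb : |β| ≤ ‖w‖ := by have := abs_real_inner_le_norm n w; rwa [hn, one_mul] at this
  have hαβ : α * β ≤ ρ * ‖w‖ ^ 2 := by
    calc α * β ≤ |α * β| := le_abs_self _
      _ = |α| * |β| := abs_mul _ _
      _ ≤ (ρ * ‖w‖) * ‖w‖ := by gcongr
      _ = _ := by ring
  -- The right side increases with R on [ρ, ∞), so it is enough to treat R = |g|.
  have mono : ρ * (ρ * ‖w‖ ^ 2 - α * β) ≤ R * (R * ‖w‖ ^ 2 - α * β) := by
    have h1 : 0 ≤ (R - ρ) * (R * ‖w‖ ^ 2 + ρ * ‖w‖ ^ 2 - α * β) := by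
      apply mul_nonneg (by linarith)
      have : 0 ≤ R * ‖w‖ ^ 2 := by have := hρ0.trans hg; positivity
      linarith
    linarith
  refine le_trans ?_ mono
  rw [e]
  -- Cauchy-Schwarz against `g + ρ n`
  have cs : (α + ρ * β) ^ 2 ≤ (2 * ρ ^ 2 + 2 * ρ * Γ) * ‖w‖ ^ 2 := by
    have h1 : inner ℝ (g + ρ • n) w = α + ρ * β := by
      rw [inner_add_left, inner_smul_left]; simp [hα, hβ]
    have h2 : ‖g + ρ • n‖ ^ 2 = 2 * ρ ^ 2 + 2 * ρ * Γ := by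
      rw [norm_add_sq_real, norm_smul, mul_pow, hn, inner_smul_right, Real.norm_eq_abs, sq_abs,
        ← hρ, ← hΓ]; ring
    rw [← h1, ← h2, ← mul_pow]
    exact sq_le_sq' (neg_le_of_abs_le (abs_real_inner_le_norm _ _)) (real_inner_le_norm _ _)
  rcases hρ0.eq_or_lt with h | h
  · have hα0 : α = 0 := by
      rw [← h] at hαb; simpa using hαb
    rw [← h, hα0]; simp
  have s1 : 4 * ρ * α * β ≤ (α + ρ * β) ^ 2 := by nlinarith [sq_nonneg (α - ρ * β)]
  have t1 : (ρ - Γ) * (4 * ρ * α * β) ≤ (ρ - Γ) * (α + ρ * β) ^ 2 := by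
    have : 0 ≤ ρ - Γ := by linarith
    gcongr
  have t2 : (3 * ρ - Γ) * (α + ρ * β) ^ 2 ≤ (3 * ρ - Γ) * ((2 * ρ ^ 2 + 2 * ρ * Γ) * ‖w‖ ^ 2) := by
    have : 0 ≤ 3 * ρ - Γ := by linarith
    gcongr
  have t3 : 0 ≤ ρ * (ρ - Γ) ^ 2 * ‖w‖ ^ 2 := by positivity
  -- After `t1` and `t2` exactly 2ρ(ρ - Γ)²|w|² is left over.
  have : 0 ≤ 8 * ρ * (ρ * (ρ * ‖w‖ ^ 2 - α * β) - (α ^ 2 + ρ ^ 2 * β ^ 2 - 2 * Γ * α * β) / 4) := by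
    nlinarith
  have := nonneg_of_mul_nonneg_right this (by positivity)
  linarith

/-- Cocoercivity for a rank-one perturbation `A ξ = P ξ + R ξ - ⟨n, ξ⟩ g` with `|n| = 1`,
`|g| ≤ R` and `P` symmetric. -/
theorem norm_sq_le_of_rank_one [FiniteDimensional ℝ V] {A P : V →L[ℝ] V} {n g : V} {R m M : ℝ}
    (hP : ∀ x y, inner ℝ (P x) y = inner ℝ (P y) x) (hm : 0 < m)
    (hpos : ∀ x, m * ‖x‖ ^ 2 ≤ inner ℝ (P x) x) (hn : ‖n‖ = 1) (hg : ‖g‖ ≤ R)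
    (hA : ∀ x, A x = P x + (R • x - inner ℝ n x • g)) (hM : ∀ x, ‖A x‖ ≤ M * ‖x‖) (x : V) :
    m * ‖x‖ ^ 2 ≤ inner ℝ (A x) x ∧ ‖A x‖ ^ 2 ≤ (2 * M - m) * inner ℝ (A x) x := by
  have hR : 0 ≤ R := (norm_nonneg g).trans hg
  set K : V →L[ℝ] V := (1 / 2 : ℝ) • ((innerSL ℝ g).smulRight n - (innerSL ℝ n).smulRight g) with hKd
  have hKa : ∀ z, K z = (1 / 2 : ℝ) • (inner ℝ g z • n - inner ℝ n z • g) := fun z => by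
    simp [hKd]
  set S : V →L[ℝ] V := A - K with hSd
  have hSA : ∀ z, S z + K z = A z := fun z => by simp [hSd]
  have hKskew : ∀ y z, inner ℝ (K y) z = -inner ℝ (K z) y := fun y z => by
    simp only [hKa, inner_smul_left, inner_sub_left]
    simp only [RCLike.conj_to_real]
    ring
  have hKz : ∀ z, inner ℝ (K z) z = 0 := fun z => by have := hKskew z z; linarith
  have hSz : ∀ z, inner ℝ (S z) z = inner ℝ (A z) z := fun z => by
    rw [← hSA, inner_add_left, hKz, add_zero]
  have hAz : ∀ z, inner ℝ (A z) z = inner ℝ (P z) z + (R * ‖z‖ ^ 2 - inner ℝ g z * inner ℝ n z) :=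
    fun z => by
      rw [hA, inner_add_left, inner_sub_left, inner_smul_left, inner_smul_left,
        real_inner_self_eq_norm_sq]
      simp only [RCLike.conj_to_real]; ring
  have hSsym : ∀ y z, inner ℝ (S y) z = inner ℝ (S z) y := fun y z => by
    have e : ∀ z, S z = P z + (R • z - (1 / 2 : ℝ) • (inner ℝ g z • n + inner ℝ n z • g)) := by
      intro z
      have : S z = A z - K z := rfl
      rw [this, hA, hKa]
      module
    rw [e, e, inner_add_left, inner_add_left, hP y z]
    simp only [inner_sub_left, inner_smul_left, inner_add_left, RCLike.conj_to_real,
      real_inner_comm z y]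
    ring
  have hB : ∀ z, 0 ≤ R * ‖z‖ ^ 2 - inner ℝ g z * inner ℝ n z := fun z => by
    have h1 := abs_real_inner_le_norm g z
    have h2 := abs_real_inner_le_norm n z
    rw [hn, one_mul] at h2
    have : inner ℝ g z * inner ℝ n z ≤ (R * ‖z‖) * ‖z‖ := by
      calc inner ℝ g z * inner ℝ n z ≤ |inner ℝ g z * inner ℝ n z| := le_abs_self _
        _ = |inner ℝ g z| * |inner ℝ n z| := abs_mul _ _
        _ ≤ (‖g‖ * ‖z‖) * ‖z‖ := by gcongr
        _ ≤ _ := by gcongr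
    nlinarith
  have hSpos : ∀ z, m * ‖z‖ ^ 2 ≤ inner ℝ (S z) z := fun z => by
    rw [hSz, hAz]; linarith [hB z, hpos z]
  have hSM : ∀ z, inner ℝ (S z) z ≤ M * ‖z‖ ^ 2 := fun z => by
    rw [hSz]; exact (real_inner_le_norm _ _).trans (by have := hM z; nlinarith [norm_nonneg z])
  refine ⟨hSz x ▸ hSpos x, ?_⟩
  have hq : 0 ≤ inner ℝ (A x) x := hSz x ▸ le_trans (by positivity) (hSpos x)
  -- If R + m ≤ M, the constant M + R obtained from the skew part is at most 2M - m. Otherwise the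
  -- form is at least (R + m)|ξ|² > M|ξ|² for nonzero ξ orthogonal to n, so no such ξ exists: the
  -- space is a line, g is parallel to n, and A is symmetric.
  rcases le_or_gt (R + m) M with h | h
  · have hKS : ∀ z, ‖K z‖ ^ 2 ≤ R * inner ℝ (S z) z := fun z => by
      rw [hKa, hSz, hAz]
      refine (norm_skew_sq_le hn hg).trans ?_
      have : 0 ≤ inner ℝ (P z) z := le_trans (by positivity) (hpos z)
      gcongr
      linarith
    have := norm_sq_symm_add_skew_le hSsym hKskew hm hR hSpos hSM hKS x
    rw [hSA, hSz] at this
    refine this.trans ?_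
    gcongr
    linarith
  · have hort : ∀ ξ, inner ℝ n ξ = 0 → ξ = 0 := by
      intro ξ hξ
      have h1 := hSM ξ
      rw [hSz, hAz, hξ, mul_zero, sub_zero] at h1
      have h2 := hpos ξ
      have h3 : (R + m - M) * ‖ξ‖ ^ 2 ≤ 0 := by linarith
      have h4 : ‖ξ‖ ^ 2 ≤ 0 := by
        by_contra hc; push Not at hc; nlinarith
      exact norm_eq_zero.1 (pow_eq_zero_iff two_ne_zero |>.1 (le_antisymm h4 (by positivity)))
    have hgn : g = inner ℝ n g • n := by
      have := hort (g - inner ℝ n g • n) (by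
        rw [inner_sub_right, inner_smul_right, real_inner_self_eq_norm_sq, hn]; ring)
      exact sub_eq_zero.1 this
    have hK0 : ∀ z, K z = 0 := fun z => by
      rw [hKa]
      have h1 : inner ℝ g z = inner ℝ n g * inner ℝ n z := by
        nth_rewrite 1 [hgn]; rw [inner_smul_left]; simp
      have h2 : inner ℝ g z • n = inner ℝ n z • g := by
        nth_rewrite 2 [hgn]; rw [h1, smul_smul, mul_comm]
      rw [h2, sub_self, smul_zero]
    have hAS : ∀ z, A z = S z := fun z => by rw [← hSA, hK0, add_zero]
    refine norm_sq_le_of_symm (fun y z => ?_) hm (fun z => ?_) hM x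
    · rw [hAS, hAS]; exact hSsym y z
    · rw [hAS]; exact hSpos z

theorem inner_fderiv_ge {f : V → V} {A : V →L[ℝ] V} {x : V} (hf : HasFDerivAt f A x) {c : ℝ}
    (h : ∀ y, c * ‖y - x‖ ^ 2 ≤ inner ℝ (f y - f x) (y - x)) (ξ : V) :
    c * ‖ξ‖ ^ 2 ≤ inner ℝ (A ξ) ξ := by
  have h1 : HasDerivAt (fun t : ℝ => f (x + t • ξ)) (A ξ) 0 := by
    have hl : HasDerivAt (fun t : ℝ => x + t • ξ) ξ 0 := by
      simpa using ((hasDerivAt_id (0 : ℝ)).smul_const ξ).const_add x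
    have hf' : HasFDerivAt f A (x + (0 : ℝ) • ξ) := by simpa using hf
    exact hf'.comp_hasDerivAt (0 : ℝ) hl
  have h2 := h1.tendsto_slope_zero_right
  have h3 : Tendsto (fun t : ℝ => inner ℝ (t⁻¹ • (f (x + (0 + t) • ξ) - f (x + (0 : ℝ) • ξ))) ξ)
      (𝓝[>] 0) (𝓝 (inner ℝ (A ξ) ξ)) := h2.inner tendsto_const_nhds
  refine ge_of_tendsto h3 ?_
  filter_upwards [self_mem_nhdsWithin] with t ht
  have ht0 : (0 : ℝ) < t := ht
  have h4 := h (x + t • ξ)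
  rw [add_sub_cancel_left, norm_smul, inner_smul_right, mul_pow, Real.norm_eq_abs, sq_abs] at h4
  simp only [zero_add, zero_smul, add_zero, inner_smul_left, RCLike.conj_to_real]
  rw [inv_mul_eq_div, le_div_iff₀ ht0]
  have h5 : t * (c * ‖ξ‖ ^ 2 * t) ≤ t * inner ℝ (f (x + t • ξ) - f x) ξ := by linarith
  exact le_of_mul_le_mul_left h5 ht0

end LinearAlgebra

/-! ### The tamed drift is globally Lipschitz. -/

theorem cutT_eq (R s : ℝ) : cutT R s = max 0 (min 1 (R - s)) := by
  unfold cutT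
  split_ifs with h1 h2
  · rw [min_eq_left (by linarith), max_eq_right zero_le_one]
  · rw [min_eq_right (by linarith), max_eq_right (by linarith)]
  · rw [min_eq_right (by linarith), max_eq_left (by linarith)]

/-- With R/max(R, |x|) split off, s(x)x is a clamp times the radial retraction onto the ball of
radius R, both of them Lipschitz. -/
theorem cutS_eq {R : ℝ} (hR : 0 < R) (s : ℝ) :
    cutS R s = max 0 (min 1 (s - R + 2)) * (R / max R s) := by
  unfold cutS
  split_ifs with h1 h2 h3
  · rw [min_eq_right (by linarith), max_eq_left (by linarith), zero_mul]
  · rw [min_eq_right (by linarith), max_eq_right (by linarith), max_eq_left (by linarith),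
      div_self hR.ne', mul_one]
  · rw [min_eq_left (by linarith), max_eq_right zero_le_one, max_eq_left h3, div_self hR.ne',
      mul_one]
  · rw [min_eq_left (by linarith), max_eq_right zero_le_one, max_eq_right (by linarith), one_mul]

theorem abs_clamp_sub_le (a b : ℝ) :
    |max 0 (min 1 a) - max 0 (min 1 b)| ≤ |a - b| :=
  (abs_max_sub_max_le_max _ _ _ _).trans (max_le (by simp) (
    (abs_min_sub_min_le_max _ _ _ _).trans (max_le (by simp) le_rfl)))

theorem abs_clamp_le_one (a : ℝ) : |max 0 (min 1 a)| ≤ 1 := by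
  rw [abs_of_nonneg (le_max_left _ _)]
  exact max_le zero_le_one (min_le_left _ _)

theorem norm_smul_sub_smul_le {V : Type*} [NormedAddCommGroup V] [NormedSpace ℝ V] (a b : ℝ)
    (x y : V) : ‖a • x - b • y‖ ≤ |a| * ‖x - y‖ + |a - b| * ‖y‖ := by
  have : a • x - b • y = a • (x - y) + (a - b) • y := by module
  rw [this]
  exact (norm_add_le _ _).trans (by rw [norm_smul, norm_smul]; rfl)

/-- The radial retraction on a ball is Lipschitz. -/
theorem norm_retract_sub_le {V : Type*} [NormedAddCommGroup V] [NormedSpace ℝ V] {R : ℝ}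
    (hR : 0 < R) (x y : V) :
    ‖(R / max R ‖x‖) • x - (R / max R ‖y‖) • y‖ ≤ 2 * ‖x - y‖ := by
  have hx : 0 < max R ‖x‖ := lt_max_of_lt_left hR
  have hy : 0 < max R ‖y‖ := lt_max_of_lt_left hR
  refine (norm_smul_sub_smul_le _ _ _ _).trans ?_
  have h1 : |R / max R ‖x‖| ≤ 1 := by
    rw [abs_of_pos (by positivity), div_le_one hx]; exact le_max_left _ _
  have h2 : |R / max R ‖x‖ - R / max R ‖y‖| * ‖y‖ ≤ ‖x - y‖ := by
    have e : R / max R ‖x‖ - R / max R ‖y‖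
        = (R / max R ‖x‖) * ((max R ‖y‖ - max R ‖x‖) / max R ‖y‖) := by
      field_simp
    have h3 : |max R ‖y‖ - max R ‖x‖| ≤ ‖x - y‖ := by
      refine (abs_max_sub_max_le_max _ _ _ _).trans (max_le (by simp) ?_)
      rw [norm_sub_rev]; exact abs_norm_sub_norm_le y x
    rw [e, abs_mul, abs_div (max R ‖y‖ - max R ‖x‖), abs_of_pos hy]
    calc |R / max R ‖x‖| * (|max R ‖y‖ - max R ‖x‖| / max R ‖y‖) * ‖y‖
        ≤ 1 * (‖x - y‖ / max R ‖y‖) * max R ‖y‖ := by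
          gcongr
          exact le_max_right _ _
      _ = ‖x - y‖ := by field_simp
  calc _ ≤ 1 * ‖x - y‖ + ‖x - y‖ := by gcongr
    _ = _ := by ring

/-- The set of Lipschitz constants is closed, so its infimum is attained once the set is nonempty.
-/
theorem lipschitzWith_lipConst {E F : Type*} [PseudoMetricSpace E] [PseudoMetricSpace F]
    {f : E → F} {K : ℝ≥0} (h : LipschitzWith K f) : LipschitzWith (lipConst f) f := by
  have hc : IsClosed {K : ℝ≥0 | LipschitzWith K f} := by
    have : {K : ℝ≥0 | LipschitzWith K f}
        = ⋂ (x : E) (y : E), {K : ℝ≥0 | dist (f x) (f y) ≤ K * dist x y} := by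
      ext K; simp [lipschitzWith_iff_dist_le_mul]
    rw [this]
    exact isClosed_iInter fun x => isClosed_iInter fun y =>
      isClosed_le continuous_const (by fun_prop)
  exact hc.csInf_mem ⟨K, h⟩ (OrderBot.bddBelow _)

section Tamed

variable {d : ℕ} {h : Vec d → Vec d} {m L l lam : ℝ}

theorem tamingRadius_pos (hm : 0 < m) (hL : 0 < L) (hlam : 0 < lam) : 0 < tamingRadius m L l lam := by
  unfold tamingRadius
  have : 0 < 1 / √lam := by positivity
  positivity

theorem norm_shifted_sub_le (hm : 0 < m) (hL : 0 < L) (hl : 0 < l)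
    (hlip : ∀ x y : Vec d, ‖h x - h y‖ ≤ L * (1 + ‖x‖ + ‖y‖) ^ l * ‖x - y‖) {ρ : ℝ} {x y : Vec d}
    (hx : ‖x‖ ≤ ρ) (hy : ‖y‖ ≤ ρ) :
    ‖shifted h m x - shifted h m y‖ ≤ (L * (1 + ρ + ρ) ^ l + m) * ‖x - y‖ := by
  have e : shifted h m x - shifted h m y = (h x - h y) - m • (x - y) := by
    unfold shifted; module
  rw [e]
  refine (norm_sub_le _ _).trans ?_
  rw [norm_smul, Real.norm_eq_abs, abs_of_pos hm, add_mul]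
  refine add_le_add ((hlip x y).trans ?_) le_rfl
  gcongr

theorem norm_shifted_le_tamingSup (hm : 0 < m) (hL : 0 < L) (hl : 0 < l)
    (hlip : ∀ x y : Vec d, ‖h x - h y‖ ≤ L * (1 + ‖x‖ + ‖y‖) ^ l * ‖x - y‖) {x : Vec d}
    (hx : ‖x‖ < tamingRadius m L l lam) : ‖shifted h m x‖ ≤ tamingSup h m L l lam := by
  set ρ := tamingRadius m L l lam
  have hρ : 0 ≤ ρ := (norm_nonneg x).trans hx.le
  refine le_csSup ⟨‖shifted h m 0‖ + (L * (1 + ρ + ρ) ^ l + m) * ρ, ?_⟩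
    ⟨x, by simpa using hx, rfl⟩
  rintro _ ⟨y, hy, rfl⟩
  have hy' : ‖y‖ ≤ ρ := by simpa using (Metric.mem_ball.1 hy).le
  have h1 := norm_shifted_sub_le (h := h) hm hL hl hlip hy' (y := 0) (by simpa using hρ)
  rw [sub_zero] at h1
  have h2 := norm_sub_norm_le (shifted h m y) (shifted h m 0)
  have h3 : (L * (1 + ρ + ρ) ^ l + m) * ‖y‖ ≤ (L * (1 + ρ + ρ) ^ l + m) * ρ := by gcongr
  simp only
  linarith

/-- Only the existence of some K matters: over an empty set the infimum in `lipConst` would be 0 and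
would say nothing about M. -/
theorem exists_lipschitzWith_tamedDrift (hm : 0 < m) (hL : 0 < L) (hl : 0 < l) (hlam : 0 < lam)
    (hlip : ∀ x y : Vec d, ‖h x - h y‖ ≤ L * (1 + ‖x‖ + ‖y‖) ^ l * ‖x - y‖) :
    ∃ K : ℝ≥0, LipschitzWith K (tamedDrift h m L l lam) := by
  have hρ : 0 < tamingRadius m L l lam := tamingRadius_pos hm hL hlam
  set ρ := tamingRadius m L l lam with hρd
  set R := tamingSup h m L l lam with hRd
  have hg : ∀ x : Vec d, ‖x‖ < ρ → ‖shifted h m x‖ ≤ R := fun x hx =>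
    norm_shifted_le_tamingSup hm hL hl hlip hx
  have hR : 0 ≤ R := (norm_nonneg _).trans (hg 0 (by simpa using hρ))
  set Kg := L * (1 + ρ + ρ) ^ l + m
  have hKg : 0 ≤ Kg := by positivity
  have hT1 : ∀ s, |cutT ρ s| ≤ 1 := fun s => by rw [cutT_eq]; exact abs_clamp_le_one _
  have hTl : ∀ x y : Vec d, |cutT ρ ‖x‖ - cutT ρ ‖y‖| ≤ ‖x - y‖ := fun x y => by
    rw [cutT_eq, cutT_eq]
    refine (abs_clamp_sub_le _ _).trans ?_
    rw [sub_sub_sub_cancel_left, norm_sub_rev]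
    exact abs_norm_sub_norm_le _ _
  have hT0 : ∀ x : Vec d, ρ ≤ ‖x‖ → cutT ρ ‖x‖ = 0 := fun x hx => by
    rw [cutT_eq, min_eq_right (by linarith), max_eq_left (by linarith)]
  have f1 : ∀ x y : Vec d, ‖cutT ρ ‖x‖ • shifted h m x - cutT ρ ‖y‖ • shifted h m y‖
      ≤ (Kg + R) * ‖x - y‖ := by
    -- The bound |g| ≤ R_λ holds only inside the ball, so the variation of t must be multiplied by g
    -- at an endpoint lying there.
    have aux : ∀ x y : Vec d, ‖y‖ < ρ →
        ‖cutT ρ ‖x‖ • shifted h m x - cutT ρ ‖y‖ • shifted h m y‖ ≤ (Kg + R) * ‖x - y‖ := by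
      intro x y hy
      rcases lt_or_ge ‖x‖ ρ with hx | hx
      · refine (norm_smul_sub_smul_le _ _ _ _).trans ?_
        have h1 := norm_shifted_sub_le (h := h) hm hL hl hlip hx.le hy.le
        calc _ ≤ 1 * (Kg * ‖x - y‖) + ‖x - y‖ * R := by
              gcongr
              · exact hT1 _
              · exact hTl x y
              · exact hg y hy
          _ = _ := by ring
      · rw [hT0 x hx, zero_smul, zero_sub, norm_neg, norm_smul, Real.norm_eq_abs]
        have h2 := hTl x y
        rw [hT0 x hx, zero_sub, abs_neg] at h2
        calc _ ≤ ‖x - y‖ * R := by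
              gcongr
              exact hg y hy
          _ ≤ (Kg + R) * ‖x - y‖ := by nlinarith [mul_nonneg hKg (norm_nonneg (x - y))]
    intro x y
    rcases lt_or_ge ‖y‖ ρ with hy | hy
    · exact aux x y hy
    rcases lt_or_ge ‖x‖ ρ with hx | hx
    · rw [norm_sub_rev, norm_sub_rev x y]; exact aux y x hx
    · rw [hT0 x hx, hT0 y hy]; simp; positivity
  have f2 : ∀ x y : Vec d, ‖cutS ρ ‖x‖ • x - cutS ρ ‖y‖ • y‖ ≤ (2 + ρ) * ‖x - y‖ := by
    intro x y
    rw [cutS_eq hρ, cutS_eq hρ, mul_smul, mul_smul]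
    refine (norm_smul_sub_smul_le _ _ _ _).trans ?_
    have h1 := norm_retract_sub_le hρ x y
    have h2 : |max 0 (min 1 (‖x‖ - ρ + 2)) - max 0 (min 1 (‖y‖ - ρ + 2))| ≤ ‖x - y‖ := by
      refine (abs_clamp_sub_le _ _).trans ?_
      rw [show ‖x‖ - ρ + 2 - (‖y‖ - ρ + 2) = ‖x‖ - ‖y‖ by ring]
      exact abs_norm_sub_norm_le _ _
    have h3 : ‖(ρ / max ρ ‖y‖) • y‖ ≤ ρ := by
      have hy : 0 < max ρ ‖y‖ := lt_max_of_lt_left hρ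
      rw [norm_smul, Real.norm_eq_abs, abs_of_pos (by positivity)]
      calc ρ / max ρ ‖y‖ * ‖y‖ ≤ ρ / max ρ ‖y‖ * max ρ ‖y‖ := by
            gcongr; exact le_max_right _ _
        _ = ρ := by field_simp
    calc _ ≤ 1 * (2 * ‖x - y‖) + ‖x - y‖ * ρ := by
          gcongr
          exact abs_clamp_le_one _
      _ = _ := by ring
  refine ⟨Real.toNNReal ((Kg + R) + R * (2 + ρ) + m), LipschitzWith.of_dist_le' fun x y => ?_⟩
  rw [dist_eq_norm, dist_eq_norm]
  have e : tamedDrift h m L l lam x - tamedDrift h m L l lam y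
      = (cutT ρ ‖x‖ • shifted h m x - cutT ρ ‖y‖ • shifted h m y)
        + R • (cutS ρ ‖x‖ • x - cutS ρ ‖y‖ • y) + m • (x - y) := by
    unfold tamedDrift; simp only [← hρd, ← hRd]; module
  rw [e]
  refine (norm_add₃_le).trans ?_
  rw [norm_smul, norm_smul, Real.norm_eq_abs, Real.norm_eq_abs, abs_of_nonneg hR, abs_of_pos hm]
  have := f1 x y
  have := mul_le_mul_of_nonneg_left (f2 x y) hR
  linarith

end Tamed

/-! ### The derivative of the tamed drift, region by region. -/

section NormDeriv

variable {V : Type*} [NormedAddCommGroup V] [InnerProductSpace ℝ V]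

theorem hasFDerivAt_norm_of_ne_zero {x : V} (hx : x ≠ 0) :
    HasFDerivAt (fun y : V => ‖y‖) (innerSL ℝ (‖x‖⁻¹ • x)) x := by
  have h0 := norm_pos_iff.2 hx
  have h1 := (hasStrictFDerivAt_norm_sq x).hasFDerivAt.sqrt (by positivity)
  simp only [Real.sqrt_sq (norm_nonneg _)] at h1
  refine h1.congr_fderiv ?_
  ext y
  simp
  field_simp

/-- The gradient of a function on a Hilbert space has a symmetric derivative wherever it is
differentiable. -/
theorem inner_fderiv_gradient_symm [CompleteSpace V] {u : V → ℝ} (hu : Differentiable ℝ u) {x : V}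
    {H : V →L[ℝ] V} (hH : HasFDerivAt (gradient u) H x) (v w : V) :
    inner ℝ (H v) w = inner ℝ (H w) v := by
  have h1 : ∀ y, HasFDerivAt u (InnerProductSpace.toDual ℝ V (gradient u y)) y := fun y =>
    (hu y).hasGradientAt.hasFDerivAt
  have h2 : HasFDerivAt (fun y => InnerProductSpace.toDual ℝ V (gradient u y))
      ((innerSL ℝ).comp H) x :=
    ((innerSL ℝ : V →L[ℝ] V →L[ℝ] ℝ).hasFDerivAt).comp x hH
  -- The gradient need be differentiable only at x; u itself is differentiable everywhere.
  have := second_derivative_symmetric h1 h2 v w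
  simpa using this

/-- Derivative of a radially modulated vector field. -/
theorem hasFDerivAt_radial_smul {τ : ℝ → ℝ} {τ' : ℝ} {G : V → V} {H : V →L[ℝ] V} {x : V}
    (hx : x ≠ 0) (hτ : HasDerivAt τ τ' ‖x‖) (hG : HasFDerivAt G H x) :
    HasFDerivAt (fun y => τ ‖y‖ • G y)
      (τ ‖x‖ • H + (τ' • innerSL ℝ (‖x‖⁻¹ • x)).smulRight (G x)) x :=
  (hτ.comp_hasFDerivAt x (hasFDerivAt_norm_of_ne_zero hx)).smul hG

end NormDeriv

section Tamed

variable {d : ℕ} {u : Vec d → ℝ} {m L l lam M : ℝ}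

/-- Subtracting m x uses one half of the convexity 2m and leaves m for g. -/
theorem inner_shifted_ge
    (hconv : ∀ x y : Vec d, 2 * m * ‖x - y‖ ^ 2 ≤ inner ℝ (gradient u x - gradient u y) (x - y))
    (x y : Vec d) :
    m * ‖y - x‖ ^ 2 ≤ inner ℝ (shifted (gradient u) m y - shifted (gradient u) m x) (y - x) := by
  have e : shifted (gradient u) m y - shifted (gradient u) m x
      = (gradient u y - gradient u x) - m • (y - x) := by unfold shifted; module
  rw [e, inner_sub_left, inner_smul_left, real_inner_self_eq_norm_sq]
  have := hconv y x
  simp only [RCLike.conj_to_real]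
  linarith

theorem inner_fderiv_shifted_symm (hu : Differentiable ℝ u) {x : Vec d} {H : Vec d →L[ℝ] Vec d}
    (hH : HasFDerivAt (shifted (gradient u) m) H x) (v w : Vec d) :
    inner ℝ (H v) w = inner ℝ (H w) v := by
  have h1 : HasFDerivAt (gradient u) (H + m • ContinuousLinearMap.id ℝ (Vec d)) x := by
    have := hH.add ((hasFDerivAt_id x).const_smul m)
    refine this.congr_of_eventuallyEq (Eventually.of_forall fun y => ?_)
    simp [shifted]
  have := inner_fderiv_gradient_symm hu h1 v w
  simp only [add_apply, smul_apply, ContinuousLinearMap.id_apply, inner_add_left, inner_smul_left,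
    RCLike.conj_to_real, real_inner_comm w v] at this
  linarith

/-- Wherever the tamed drift is locally of the form `τ g + (R σ + m) x` with `τ ≠ 0` differentiable,
its derivative is given by the product rule. -/
theorem fderiv_eq_of_local {g T : Vec d → Vec d} {τ σ : ℝ → ℝ} {τ' σ' R : ℝ} {x : Vec d}
    (hx : x ≠ 0) (hτ : HasDerivAt τ τ' ‖x‖) (hσ : HasDerivAt σ σ' ‖x‖) (hτ0 : τ ‖x‖ ≠ 0)
    (hT : DifferentiableAt ℝ T x)
    (hloc : T =ᶠ[𝓝 x] fun y => τ ‖y‖ • g y + (R * σ ‖y‖) • y + m • y) :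
    ∃ H : Vec d →L[ℝ] Vec d, HasFDerivAt g H x ∧ ∀ ξ, fderiv ℝ T x ξ
      = τ ‖x‖ • H ξ + (τ' * inner ℝ (‖x‖⁻¹ • x) ξ) • g x + (R * σ ‖x‖) • ξ
        + (R * (σ' * inner ℝ (‖x‖⁻¹ • x) ξ)) • x + m • ξ := by
  have hid := hasFDerivAt_id (𝕜 := ℝ) x
  have hS := hasFDerivAt_radial_smul hx (hσ.const_mul R) hid
  -- As τ ≠ 0, the local formula can be solved for g, which inherits differentiability from T.
  have hgd : DifferentiableAt ℝ g x := by
    have h1 : DifferentiableAt ℝ (fun y => (τ ‖y‖)⁻¹ • (T y - (R * σ ‖y‖) • y - m • y)) x := by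
      have hn := (hasFDerivAt_norm_of_ne_zero hx).differentiableAt
      have ht : DifferentiableAt ℝ (fun y : Vec d => τ ‖y‖) x :=
        (hτ.comp_hasFDerivAt x (hasFDerivAt_norm_of_ne_zero hx)).differentiableAt
      exact (ht.inv hτ0).smul ((hT.sub hS.differentiableAt).sub (differentiableAt_id.const_smul m))
    refine h1.congr_of_eventuallyEq ?_
    have hne : ∀ᶠ y in 𝓝 x, τ ‖y‖ ≠ 0 :=
      (hτ.continuousAt.comp (f := fun y : Vec d => ‖y‖) continuous_norm.continuousAt).eventually_ne
        hτ0
    filter_upwards [hloc, hne] with y hy hne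
    rw [hy, add_sub_right_comm, add_sub_cancel_right, add_sub_cancel_right, smul_smul,
      inv_mul_cancel₀ hne, one_smul]
  refine ⟨fderiv ℝ g x, hgd.hasFDerivAt, fun ξ => ?_⟩
  have hG := hasFDerivAt_radial_smul hx hτ hgd.hasFDerivAt
  have hall := (hG.add hS).add (hid.const_smul m)
  have := (hall.congr_of_eventuallyEq hloc).fderiv
  rw [this]
  simp [inner_smul_left]
  module

theorem fderiv_eq_of_local_outer {T : Vec d → Vec d} {σ : ℝ → ℝ} {σ' R : ℝ} {x : Vec d}
    (hx : x ≠ 0) (hσ : HasDerivAt σ σ' ‖x‖)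
    (hloc : T =ᶠ[𝓝 x] fun y => (R * σ ‖y‖) • y + m • y) (ξ : Vec d) :
    fderiv ℝ T x ξ = (R * σ ‖x‖) • ξ
        + (R * (σ' * inner ℝ (‖x‖⁻¹ • x) ξ)) • x + m • ξ := by
  have hid := hasFDerivAt_id (𝕜 := ℝ) x
  have hS := hasFDerivAt_radial_smul hx (hσ.const_mul R) hid
  have hall := hS.add (hid.const_smul m)
  have := (hall.congr_of_eventuallyEq hloc).fderiv
  rw [this]
  simp [inner_smul_left]
  module

/-- Pointwise monotonicity and cocoercivity of the derivative of the tamed drift. -/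
theorem fderiv_tamedDrift_bounds (hu : Differentiable ℝ u) (hm : 0 < m) (hL : 0 < L) (hl : 0 < l)
    (hlam : 0 < lam)
    (hconv : ∀ x y : Vec d, 2 * m * ‖x - y‖ ^ 2 ≤ inner ℝ (gradient u x - gradient u y) (x - y))
    (hlip : ∀ x y : Vec d,
      ‖gradient u x - gradient u y‖ ≤ L * (1 + ‖x‖ + ‖y‖) ^ l * ‖x - y‖)
    {x : Vec d} (hx : x ≠ 0) (h2 : ‖x‖ ≠ tamingRadius m L l lam - 2)
    (h1 : ‖x‖ ≠ tamingRadius m L l lam - 1) (h0 : ‖x‖ ≠ tamingRadius m L l lam)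
    (hT : DifferentiableAt ℝ (tamedDrift (gradient u) m L l lam) x)
    (hM : ∀ ξ, ‖fderiv ℝ (tamedDrift (gradient u) m L l lam) x ξ‖ ≤ M * ‖ξ‖) (ξ : Vec d) :
    m * ‖ξ‖ ^ 2 ≤ inner ℝ (fderiv ℝ (tamedDrift (gradient u) m L l lam) x ξ) ξ ∧
      ‖fderiv ℝ (tamedDrift (gradient u) m L l lam) x ξ‖ ^ 2
        ≤ (2 * M - m) * inner ℝ (fderiv ℝ (tamedDrift (gradient u) m L l lam) x ξ) ξ := by
  have hρ : 0 < tamingRadius m L l lam := tamingRadius_pos hm hL hlam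
  have hgR : ∀ x : Vec d, ‖x‖ < tamingRadius m L l lam →
      ‖shifted (gradient u) m x‖ ≤ tamingSup (gradient u) m L l lam := fun x hx =>
    norm_shifted_le_tamingSup hm hL hl hlip hx
  set T := tamedDrift (gradient u) m L l lam with hTd
  have hTe : ∀ y, T y = cutT (tamingRadius m L l lam) ‖y‖ • shifted (gradient u) m y
    + (tamingSup (gradient u) m L l lam * cutS (tamingRadius m L l lam) ‖y‖) • y + m • y :=
    fun y => rfl
  set ρ := tamingRadius m L l lam
  set R := tamingSup (gradient u) m L l lam
  set g := shifted (gradient u) m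
  have hR : 0 ≤ R := (norm_nonneg _).trans (hgR 0 (by simpa using hρ))
  have hx0 := norm_pos_iff.2 hx
  set n := ‖x‖⁻¹ • x with hn
  have hn1 : ‖n‖ = 1 := by rw [hn, norm_smul, norm_inv, norm_norm, inv_mul_cancel₀ hx0.ne']
  have hxn : x = ‖x‖ • n := by rw [hn, smul_smul, mul_inv_cancel₀ hx0.ne', one_smul]
  clear_value n
  have hnc : Continuous fun y : Vec d => ‖y‖ := continuous_norm
  have hHpos : ∀ {H : Vec d →L[ℝ] Vec d}, HasFDerivAt g H x → ∀ ξ, m * ‖ξ‖ ^ 2 ≤ inner ℝ (H ξ) ξ :=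
    fun hH ξ => inner_fderiv_ge hH (fun y => inner_shifted_ge hconv x y) ξ
  have hsym : ∀ (hs : ∀ v w, inner ℝ (fderiv ℝ T x v) w = inner ℝ (fderiv ℝ T x w) v)
      (hp : ∀ v, m * ‖v‖ ^ 2 ≤ inner ℝ (fderiv ℝ T x v) v),
      m * ‖ξ‖ ^ 2 ≤ inner ℝ (fderiv ℝ T x ξ) ξ ∧
        ‖fderiv ℝ T x ξ‖ ^ 2 ≤ (2 * M - m) * inner ℝ (fderiv ℝ T x ξ) ξ :=
    fun hs hp => ⟨hp ξ, norm_sq_le_of_symm hs hm hp hM ξ⟩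
  rcases lt_or_gt_of_ne h2 with c2 | c2
  -- Inner ball: the derivative is H + m, with H the derivative of g.
  · have hloc : T =ᶠ[𝓝 x] fun y => (fun _ => (1 : ℝ)) ‖y‖ • g y
        + (R * (fun _ => (0 : ℝ)) ‖y‖) • y + m • y := by
      filter_upwards [hnc.continuousAt.eventually_lt continuousAt_const c2] with y hy
      rw [hTe, cutT, cutS, if_pos (by linarith), if_pos (by linarith)]
    obtain ⟨H, hH, hA⟩ := fderiv_eq_of_local hx (hasDerivAt_const _ _) (hasDerivAt_const _ _)
      one_ne_zero hT hloc
    have hA' : ∀ v, fderiv ℝ T x v = H v + m • v := fun v => by rw [hA]; simp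
    refine hsym (fun v w => ?_) fun v => ?_
    · rw [hA', hA', inner_add_left, inner_add_left, inner_fderiv_shifted_symm hu hH v w,
        inner_smul_left, inner_smul_left, real_inner_comm v w]
    · rw [hA', inner_add_left, inner_smul_left, real_inner_self_eq_norm_sq]
      have := hHpos hH v
      have : 0 ≤ m * ‖v‖ ^ 2 := by positivity
      simp only [RCLike.conj_to_real]
      linarith
  rcases lt_or_gt_of_ne h1 with c1 | c1
  -- Shell where s grows: the derivative of s adds the nonnegative symmetric term ξ ↦ R|x|⟨n, ξ⟩n.
  · have hloc : T =ᶠ[𝓝 x] fun y => (fun _ => (1 : ℝ)) ‖y‖ • g y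
        + (R * (fun s => s - ρ + 2) ‖y‖) • y + m • y := by
      filter_upwards [hnc.continuousAt.eventually_lt continuousAt_const c1,
        continuousAt_const.eventually_lt hnc.continuousAt c2] with y hy hy'
      rw [hTe, cutT, cutS, if_pos (by linarith), if_neg (by linarith), if_pos (by linarith)]
    have hσ : HasDerivAt (fun s : ℝ => s - ρ + 2) 1 ‖x‖ :=
      ((hasDerivAt_id _).sub_const ρ).add_const 2
    obtain ⟨H, hH, hA⟩ := fderiv_eq_of_local hx (hasDerivAt_const _ _) hσ one_ne_zero hT hloc
    simp only [← hn] at hA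
    have hA' : ∀ v, fderiv ℝ T x v = H v + (R * (‖x‖ - ρ + 2)) • v
        + (R * ‖x‖ * inner ℝ n v) • n + m • v := fun v => by
      rw [hA]
      have : (R * (1 * inner ℝ n v)) • x = (R * ‖x‖ * inner ℝ n v) • n := by
        nth_rewrite 1 [hxn]; rw [smul_smul]; congr 1; ring
      rw [this]; simp
    have hσ0 : 0 ≤ ‖x‖ - ρ + 2 := by linarith
    refine hsym (fun v w => ?_) fun v => ?_
    · simp only [hA', inner_add_left, inner_fderiv_shifted_symm hu hH v w,
        inner_smul_left, real_inner_comm v w, RCLike.conj_to_real]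
      ring
    · rw [hA', inner_add_left, inner_add_left, inner_add_left, inner_smul_left, inner_smul_left,
        inner_smul_left, real_inner_self_eq_norm_sq]
      simp only [RCLike.conj_to_real]
      have a1 := hHpos hH v
      have a2 : 0 ≤ m * ‖v‖ ^ 2 := by positivity
      have a3 : 0 ≤ R * (‖x‖ - ρ + 2) * ‖v‖ ^ 2 := by positivity
      have a4 : 0 ≤ R * ‖x‖ * inner ℝ n v * inner ℝ n v := by
        rw [mul_assoc]; exact mul_nonneg (by positivity) (mul_self_nonneg _)
      linarith
  rcases lt_or_gt_of_ne h0 with c0 | c0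
  -- Shell where t decreases: t' = -1 produces the nonsymmetric term -⟨n, ξ⟩g, balanced by R ξ
  -- because |g| ≤ R.
  · have hloc : T =ᶠ[𝓝 x] fun y => (fun s => ρ - s) ‖y‖ • g y
        + (R * (fun _ => (1 : ℝ)) ‖y‖) • y + m • y := by
      filter_upwards [hnc.continuousAt.eventually_lt continuousAt_const c0,
        continuousAt_const.eventually_lt hnc.continuousAt c1] with y hy hy'
      rw [hTe, cutT, cutS, if_neg (by linarith), if_pos hy, if_neg (by linarith),
        if_neg (by linarith), if_pos hy.le]
    have hτ : HasDerivAt (fun s : ℝ => ρ - s) (-1) ‖x‖ := (hasDerivAt_id _).const_sub ρ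
    have hτ0 : 0 < ρ - ‖x‖ := by linarith
    obtain ⟨H, hH, hA⟩ := fderiv_eq_of_local hx hτ (hasDerivAt_const _ _) hτ0.ne' hT hloc
    refine norm_sq_le_of_rank_one (P := (ρ - ‖x‖) • H + m • ContinuousLinearMap.id ℝ (Vec d))
      (n := n) (g := g x) (R := R) (fun v w => ?_) hm (fun v => ?_) hn1 (hgR x c0) (fun v => ?_) hM ξ
    · simp only [add_apply, smul_apply, ContinuousLinearMap.id_apply, inner_add_left,
        inner_smul_left, inner_fderiv_shifted_symm hu hH v w, real_inner_comm v w]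
    · simp only [add_apply, smul_apply, ContinuousLinearMap.id_apply, inner_add_left,
        inner_smul_left, real_inner_self_eq_norm_sq, RCLike.conj_to_real]
      have a1 : 0 ≤ inner ℝ (H v) v := le_trans (by positivity) (hHpos hH v)
      have : 0 ≤ (ρ - ‖x‖) * inner ℝ (H v) v := by positivity
      linarith
    · rw [hA]
      simp only [add_apply, smul_apply, ContinuousLinearMap.id_apply, ← hn]
      module
  -- Exterior: g is absent, and the derivative is m plus Rρ/|x| times the projection orthogonal to
  -- n.
  · have hloc : T =ᶠ[𝓝 x] fun y => (R * (fun s => ρ / s) ‖y‖) • y + m • y := by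
      filter_upwards [continuousAt_const.eventually_lt hnc.continuousAt c0] with y hy
      rw [hTe, cutT, cutS, if_neg (by linarith), if_neg (by linarith), if_neg (by linarith),
        if_neg (by linarith), if_neg (by linarith), zero_smul, zero_add]
    have hσ : HasDerivAt (fun s : ℝ => ρ / s) (-ρ / ‖x‖ ^ 2) ‖x‖ := by
      have : HasDerivAt (fun s : ℝ => ρ / s) _ ‖x‖ :=
        (hasDerivAt_const ‖x‖ ρ).div (hasDerivAt_id ‖x‖) hx0.ne'
      exact this.congr_deriv (by simp)
    have hA := fderiv_eq_of_local_outer hx hσ hloc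
    simp only [← hn] at hA
    have hA' : ∀ v, fderiv ℝ T x v = (R * ρ / ‖x‖) • (v - inner ℝ n v • n) + m • v := fun v => by
      rw [hA]
      have : (R * (-ρ / ‖x‖ ^ 2 * inner ℝ n v)) • x = -((R * ρ / ‖x‖ * inner ℝ n v) • n) := by
        nth_rewrite 2 [hxn]; rw [smul_smul, ← neg_smul]; congr 1; field_simp
      rw [this, mul_div_assoc]; module
    refine hsym (fun v w => ?_) fun v => ?_
    · simp only [hA', inner_add_left, inner_sub_left, inner_smul_left, real_inner_comm v w,
        RCLike.conj_to_real]
      ring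
    · rw [hA', inner_add_left, inner_smul_left, inner_smul_left, inner_sub_left, inner_smul_left,
        real_inner_self_eq_norm_sq]
      simp only [RCLike.conj_to_real]
      have b1 := abs_real_inner_le_norm n v
      rw [hn1, one_mul] at b1
      have b2 : inner ℝ n v * inner ℝ n v ≤ ‖v‖ ^ 2 := by
        rw [← sq, ← sq_abs]; gcongr
      have : 0 ≤ R * ρ / ‖x‖ * (‖v‖ ^ 2 - inner ℝ n v * inner ℝ n v) :=
        mul_nonneg (by positivity) (by linarith)
      linarith

/-- Almost everywhere differentiability of the tamed drift, with the derivative bounds. -/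
theorem ae_fderiv_tamedDrift_bounds (hd : 0 < d) (hu : Differentiable ℝ u) (hm : 0 < m) (hL : 0 < L)
    (hl : 0 < l) (hlam : 0 < lam)
    (hconv : ∀ x y : Vec d, 2 * m * ‖x - y‖ ^ 2 ≤ inner ℝ (gradient u x - gradient u y) (x - y))
    (hlip : ∀ x y : Vec d,
      ‖gradient u x - gradient u y‖ ≤ L * (1 + ‖x‖ + ‖y‖) ^ l * ‖x - y‖)
    {K : ℝ≥0} (hK : LipschitzWith K (tamedDrift (gradient u) m L l lam)) :
    ∀ᵐ x : Vec d, DifferentiableAt ℝ (tamedDrift (gradient u) m L l lam) x ∧ ∀ ξ,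
      m * ‖ξ‖ ^ 2 ≤ inner ℝ (fderiv ℝ (tamedDrift (gradient u) m L l lam) x ξ) ξ ∧
      ‖fderiv ℝ (tamedDrift (gradient u) m L l lam) x ξ‖ ^ 2
        ≤ (2 * K - m) * inner ℝ (fderiv ℝ (tamedDrift (gradient u) m L l lam) x ξ) ξ := by
  have : Nonempty (Fin d) := ⟨⟨0, hd⟩⟩
  -- In positive dimension spheres are null sets. This discards the interfaces and, with r = 0, the
  -- origin, where the norm is not differentiable.
  have hsph : ∀ r : ℝ, ∀ᵐ x : Vec d, ‖x‖ ≠ r := fun r => by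
    have := Measure.addHaar_sphere (volume : Measure (Vec d)) 0 r
    rw [measure_eq_zero_iff_ae_notMem] at this
    filter_upwards [this] with x hx
    simpa using hx
  filter_upwards [hK.ae_differentiableAt (μ := volume), hsph 0,
    hsph (tamingRadius m L l lam - 2), hsph (tamingRadius m L l lam - 1),
    hsph (tamingRadius m L l lam)] with x hx h0 h2 h1 hr
  refine ⟨hx, fun ξ => fderiv_tamedDrift_bounds hu hm hL hl hlam hconv hlip
    (norm_ne_zero_iff.1 h0) h2 h1 hr hx (fun v => ?_) ξ⟩
  exact (ContinuousLinearMap.le_opNorm _ _).trans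
    (mul_le_mul_of_nonneg_right (norm_fderiv_le_of_lipschitz ℝ hK) (norm_nonneg _))

end Tamed

/-! ### Mollification preserving monotonicity and cocoercivity. -/

section Mollify

variable {V : Type*} [NormedAddCommGroup V] [InnerProductSpace ℝ V]

theorem inner_sub_ge_of_fderiv {f : V → V} (hf : Differentiable ℝ f) {c : ℝ}
    (h : ∀ x ξ, c * ‖ξ‖ ^ 2 ≤ inner ℝ (fderiv ℝ f x ξ) ξ) (x y : V) :
    c * ‖x - y‖ ^ 2 ≤ inner ℝ (f x - f y) (x - y) := by
  set ξ := x - y with hξ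
  have hd : ∀ t : ℝ, HasDerivAt (fun t : ℝ => inner ℝ (f (y + t • ξ)) ξ - t * (c * ‖ξ‖ ^ 2))
      (inner ℝ (fderiv ℝ f (y + t • ξ) ξ) ξ - c * ‖ξ‖ ^ 2) t := by
    intro t
    have hl : HasDerivAt (fun t : ℝ => y + t • ξ) ξ t := by
      simpa using ((hasDerivAt_id t).smul_const ξ).const_add y
    have h1 := (hf (y + t • ξ)).hasFDerivAt.comp_hasDerivAt t hl
    have h2 := h1.inner ℝ (hasDerivAt_const t ξ)
    have h3 := (hasDerivAt_id t).mul_const (c * ‖ξ‖ ^ 2)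
    refine (h2.sub h3).congr_deriv ?_
    simp
  have mono := monotone_of_deriv_nonneg (fun t => (hd t).differentiableAt) (fun t => by
    rw [(hd t).deriv]; linarith [h (y + t • ξ) ξ])
  have h01 := mono (zero_le_one' ℝ)
  simp only [zero_smul, add_zero, zero_mul, sub_zero, one_smul, one_mul] at h01
  have hx : y + ξ = x := by rw [hξ]; abel
  rw [hx] at h01
  rw [inner_sub_left]
  linarith

/-- Cocoercivity with constant c means that c·id - 2f is c-Lipschitz. In this form it passes from
derivatives to increments by the mean value inequality, with no symmetry needed. -/
theorem norm_sub_sq_le_of_fderiv {f : V → V} (hf : Differentiable ℝ f) {c : ℝ} (hc : 0 < c)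
    (h : ∀ x ξ, ‖fderiv ℝ f x ξ‖ ^ 2 ≤ c * inner ℝ (fderiv ℝ f x ξ) ξ) (x y : V) :
    ‖f x - f y‖ ^ 2 ≤ c * inner ℝ (f x - f y) (x - y) := by
  have hexp : ∀ a b : V, ‖c • a - (2 : ℝ) • b‖ ^ 2 = c ^ 2 * ‖a‖ ^ 2
      - 4 * (c * inner ℝ b a - ‖b‖ ^ 2) := fun a b => by
    rw [norm_sub_sq_real, norm_smul, norm_smul, mul_pow, mul_pow, inner_smul_left, inner_smul_right,
      Real.norm_eq_abs, sq_abs, real_inner_comm a b]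
    simp
    ring
  set T : V → V := fun z => c • z - (2 : ℝ) • f z with hT
  have hTd : ∀ z, HasFDerivAt T (c • ContinuousLinearMap.id ℝ V - (2 : ℝ) • fderiv ℝ f z) z :=
    fun z => ((hasFDerivAt_id z).const_smul c).sub ((hf z).hasFDerivAt.const_smul (2 : ℝ))
  have hTn : ∀ z, ‖fderiv ℝ T z‖ ≤ c := by
    intro z
    rw [(hTd z).fderiv]
    refine ContinuousLinearMap.opNorm_le_bound _ hc.le fun ξ => ?_
    have e := hexp ξ (fderiv ℝ f z ξ)
    have h1 := h z ξ
    have : ‖c • ξ - (2 : ℝ) • fderiv ℝ f z ξ‖ ^ 2 ≤ (c * ‖ξ‖) ^ 2 := by rw [e, mul_pow]; linarith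
    exact abs_le_of_sq_le_sq' this (by positivity) |>.2
  have key := norm_sub_le_of_norm_fderiv_le (fun z => (hTd z).differentiableAt) hTn y x
  have e1 : T x - T y = c • (x - y) - (2 : ℝ) • (f x - f y) := by simp only [hT]; module
  rw [e1] at key
  have e2 := hexp (x - y) (f x - f y)
  have : ‖c • (x - y) - (2 : ℝ) • (f x - f y)‖ ^ 2 ≤ (c * ‖x - y‖) ^ 2 := by gcongr
  rw [e2, mul_pow] at this
  linarith

variable [FiniteDimensional ℝ V] [MeasurableSpace V] [BorelSpace V]

open ContinuousLinearMap in
/-- Smooth approximation of a Lipschitz field which is almost everywhere strongly monotone and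
cocoercive. -/
theorem exists_contDiff_approx {h : V → V} {M : ℝ≥0} (hM : LipschitzWith M h) {m c : ℝ}
    (hc : 0 < c)
    (hae : ∀ᵐ x : V ∂(volume : Measure V), DifferentiableAt ℝ h x ∧ ∀ ξ, m * ‖ξ‖ ^ 2 ≤ inner ℝ (fderiv ℝ h x ξ) ξ ∧
      ‖fderiv ℝ h x ξ‖ ^ 2 ≤ c * inner ℝ (fderiv ℝ h x ξ) ξ) {ε : ℝ} (hε : 0 < ε) :
    ∃ k : V → V, ContDiff ℝ 1 k ∧ (∀ x, ‖k x - h x‖ ≤ M * ε) ∧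
      (∀ x y, m * ‖x - y‖ ^ 2 ≤ inner ℝ (k x - k y) (x - y)) ∧
      (∀ x y, ‖k x - k y‖ ^ 2 ≤ c * inner ℝ (k x - k y) (x - y)) := by
  let φ : ContDiffBump (0 : V) := ⟨ε / 2, ε, by positivity, by linarith⟩
  set w : V → ℝ := φ.normed volume with hw
  have hw0 : ∀ t, 0 ≤ w t := φ.nonneg_normed
  have hwi : Integrable w := φ.integrable_normed
  have hw1 : ∫ t, w t = 1 := φ.integral_normed
  have hwc : Continuous w := φ.continuous_normed
  have hws : HasCompactSupport w := φ.hasCompactSupport_normed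
  set k : V → V := convolution w h (lsmul ℝ ℝ) volume with hk
  have hkc : ContDiff ℝ 1 k :=
    hws.contDiff_convolution_left (lsmul ℝ ℝ) φ.contDiff_normed hM.continuous.locallyIntegrable
  have hkd : ∀ x, k x = ∫ t, w t • h (x - t) := fun x => rfl
  have hder : ∀ x, Integrable (fun t => w t • fderiv ℝ h (x - t)) ∧
      HasFDerivAt k (∫ t, w t • fderiv ℝ h (x - t)) x := by
    intro x
    have hcont : ∀ y, Continuous fun t => w t • h (y - t) := fun y =>
      hwc.smul (hM.continuous.comp (by fun_prop))
    -- The derivative is put on h rather than on the bump: Lipschitz domination and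
    -- differentiability of h at x - t for almost every t suffice.
    refine hasFDerivAt_integral_of_dominated_loc_of_lip' (F := fun y t => w t • h (y - t))
      (bound := fun t => w t * M) univ_mem (fun y _ => (hcont y).aestronglyMeasurable)
      ((hcont x).integrable_of_hasCompactSupport hws.smul_right) ?_ ?_ (hwi.mul_const _) ?_
    · have : Measurable fun t => fderiv ℝ h (x - t) :=
        (measurable_fderiv ℝ h).comp (by fun_prop)
      exact (hwc.measurable.smul this).aestronglyMeasurable
    · refine Eventually.of_forall fun t y _ => ?_
      rw [← smul_sub, norm_smul, Real.norm_of_nonneg (hw0 t), mul_assoc]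
      refine mul_le_mul_of_nonneg_left ?_ (hw0 t)
      have := hM.norm_sub_le (y - t) (x - t)
      rwa [sub_sub_sub_cancel_right] at this
    · have := (Measure.measurePreserving_sub_left (volume : Measure V) x).quasiMeasurePreserving.ae hae
      filter_upwards [this] with t ht
      have h1 : HasFDerivAt (fun y => h (y - t)) (fderiv ℝ h (x - t)) x :=
        (ht.1.hasFDerivAt.comp x ((hasFDerivAt_id x).sub_const t)).congr_fderiv (by ext; simp)
      exact h1.const_smul (w t)
  have hbd : ∀ x ξ, m * ‖ξ‖ ^ 2 ≤ inner ℝ (fderiv ℝ k x ξ) ξ ∧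
      ‖fderiv ℝ k x ξ‖ ^ 2 ≤ c * inner ℝ (fderiv ℝ k x ξ) ξ := by
    intro x ξ
    obtain ⟨hi, hd⟩ := hder x
    rw [hd.fderiv]
    set D := (∫ t, w t • fderiv ℝ h (x - t)) ξ with hD
    have hae' := (Measure.measurePreserving_sub_left (volume : Measure V) x).quasiMeasurePreserving.ae hae
    have hiξ : Integrable fun t => w t • fderiv ℝ h (x - t) ξ := hi.apply_continuousLinearMap ξ
    have hDe : D = ∫ t, w t • fderiv ℝ h (x - t) ξ :=
      ContinuousLinearMap.integral_apply hi ξ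
    have hin : ∀ z, inner ℝ D z = ∫ t, w t * inner ℝ (fderiv ℝ h (x - t) ξ) z := by
      intro z
      rw [hDe, real_inner_comm, ← integral_inner hiξ]
      congr 1; ext t
      rw [inner_smul_right, real_inner_comm]
    have hinI : ∀ z, Integrable fun t => w t * inner ℝ (fderiv ℝ h (x - t) ξ) z := by
      intro z
      have := hiξ.const_inner (𝕜 := ℝ) z
      refine this.congr (Eventually.of_forall fun t => ?_)
      simp only
      rw [inner_smul_right, real_inner_comm]
    constructor
    · rw [hin]
      calc m * ‖ξ‖ ^ 2 = ∫ t, w t * (m * ‖ξ‖ ^ 2) := by rw [integral_mul_const, hw1, one_mul]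
        _ ≤ _ := by
          refine integral_mono_ae (hwi.mul_const _) (hinI ξ) ?_
          filter_upwards [hae'] with t ht
          exact mul_le_mul_of_nonneg_left (ht.2 ξ).1 (hw0 t)
    -- Convexity of the cocoercivity condition: average 2⟨Aξ, D⟩ ≤ |Aξ|² + |D|² ≤ c⟨Aξ, ξ⟩ + |D|²
    -- over the derivatives A, whose mean applied to ξ is D.
    · have h1 : 2 * inner ℝ D D ≤ c * inner ℝ D ξ + ‖D‖ ^ 2 := by
        rw [hin D, hin ξ, ← integral_const_mul, ← integral_const_mul]
        calc ∫ t, 2 * (w t * inner ℝ (fderiv ℝ h (x - t) ξ) D)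
            ≤ ∫ t, (c * (w t * inner ℝ (fderiv ℝ h (x - t) ξ) ξ) + w t * ‖D‖ ^ 2) := by
              refine integral_mono_ae ((hinI D).const_mul 2)
                (((hinI ξ).const_mul c).add (hwi.mul_const _)) ?_
              filter_upwards [hae'] with t ht
              have a1 := (ht.2 ξ).2
              have a2 := norm_sub_sq_real (fderiv ℝ h (x - t) ξ) D
              have a3 : 2 * inner ℝ (fderiv ℝ h (x - t) ξ) D
                  ≤ c * inner ℝ (fderiv ℝ h (x - t) ξ) ξ + ‖D‖ ^ 2 := by
                linarith [sq_nonneg ‖fderiv ℝ h (x - t) ξ - D‖]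
              have a4 := mul_le_mul_of_nonneg_left a3 (hw0 t)
              linarith
          _ = _ := by
              rw [integral_add ((hinI ξ).const_mul c) (hwi.mul_const _), integral_mul_const, hw1,
                one_mul]
      rw [real_inner_self_eq_norm_sq] at h1
      linarith
  have hdiff : Differentiable ℝ k := hkc.differentiable one_ne_zero
  refine ⟨k, hkc, fun x => ?_, inner_sub_ge_of_fderiv hdiff fun x ξ => (hbd x ξ).1,
    norm_sub_sq_le_of_fderiv hdiff hc fun x ξ => (hbd x ξ).2⟩
  rw [← dist_eq_norm]
  refine φ.dist_normed_convolution_le hM.continuous.aestronglyMeasurable fun y hy => ?_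
  refine (hM.dist_le_mul y x).trans ?_
  have : dist y x ≤ ε := (Metric.mem_ball.1 hy).le
  gcongr

end Mollify

/-! ### Independence of the chain from its next inputs. -/

/-- The joint law of the three variables is a triple product, which only has to be reassociated. -/
theorem ProbabilityTheory.IndepFun.prodMk_left {Ω α β γ : Type*} [MeasurableSpace Ω]
    [MeasurableSpace α] [MeasurableSpace β] [MeasurableSpace γ] {P : Measure Ω}
    [IsProbabilityMeasure P] {X : Ω → α} {Y : Ω → β} {Z : Ω → γ} (hX : Measurable X)
    (hY : Measurable Y) (hZ : Measurable Z) (h : IndepFun X (fun ω => (Y ω, Z ω)) P)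
    (h' : IndepFun Y Z P) : IndepFun (fun ω => (X ω, Y ω)) Z P := by
  have hXY : IndepFun X Y P := h.comp measurable_id measurable_fst
  have pX := Measure.isProbabilityMeasure_map (μ := P) hX.aemeasurable
  have pY := Measure.isProbabilityMeasure_map (μ := P) hY.aemeasurable
  have pZ := Measure.isProbabilityMeasure_map (μ := P) hZ.aemeasurable
  rw [indepFun_iff_map_prod_eq_prod_map_map (by fun_prop) (by fun_prop)] at h h' hXY ⊢
  rw [h'] at h
  have e : (fun ω => ((X ω, Y ω), Z ω))
      = MeasurableEquiv.prodAssoc.symm ∘ fun ω => (X ω, (Y ω, Z ω)) := rfl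
  rw [e, ← Measure.map_map (MeasurableEquiv.measurable _) (by fun_prop), h, hXY,
    ← Measure.prodAssoc_prod]
  exact MeasurableEquiv.map_symm_map _

theorem SatisfiesLSI.map_of_indepFun {Ω E W E' : Type*} [MeasurableSpace Ω] {P : Measure Ω}
    [IsProbabilityMeasure P] [NormedAddCommGroup E] [NormedSpace ℝ E]
    [MeasurableSpace E] [BorelSpace E] [SecondCountableTopology E]
    [NormedAddCommGroup W] [NormedSpace ℝ W] [MeasurableSpace W] [BorelSpace W]
    [SecondCountableTopology W] [NormedAddCommGroup E'] [NormedSpace ℝ E'] [MeasurableSpace E']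
    [BorelSpace E'] {X : Ω → E} {Y : Ω → W} (hX : Measurable X) (hY : Measurable Y)
    (hXY : IndepFun X Y P) {C C' : ℝ} (hμ : SatisfiesLSI (P.map X) C)
    (hν : SatisfiesLSI (P.map Y) C') (hC : 0 ≤ C) (hC' : 0 ≤ C') {T : E × W → E'}
    (hT : ContDiff ℝ 1 T) {r s : ℝ≥0} (hr : ∀ y, LipschitzWith r (fun x => T (x, y)))
    (hs : ∀ x, LipschitzWith s (fun y => T (x, y))) :
    SatisfiesLSI (P.map fun ω => T (X ω, Y ω)) (r ^ 2 * C + s ^ 2 * C') := by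
  have pX := Measure.isProbabilityMeasure_map (μ := P) hX.aemeasurable
  have pY := Measure.isProbabilityMeasure_map (μ := P) hY.aemeasurable
  have e : P.map (fun ω => T (X ω, Y ω)) = ((P.map X).prod (P.map Y)).map T := by
    rw [← (indepFun_iff_map_prod_eq_prod_map_map hX.aemeasurable hY.aemeasurable).1 hXY,
      Measure.map_map hT.continuous.measurable (by fun_prop)]
    rfl
  rw [e]
  exact hμ.map_prod hν hC hC' hT hr hs

section Chain

variable {d : ℕ}

theorem Phase.measurable_toLp : Measurable fun p : Vec d × Vec d => (WithLp.toLp 2 p : Phase d) :=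
  (WithLp.prodContinuousLinearEquiv 2 ℝ (Vec d) (Vec d)).symm.continuous.measurable

theorem Phase.measurable_fst : Measurable fun z : Phase d => z.fst :=
  (continuous_fst.comp (WithLp.prodContinuousLinearEquiv 2 ℝ (Vec d) (Vec d)).continuous).measurable

theorem Phase.measurable_snd : Measurable fun z : Phase d => z.snd :=
  (continuous_snd.comp (WithLp.prodContinuousLinearEquiv 2 ℝ (Vec d) (Vec d)).continuous).measurable

theorem measurable_obaboStep {b : Vec d → Vec d} (hb : Measurable b) (lam gam : ℝ) :
    Measurable fun p : Phase d × (Vec d × Vec d) => obaboStep b lam gam p.1 p.2.1 p.2.2 := by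
  have h1 : Measurable fun p : Phase d × (Vec d × Vec d) => p.1.fst :=
    Phase.measurable_fst.comp measurable_fst
  have h2 : Measurable fun p : Phase d × (Vec d × Vec d) => p.1.snd :=
    Phase.measurable_snd.comp measurable_fst
  unfold obaboStep
  refine Phase.measurable_toLp.comp ?_
  fun_prop

/-- The indices of the inputs used in the first `n` steps. -/
def pastIndices (n : ℕ) : Finset (ℕ ⊕ ℕ) := (Finset.range n).disjSum (Finset.range n)

theorem pastIndices_mono (n : ℕ) : pastIndices n ⊆ pastIndices (n + 1) :=
  Finset.disjSum_mono (Finset.range_mono n.le_succ) (Finset.range_mono n.le_succ)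

/-- The chain at time `n` is a function of the initial condition and of the inputs used so far. -/
theorem exists_obaboChain_eq {Ω : Type*} {z₀ : Ω → Phase d} {G G' : ℕ → Ω → Vec d}
    {b : Vec d → Vec d} (hb : Measurable b) (lam gam : ℝ) (n : ℕ) :
    ∃ Φ : Phase d × (pastIndices n → Vec d) → Phase d, Measurable Φ ∧
      ∀ ω, obaboChain b lam gam z₀ G G' n ω = Φ (z₀ ω, fun i => Sum.elim G G' (i : ℕ ⊕ ℕ) ω) := by
  induction n with
  | zero => exact ⟨Prod.fst, measurable_fst, fun ω => rfl⟩
  | succ n ih =>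
    obtain ⟨Φ, hΦ, hΦe⟩ := ih
    have hl : (Sum.inl n : ℕ ⊕ ℕ) ∈ pastIndices (n + 1) := by simp [pastIndices]
    have hr : (Sum.inr n : ℕ ⊕ ℕ) ∈ pastIndices (n + 1) := by simp [pastIndices]
    refine ⟨fun p => obaboStep b lam gam
      (Φ (p.1, fun i => p.2 ⟨i, pastIndices_mono n i.2⟩)) (p.2 ⟨_, hl⟩) (p.2 ⟨_, hr⟩), ?_, fun ω => ?_⟩
    · refine (measurable_obaboStep hb lam gam).comp (Measurable.prodMk (hΦ.comp
        (measurable_fst.prodMk ?_)) (Measurable.prodMk ?_ ?_))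
      · exact measurable_pi_lambda _ fun i => (measurable_pi_apply _).comp measurable_snd
      · exact (measurable_pi_apply _).comp measurable_snd
      · exact (measurable_pi_apply _).comp measurable_snd
    · simp only [obaboChain, hΦe, Sum.elim_inl, Sum.elim_inr]

variable {Ω : Type*} [MeasurableSpace Ω] {P : Measure Ω} {z₀ : Ω → Phase d} {G G' : ℕ → Ω → Vec d}

theorem measurable_obaboChain {b : Vec d → Vec d} (hb : Measurable b) (lam gam : ℝ)
    (hz₀ : Measurable z₀) (hG : ∀ k, Measurable (G k)) (hG' : ∀ k, Measurable (G' k)) (n : ℕ) :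
    Measurable (obaboChain b lam gam z₀ G G' n) := by
  induction n with
  | zero => exact hz₀
  | succ n ih => exact (measurable_obaboStep hb lam gam).comp (ih.prodMk ((hG n).prodMk (hG' n)))

/-- The state at time n depends only on the initial condition and on inputs with index below n, a
block disjoint from the two inputs of the next step. -/
theorem indepFun_obaboChain [IsProbabilityMeasure P] {b : Vec d → Vec d} (hb : Measurable b)
    (lam gam : ℝ) (hz₀ : Measurable z₀) (hG : ∀ k, Measurable (G k)) (hG' : ∀ k, Measurable (G' k))
    (hindep : iIndepFun (fun i : ℕ ⊕ ℕ => Sum.elim G G' i) P)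
    (hindep₀ : IndepFun z₀ (fun ω (i : ℕ ⊕ ℕ) => Sum.elim G G' i ω) P) (n : ℕ) :
    IndepFun (obaboChain b lam gam z₀ G G' n) (fun ω => (G n ω, G' n ω)) P := by
  have hm : ∀ i : ℕ ⊕ ℕ, Measurable (Sum.elim G G' i) := by
    rintro (i | i)
    · exact hG i
    · exact hG' i
  obtain ⟨Φ, hΦ, hΦe⟩ := exists_obaboChain_eq (z₀ := z₀) (G := G) (G' := G') hb lam gam n
  have hdisj : Disjoint (pastIndices n) {Sum.inl n, Sum.inr n} := by
    rw [Finset.disjoint_right]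
    simp [pastIndices]
  have h1 := hindep.indepFun_finset _ _ hdisj hm
  have hmem1 : (Sum.inl n : ℕ ⊕ ℕ) ∈ ({Sum.inl n, Sum.inr n} : Finset (ℕ ⊕ ℕ)) := by simp
  have hmem2 : (Sum.inr n : ℕ ⊕ ℕ) ∈ ({Sum.inl n, Sum.inr n} : Finset (ℕ ⊕ ℕ)) := by simp
  have hψ : Measurable fun p : (({Sum.inl n, Sum.inr n} : Finset (ℕ ⊕ ℕ)) → Vec d) =>
      (p ⟨_, hmem1⟩, p ⟨_, hmem2⟩) := (measurable_pi_apply _).prodMk (measurable_pi_apply _)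
  have h2 : IndepFun (fun ω (i : pastIndices n) => Sum.elim G G' (i : ℕ ⊕ ℕ) ω)
      (fun ω => (G n ω, G' n ω)) P := h1.comp measurable_id hψ
  have hχ : Measurable fun p : (ℕ ⊕ ℕ → Vec d) =>
      ((fun i : pastIndices n => p (i : ℕ ⊕ ℕ)), (p (Sum.inl n), p (Sum.inr n))) :=
    (measurable_pi_lambda _ fun i => measurable_pi_apply _).prodMk
      ((measurable_pi_apply _).prodMk (measurable_pi_apply _))
  have h3 : IndepFun z₀ (fun ω => ((fun (i : pastIndices n) => Sum.elim G G' (i : ℕ ⊕ ℕ) ω),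
      (G n ω, G' n ω))) P := hindep₀.comp measurable_id hχ
  have hY : Measurable fun ω (i : pastIndices n) => Sum.elim G G' (i : ℕ ⊕ ℕ) ω :=
    measurable_pi_lambda _ fun i => hm i
  have h4 := h3.prodMk_left hz₀ hY ((hG n).prodMk (hG' n)) h2
  have h5 := h4.comp hΦ measurable_id
  have e : obaboChain b lam gam z₀ G G' n
      = Φ ∘ fun ω => (z₀ ω, fun (i : pastIndices n) => Sum.elim G G' (i : ℕ ⊕ ℕ) ω) :=
    funext hΦe
  rw [e]
  exact h5

end Chain

/-! ### The twisted norm and the linear change of coordinates. -/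

section Shear

variable {d : ℕ}

theorem Phase.contDiff_toLp :
    ContDiff ℝ 1 fun p : Vec d × Vec d => (WithLp.toLp 2 p : Phase d) :=
  (WithLp.prodContinuousLinearEquiv 2 ℝ (Vec d) (Vec d)).symm.contDiff

theorem Phase.contDiff_fst : ContDiff ℝ 1 fun z : Phase d => z.fst :=
  (WithLp.prodContinuousLinearEquiv 2 ℝ (Vec d) (Vec d)).contDiff.fst

theorem Phase.contDiff_snd : ContDiff ℝ 1 fun z : Phase d => z.snd :=
  (WithLp.prodContinuousLinearEquiv 2 ℝ (Vec d) (Vec d)).contDiff.snd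

theorem Phase.ext {z z' : Phase d} (h1 : z.fst = z'.fst) (h2 : z.snd = z'.snd) : z = z' :=
  WithLp.ofLp_injective 2 (Prod.ext h1 h2)

theorem shear_sub (a b : ℝ) (z z' : Phase d) :
    shear a b z - shear a b z' = shear a b (z - z') := by
  refine Phase.ext ?_ ?_
  · simp only [shear, WithLp.toLp_fst, WithLp.sub_fst, WithLp.sub_snd]
    module
  · simp only [shear, WithLp.toLp_snd, WithLp.sub_snd]
    module

theorem shear_add (a b : ℝ) (z z' : Phase d) :
    shear a b (z + z') = shear a b z + shear a b z' := by
  refine Phase.ext ?_ ?_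
  · simp only [shear, WithLp.toLp_fst, WithLp.add_fst, WithLp.add_snd]
    module
  · simp only [shear, WithLp.toLp_snd, WithLp.add_snd]
    module

theorem contDiff_shear (a b : ℝ) : ContDiff ℝ 1 (shear (d := d) a b) :=
  Phase.contDiff_toLp.comp ((Phase.contDiff_fst.add (Phase.contDiff_snd.const_smul b)).prodMk
    (Phase.contDiff_snd.const_smul _))

theorem norm_sq_shear {a b : ℝ} (hab : b ^ 2 ≤ a) (z : Phase d) :
    ‖shear a b z‖ ^ 2 = ‖z.fst‖ ^ 2 + 2 * b * inner ℝ z.fst z.snd + a * ‖z.snd‖ ^ 2 := by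
  have e1 : (shear a b z).fst = z.fst + b • z.snd := rfl
  have e2 : (shear a b z).snd = √(a - b ^ 2) • z.snd := rfl
  rw [WithLp.prod_norm_sq_eq_of_L2, e1, e2, norm_add_sq_real, norm_smul, norm_smul,
    inner_smul_right, mul_pow, mul_pow, Real.norm_eq_abs, Real.norm_eq_abs, sq_abs, sq_abs,
    Real.sq_sqrt (by linarith)]
  ring

/-- Uses 2b⟨x, v⟩ ≤ |x|² + b²|v|² and b² ≤ a/4. -/
theorem norm_sq_shear_le {a b : ℝ} (hab : 4 * b ^ 2 ≤ a) (z : Phase d) :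
    ‖shear a b z‖ ^ 2 ≤ 2 * ‖z.fst‖ ^ 2 + 5 / 4 * a * ‖z.snd‖ ^ 2 := by
  rw [norm_sq_shear (by nlinarith [sq_nonneg b])]
  have h := norm_sub_sq_real z.fst (b • z.snd)
  rw [inner_smul_right, norm_smul, mul_pow, Real.norm_eq_abs, sq_abs] at h
  nlinarith [sq_nonneg ‖z.fst - b • z.snd‖, sq_nonneg ‖z.snd‖,
    mul_le_mul_of_nonneg_right hab (sq_nonneg ‖z.snd‖)]

/-- The inverse of `shear a b` when `b ^ 2 < a`. -/
noncomputable def unshear (a b : ℝ) (w : Phase d) : Phase d :=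
  WithLp.toLp 2 (w.fst - (b / √(a - b ^ 2)) • w.snd, (1 / √(a - b ^ 2)) • w.snd)

theorem contDiff_unshear (a b : ℝ) : ContDiff ℝ 1 (unshear (d := d) a b) :=
  Phase.contDiff_toLp.comp ((Phase.contDiff_fst.sub (Phase.contDiff_snd.const_smul _)).prodMk
    (Phase.contDiff_snd.const_smul _))

theorem shear_unshear {a b : ℝ} (hab : b ^ 2 < a) (w : Phase d) :
    shear a b (unshear a b w) = w := by
  have hc : √(a - b ^ 2) ≠ 0 := (Real.sqrt_pos.2 (by linarith)).ne'
  refine Phase.ext ?_ ?_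
  · simp only [shear, WithLp.toLp_fst, WithLp.toLp_snd, unshear]
    rw [smul_smul, mul_one_div, sub_add_cancel]
  · simp only [shear, WithLp.toLp_fst, WithLp.toLp_snd, unshear]
    rw [smul_smul, mul_one_div, div_self hc, one_smul]

theorem unshear_shear {a b : ℝ} (hab : b ^ 2 < a) (z : Phase d) :
    unshear a b (shear a b z) = z := by
  have hc : √(a - b ^ 2) ≠ 0 := (Real.sqrt_pos.2 (by linarith)).ne'
  refine Phase.ext ?_ ?_
  · simp only [shear, WithLp.toLp_fst, WithLp.toLp_snd, unshear]
    rw [smul_smul, div_mul_cancel₀ _ hc, add_sub_cancel_right]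
  · simp only [shear, WithLp.toLp_fst, WithLp.toLp_snd, unshear]
    rw [smul_smul, one_div_mul_cancel hc, one_smul]

/-- The squared constant is Q = √(1 + a), the factor in front of the initial constant. The bound by
Q(|x|² + |v|²) reduces to b² ≤ (Q - 1)(Q - a), for which a ≤ 1/2, that is M ≥ 2, is used. -/
theorem lipschitzWith_shear {a b : ℝ} (ha : a ≤ 1 / 2) (ha0 : 0 < a) (hab : 4 * b ^ 2 ≤ a) :
    LipschitzWith (NNReal.sqrt (Real.toNNReal √(1 + a))) (shear (d := d) a b) := by
  refine LipschitzWith.of_dist_le_mul fun z z' => ?_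
  rw [dist_eq_norm, dist_eq_norm, shear_sub]
  generalize z - z' = y
  have hQ2 : √(1 + a) ^ 2 = 1 + a := Real.sq_sqrt (by linarith)
  have hQ0 := Real.sqrt_nonneg (1 + a)
  set Q := √(1 + a) with hQ
  have hQ1 : 1 ≤ Q := by nlinarith
  have hQa : 1 + 4 * a ≤ 3 * Q := by nlinarith
  refine abs_le_of_sq_le_sq' ?_ (by positivity) |>.2
  rw [mul_pow, ← NNReal.coe_pow, NNReal.sq_sqrt, Real.coe_toNNReal _ hQ0,
    norm_sq_shear (by nlinarith [sq_nonneg b]), WithLp.prod_norm_sq_eq_of_L2]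
  have hkey : b ^ 2 ≤ (Q - 1) * (Q - a) := by nlinarith
  have h2 : 2 * b * inner ℝ y.fst y.snd ≤ (2 * |b|) * ‖y.fst‖ * ‖y.snd‖ := by
    have := abs_real_inner_le_norm y.fst y.snd
    calc 2 * b * inner ℝ y.fst y.snd ≤ |2 * b * inner ℝ y.fst y.snd| := le_abs_self _
      _ = 2 * |b| * |inner ℝ y.fst y.snd| := by rw [abs_mul, abs_mul, abs_two]
      _ ≤ 2 * |b| * (‖y.fst‖ * ‖y.snd‖) := by gcongr
      _ = _ := by ring
  have h3 := mul_mul_le_of_sq_le (P := Q - 1) (Q := Q - a) (R := 2 * |b|) (y := ‖y.fst‖)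
    (w := ‖y.snd‖) (by linarith) (by linarith) (by rw [mul_pow, sq_abs]; linarith)
  linarith

end Shear

/-! ### Lipschitz bounds for one step. -/

/-- The relations between the parameters of the OBABO scheme under which it contracts the
norm `‖shear a b ·‖`. -/
structure ObaboParams (a b γ m M lam : ℝ) : Prop where
  m_pos : 0 < m
  m_le : m ≤ M
  two_le : 2 ≤ M
  a_mul : a * M = 1
  b_mul : b * γ = 1
  γ_pos : 0 < γ
  four_b_le : 4 * b ≤ a * γ
  lam_pos : 0 < lam
  step_le : 33 * (lam * γ) ≤ m * b ^ 2

namespace ObaboParams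

variable {a b γ m M lam : ℝ}

theorem a_pos (h : ObaboParams a b γ m M lam) : 0 < a := by
  have h1 := h.a_mul
  have h2 := h.two_le
  by_contra hc
  nlinarith

theorem a_le (h : ObaboParams a b γ m M lam) : a ≤ 1 / 2 := by
  have h1 := h.a_mul
  nlinarith [h.a_pos, h.two_le]

theorem b_pos (h : ObaboParams a b γ m M lam) : 0 < b := by
  have h1 := h.b_mul
  have h2 := h.γ_pos
  by_contra hc
  nlinarith

theorem four_b_sq_le (h : ObaboParams a b γ m M lam) : 4 * b ^ 2 ≤ a := by
  have h1 := mul_le_mul_of_nonneg_right h.four_b_le h.b_pos.le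
  have h2 : a * γ * b = a := by rw [mul_assoc, mul_comm γ, h.b_mul, mul_one]
  nlinarith

theorem b_sq_lt (h : ObaboParams a b γ m M lam) : b ^ 2 < a := by
  nlinarith [h.four_b_sq_le, h.a_pos]

theorem lam_mul_γ_le (h : ObaboParams a b γ m M lam) : lam * γ ≤ 1 / 132 := by
  have h1 : m * b ^ 2 ≤ M * b ^ 2 := mul_le_mul_of_nonneg_right h.m_le (sq_nonneg b)
  have h2 : M * (4 * b ^ 2) ≤ M * a :=
    mul_le_mul_of_nonneg_left h.four_b_sq_le (by linarith [h.two_le])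
  linarith [h.step_le, h.a_mul, mul_comm M a]

theorem lam_sq_mul_le (h : ObaboParams a b γ m M lam) : lam ^ 2 * M ≤ 1 / 100 := by
  have h0 : 0 < lam * γ := mul_pos h.lam_pos h.γ_pos
  have h2 : M * (4 * b ^ 2) ≤ M * a :=
    mul_le_mul_of_nonneg_left h.four_b_sq_le (by linarith [h.two_le])
  have h3 : lam = lam * γ * b := by rw [mul_assoc, mul_comm γ, h.b_mul, mul_one]
  have h4 : lam ^ 2 * M = (lam * γ) ^ 2 * (M * b ^ 2) := by
    nth_rewrite 1 [h3]
    ring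
  have h5 : M * b ^ 2 ≤ 1 / 4 := by linarith [h.a_mul, mul_comm M a]
  have h6 : (lam * γ) ^ 2 ≤ 1 / 132 ^ 2 := by nlinarith [h.lam_mul_γ_le]
  rw [h4]
  nlinarith [sq_nonneg (lam * γ)]

end ObaboParams

section Step

variable {d : ℕ} {a b γ m M lam : ℝ} {k : Vec d → Vec d}

theorem norm_sub_le_of_cocoercive {c : ℝ} (hc : 0 ≤ c)
    (hcoc : ∀ x y, ‖k x - k y‖ ^ 2 ≤ c * inner ℝ (k x - k y) (x - y)) (x y : Vec d) :
    ‖k x - k y‖ ≤ c * ‖x - y‖ := by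
  have h1 := mul_le_mul_of_nonneg_left (real_inner_le_norm (k x - k y) (x - y)) hc
  have h2 := hcoc x y
  by_contra! h3
  have h4 : 0 ≤ c * ‖x - y‖ := by positivity
  nlinarith

/-- The OBABO step is a contraction in the initial condition. -/
theorem norm_sq_shear_obaboStep_sub_le (hp : ObaboParams a b γ m M lam)
    (hmon : ∀ x y, m * ‖x - y‖ ^ 2 ≤ inner ℝ (k x - k y) (x - y))
    (hcoc : ∀ x y, ‖k x - k y‖ ^ 2 ≤ (2 * M - m) * inner ℝ (k x - k y) (x - y))
    (z z' : Phase d) (g g' : Vec d) :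
    ‖shear a b (obaboStep k lam γ z g g') - shear a b (obaboStep k lam γ z' g g')‖ ^ 2
      ≤ (1 - lam * (m * b / 3)) * ‖shear a b z - shear a b z'‖ ^ 2 := by
  rw [shear_sub, shear_sub, norm_sq_shear hp.b_sq_lt.le, norm_sq_shear hp.b_sq_lt.le]
  set e := Real.exp (-(lam * γ / 2)) with he
  set s := √(1 - e ^ 2) with hs
  set w := e • z.snd + s • g - (lam / 2) • k z.fst with hw
  set w' := e • z'.snd + s • g - (lam / 2) • k z'.fst with hw'
  have hx : (z - z').fst + lam • (w - w') = (z.fst + lam • w) - (z'.fst + lam • w') := by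
    rw [WithLp.sub_fst]
    module
  have h := obabo_contraction_scalars hp.m_pos hp.m_le hp.a_mul hp.b_mul hp.γ_pos hp.four_b_le
    hp.lam_pos hp.step_le rfl (z - z').fst (w - w') (k z.fst - k z'.fst)
    (k (z.fst + lam • w) - k (z'.fst + lam • w')) (hmon _ _)
    (by rw [hx]; exact le_trans (mul_nonneg hp.m_pos.le (sq_nonneg _)) (hmon _ _)) (hcoc _ _)
    (by rw [hx]; exact hcoc _ _) (z - z').snd
    (by rw [WithLp.sub_snd, ← he, hw, hw']; module)
  have e1 : (obaboStep k lam γ z g g' - obaboStep k lam γ z' g g').fst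
      = (z - z').fst + lam • (w - w') := by
    rw [hx]
    rfl
  have e2 : (obaboStep k lam γ z g g' - obaboStep k lam γ z' g g').snd
      = e • ((w - w') - (lam / 2) • (k (z.fst + lam • w) - k (z'.fst + lam • w'))) := by
    have : (obaboStep k lam γ z g g' - obaboStep k lam γ z' g g').snd
      = (e • (w - (lam / 2) • k (z.fst + lam • w)) + s • g')
        - (e • (w' - (lam / 2) • k (z'.fst + lam • w')) + s • g') := rfl
    rw [this]
    module
  rw [e1, e2]
  exact h

/-- The OBABO step is Lipschitz in the first Gaussian input. -/
theorem norm_sq_shear_obaboStep_sub_le_left (hp : ObaboParams a b γ m M lam)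
    (hcoc : ∀ x y, ‖k x - k y‖ ^ 2 ≤ (2 * M - m) * inner ℝ (k x - k y) (x - y))
    (z : Phase d) (g₁ g₂ g' : Vec d) :
    ‖shear a b (obaboStep k lam γ z g₁ g') - shear a b (obaboStep k lam γ z g₂ g')‖
      ≤ √(1 - Real.exp (-(lam * γ / 2)) ^ 2) * ‖g₁ - g₂‖ := by
  refine abs_le_of_sq_le_sq' ?_ (by positivity) |>.2
  rw [shear_sub]
  refine (norm_sq_shear_le hp.four_b_sq_le _).trans ?_
  set e := Real.exp (-(lam * γ / 2)) with he
  set s := √(1 - e ^ 2) with hs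
  set w := e • z.snd + s • g₁ - (lam / 2) • k z.fst with hw
  set w' := e • z.snd + s • g₂ - (lam / 2) • k z.fst with hw'
  have hs0 : 0 ≤ s := Real.sqrt_nonneg _
  have he0 : 0 ≤ e := (Real.exp_pos _).le
  have he1 : e ≤ 1 := Real.exp_le_one_iff.2 (by linarith [mul_pos hp.lam_pos hp.γ_pos])
  have hww : w - w' = s • (g₁ - g₂) := by
    rw [hw, hw']
    module
  have e1 : (obaboStep k lam γ z g₁ g' - obaboStep k lam γ z g₂ g').fst
      = lam • (s • (g₁ - g₂)) := by
    have : (obaboStep k lam γ z g₁ g' - obaboStep k lam γ z g₂ g').fst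
      = (z.fst + lam • w) - (z.fst + lam • w') := rfl
    rw [this, ← hww]
    module
  have e2 : (obaboStep k lam γ z g₁ g' - obaboStep k lam γ z g₂ g').snd
      = e • (s • (g₁ - g₂) - (lam / 2) • (k (z.fst + lam • w) - k (z.fst + lam • w'))) := by
    have : (obaboStep k lam γ z g₁ g' - obaboStep k lam γ z g₂ g').snd
      = (e • (w - (lam / 2) • k (z.fst + lam • w)) + s • g')
        - (e • (w' - (lam / 2) • k (z.fst + lam • w')) + s • g') := rfl
    rw [this, ← hww]
    module
  have hl := hp.lam_pos
  have hc : 0 ≤ 2 * M - m := by linarith [hp.m_le, hp.m_pos]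
  have hk : ‖k (z.fst + lam • w) - k (z.fst + lam • w')‖ ≤ 2 * M * (lam * (s * ‖g₁ - g₂‖)) := by
    refine (norm_sub_le_of_cocoercive hc hcoc _ _).trans ?_
    have : (z.fst + lam • w) - (z.fst + lam • w') = lam • (s • (g₁ - g₂)) := by
      rw [← hww]
      module
    rw [this, norm_smul, norm_smul, Real.norm_of_nonneg hl.le, Real.norm_of_nonneg hs0]
    gcongr
    linarith [hp.m_pos]
  set q := s * ‖g₁ - g₂‖ with hq
  have hq0 : 0 ≤ q := by positivity
  -- The extra 1/100 is (λ/2)·2Mλ = λ²M, from the drift at the two new positions.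
  have hv : ‖(obaboStep k lam γ z g₁ g' - obaboStep k lam γ z g₂ g').snd‖ ≤ 101 / 100 * q := by
    rw [e2, norm_smul, Real.norm_of_nonneg he0]
    refine (mul_le_of_le_one_left (norm_nonneg _) he1).trans ((norm_sub_le _ _).trans ?_)
    rw [norm_smul, norm_smul, Real.norm_of_nonneg hs0, Real.norm_of_nonneg (by positivity), ← hq]
    have h1 := mul_le_mul_of_nonneg_left hk (by positivity : 0 ≤ lam / 2)
    have h2 := mul_le_mul_of_nonneg_right hp.lam_sq_mul_le hq0
    linarith
  have hx : ‖(obaboStep k lam γ z g₁ g' - obaboStep k lam γ z g₂ g').fst‖ = lam * q := by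
    rw [e1, norm_smul, norm_smul, Real.norm_of_nonneg hl.le, Real.norm_of_nonneg hs0]
  rw [hx]
  have hl2 : lam ^ 2 ≤ 1 / 200 := by nlinarith [hp.lam_sq_mul_le, hp.two_le, sq_nonneg lam]
  have hv2 := pow_le_pow_left₀ (norm_nonneg _) hv 2
  have hv3 := mul_le_mul hp.a_le hv2 (sq_nonneg _) (by norm_num)
  have hx3 := mul_le_mul_of_nonneg_right hl2 (sq_nonneg q)
  -- The total is at most 2·(1/200) + (5/4)(1/2)(1.01)² < 1 times q².
  nlinarith [sq_nonneg q]

/-- The second input enters additively, so it can be adjoined afterwards as a separate independent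
noise. -/
theorem obaboStep_eq_add (z : Phase d) (g g' : Vec d) :
    obaboStep k lam γ z g g' = obaboStep k lam γ z g 0
      + WithLp.toLp 2 (0, √(1 - Real.exp (-(lam * γ / 2)) ^ 2) • g') := by
  refine Phase.ext ?_ ?_
  · simp [obaboStep]
  · simp [obaboStep]

theorem norm_shear_toLp_sub_le (hp : ObaboParams a b γ m M lam) {s : ℝ} (hs : 0 ≤ s)
    (g₁ g₂ : Vec d) :
    ‖shear a b (WithLp.toLp 2 (0, s • g₁)) - shear a b (WithLp.toLp 2 (0, s • g₂))‖
      ≤ s * ‖g₁ - g₂‖ := by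
  refine abs_le_of_sq_le_sq' ?_ (by positivity) |>.2
  rw [shear_sub]
  refine (norm_sq_shear_le hp.four_b_sq_le _).trans ?_
  rw [WithLp.sub_fst, WithLp.sub_snd, WithLp.toLp_fst, WithLp.toLp_fst, WithLp.toLp_snd,
    WithLp.toLp_snd, sub_self, norm_zero, ← smul_sub, norm_smul, Real.norm_of_nonneg hs]
  nlinarith [mul_le_mul_of_nonneg_right hp.a_le (sq_nonneg (s * ‖g₁ - g₂‖)),
    sq_nonneg (s * ‖g₁ - g₂‖)]

theorem contDiff_obaboStep (hk : ContDiff ℝ 1 k) (g' : Vec d) :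
    ContDiff ℝ 1 fun p : Phase d × Vec d => obaboStep k lam γ p.1 p.2 g' := by
  have h1 : ContDiff ℝ 1 fun p : Phase d × Vec d => p.1.fst :=
    Phase.contDiff_fst.comp contDiff_fst
  have h2 : ContDiff ℝ 1 fun p : Phase d × Vec d => p.1.snd :=
    Phase.contDiff_snd.comp contDiff_fst
  unfold obaboStep
  refine Phase.contDiff_toLp.comp ?_
  fun_prop

end Step

/-! ### Propagation of the inequality along a chain with smooth drift. -/

section LSI

variable {d : ℕ} {a b γ m M lam : ℝ} {k : Vec d → Vec d} {Ω : Type*} [MeasurableSpace Ω]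
  {P : Measure Ω} [IsProbabilityMeasure P]

/-- Propagation of the logarithmic Sobolev inequality through one OBABO step with smooth drift. -/
theorem SatisfiesLSI.obaboStep (hp : ObaboParams a b γ m M lam) (hk : ContDiff ℝ 1 k)
    (hmon : ∀ x y, m * ‖x - y‖ ^ 2 ≤ inner ℝ (k x - k y) (x - y))
    (hcoc : ∀ x y, ‖k x - k y‖ ^ 2 ≤ (2 * M - m) * inner ℝ (k x - k y) (x - y))
    {r : ℝ} (hr0 : 0 ≤ r) (hr : r ^ 2 = 1 - lam * (m * b / 3))
    {Z : Ω → Phase d} {G G' : Ω → Vec d} (hZ : Measurable Z) (hGm : Measurable G)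
    (hGm' : Measurable G') (hG : P.map G = stdGaussian (Vec d))
    (hG' : P.map G' = stdGaussian (Vec d)) (hind : IndepFun G G' P)
    (hindZ : IndepFun Z (fun ω => (G ω, G' ω)) P) {C : ℝ} (hC : 0 ≤ C)
    (hLSI : SatisfiesLSI (P.map fun ω => shear a b (Z ω)) C) :
    SatisfiesLSI (P.map fun ω => shear a b (_root_.obaboStep k lam γ (Z ω) (G ω) (G' ω)))
      (r ^ 2 * C + 4 * (1 - Real.exp (-(lam * γ / 2)) ^ 2)) := by
  set s := √(1 - Real.exp (-(lam * γ / 2)) ^ 2) with hs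
  have hs0 : 0 ≤ s := Real.sqrt_nonneg _
  have hs2 : s ^ 2 = 1 - Real.exp (-(lam * γ / 2)) ^ 2 := by
    refine Real.sq_sqrt ?_
    have h1 : Real.exp (-(lam * γ / 2)) ≤ 1 :=
      Real.exp_le_one_iff.2 (by linarith [mul_pos hp.lam_pos hp.γ_pos])
    nlinarith [Real.exp_pos (-(lam * γ / 2))]
  have hsh : Measurable (shear (d := d) a b) := (contDiff_shear a b).continuous.measurable
  have hZG : IndepFun (fun ω => shear a b (Z ω)) G P := hindZ.comp hsh measurable_fst
  -- Conjugated by the shear, the twisted norm is the Euclidean one and the contraction becomes the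
  -- Lipschitz constant r. The second input is set to 0 for now.
  have hT₁ : ContDiff ℝ 1 fun p : Phase d × Vec d =>
      shear a b (_root_.obaboStep k lam γ (unshear a b p.1) p.2 0) :=
    (contDiff_shear a b).comp ((contDiff_obaboStep hk 0).comp
      (((contDiff_unshear a b).comp contDiff_fst).prodMk contDiff_snd))
  have h₁ := hLSI.map_of_indepFun (hsh.comp hZ) hGm hZG
    (hG ▸ satisfiesLSI_stdGaussian) hC zero_le_two hT₁ (r := ⟨r, hr0⟩) (s := ⟨s, hs0⟩)
    (fun g => LipschitzWith.of_dist_le_mul fun w w' => by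
      rw [dist_eq_norm, dist_eq_norm]
      refine abs_le_of_sq_le_sq' ?_ (by positivity) |>.2
      have := norm_sq_shear_obaboStep_sub_le hp hmon hcoc (unshear a b w) (unshear a b w') g 0
      rw [shear_unshear hp.b_sq_lt, shear_unshear hp.b_sq_lt, ← hr] at this
      rw [mul_pow]
      exact this)
    (fun w => LipschitzWith.of_dist_le_mul fun g₁ g₂ => by
      rw [dist_eq_norm, dist_eq_norm]
      exact norm_sq_shear_obaboStep_sub_le_left hp hcoc _ g₁ g₂ 0)
  simp only [Function.comp_apply, unshear_shear hp.b_sq_lt] at h₁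
  replace h₁ : SatisfiesLSI (P.map fun ω => shear a b (_root_.obaboStep k lam γ (Z ω) (G ω) 0))
      (r ^ 2 * C + s ^ 2 * 2) := h₁
  have hZGG := hindZ.prodMk_left hZ hGm hGm' hind
  have hstep : Measurable fun p : Phase d × Vec d =>
      shear a b (_root_.obaboStep k lam γ p.1 p.2 0) :=
    ((contDiff_shear a b).comp (contDiff_obaboStep hk 0)).continuous.measurable
  have hind₂ : IndepFun (fun ω => shear a b (_root_.obaboStep k lam γ (Z ω) (G ω) 0)) G' P :=
    hZGG.comp hstep measurable_id
  have hT₂ : ContDiff ℝ 1 fun p : Phase d × Vec d =>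
      p.1 + shear a b (WithLp.toLp 2 (0, s • p.2)) :=
    contDiff_fst.add ((contDiff_shear a b).comp (Phase.contDiff_toLp.comp
      (contDiff_const.prodMk (contDiff_snd.const_smul s))))
  -- Adding the second input has Lipschitz constant 1 in the state and s in the input, so it
  -- contributes another 2s².
  have h₂ := h₁.map_of_indepFun (hstep.comp (hZ.prodMk hGm)) hGm' hind₂
    (hG' ▸ satisfiesLSI_stdGaussian) (by positivity) zero_le_two hT₂ (r := 1) (s := ⟨s, hs0⟩)
    (fun g => LipschitzWith.of_dist_le_mul fun w w' => by simp)
    (fun w => LipschitzWith.of_dist_le_mul fun g₁ g₂ => by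
      rw [dist_add_left, dist_eq_norm, dist_eq_norm]
      exact norm_shear_toLp_sub_le hp hs0 g₁ g₂)
  have e : (fun ω => shear a b (_root_.obaboStep k lam γ (Z ω) (G ω) (G' ω))) = fun ω =>
      shear a b (_root_.obaboStep k lam γ (Z ω) (G ω) 0)
        + shear a b (WithLp.toLp 2 (0, s • G' ω)) := by
    funext ω
    rw [obaboStep_eq_add, shear_add]
  rw [e]
  refine h₂.mono (le_of_eq ?_)
  rw [← hs2]
  change (1 : ℝ) ^ 2 * (r ^ 2 * C + s ^ 2 * 2) + s ^ 2 * 2 = _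
  ring

/-- Propagation of the logarithmic Sobolev inequality along the OBABO chain with smooth drift. -/
theorem satisfiesLSI_obaboChain (hp : ObaboParams a b γ m M lam) (hk : ContDiff ℝ 1 k)
    (hmon : ∀ x y, m * ‖x - y‖ ^ 2 ≤ inner ℝ (k x - k y) (x - y))
    (hcoc : ∀ x y, ‖k x - k y‖ ^ 2 ≤ (2 * M - m) * inner ℝ (k x - k y) (x - y))
    {r : ℝ} (hr0 : 0 ≤ r) (hr : r ^ 2 = 1 - lam * (m * b / 3))
    {z₀ : Ω → Phase d} {G G' : ℕ → Ω → Vec d} (hz₀ : Measurable z₀)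
    (hGm : ∀ k, Measurable (G k)) (hGm' : ∀ k, Measurable (G' k))
    (hG : ∀ k, P.map (G k) = stdGaussian (Vec d))
    (hG' : ∀ k, P.map (G' k) = stdGaussian (Vec d))
    (hindep : iIndepFun (fun i : ℕ ⊕ ℕ => Sum.elim G G' i) P)
    (hindep₀ : IndepFun z₀ (fun ω (i : ℕ ⊕ ℕ) => Sum.elim G G' i ω) P)
    {C₀ : ℝ} (hC₀ : 0 ≤ C₀) (hLSI : SatisfiesLSI (P.map z₀) C₀) {C₁ : ℝ}
    (hC₁ : 4 * (1 - Real.exp (-(lam * γ / 2)) ^ 2) ≤ C₁) (n : ℕ) :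
    SatisfiesLSI (P.map fun ω => shear a b (obaboChain k lam γ z₀ G G' n ω))
      ((r ^ 2) ^ n * √(1 + a) * C₀ + (∑ i ∈ Finset.range n, (r ^ 2) ^ i) * C₁) := by
  have hC₁0 : 0 ≤ C₁ := by
    refine le_trans ?_ hC₁
    have h1 : Real.exp (-(lam * γ / 2)) ≤ 1 :=
      Real.exp_le_one_iff.2 (by linarith [mul_pos hp.lam_pos hp.γ_pos])
    nlinarith [Real.exp_pos (-(lam * γ / 2))]
  induction n with
  | zero =>
    have pz := Measure.isProbabilityMeasure_map (μ := P) hz₀.aemeasurable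
    have h := hLSI.map_lipschitz hC₀ (contDiff_shear a b)
      (lipschitzWith_shear hp.a_le hp.a_pos hp.four_b_sq_le)
    rw [Measure.map_map (contDiff_shear a b).continuous.measurable hz₀, ← NNReal.coe_pow,
      NNReal.sq_sqrt, Real.coe_toNNReal _ (Real.sqrt_nonneg _)] at h
    refine h.mono (le_of_eq ?_)
    simp
  | succ n ih =>
    have hindn : IndepFun (G n) (G' n) P :=
      hindep.indepFun (i := Sum.inl n) (j := Sum.inr n) (by simp)
    have hkm := hk.continuous.measurable
    have h := ih.obaboStep hp hk hmon hcoc hr0 hr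
      (measurable_obaboChain hkm lam γ hz₀ hGm hGm' n) (hGm n) (hGm' n) (hG n) (hG' n) hindn
      (indepFun_obaboChain hkm lam γ hz₀ hGm hGm' hindep hindep₀ n) (by positivity)
    refine SatisfiesLSI.mono h ?_
    rw [Finset.sum_range_succ', Finset.sum_congr rfl fun i _ => pow_succ (r ^ 2) i,
      ← Finset.sum_mul]
    rw [pow_succ (r ^ 2) n, pow_zero]
    linarith

end LSI

/-! ### Removal of the smoothing and the main theorem. -/

/-- The OBABO chain depends continuously on the drift, under uniform convergence. -/
theorem tendsto_obaboChain {d : ℕ} {Ω : Type*} {h : Vec d → Vec d} (hh : Continuous h)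
    {k : ℕ → Vec d → Vec d} (hk : TendstoUniformly k h atTop) (lam γ : ℝ) (z₀ : Ω → Phase d)
    (G G' : ℕ → Ω → Vec d) (n : ℕ) (ω : Ω) :
    Tendsto (fun j => obaboChain (k j) lam γ z₀ G G' n ω) atTop
      (𝓝 (obaboChain h lam γ z₀ G G' n ω)) := by
  have key : ∀ {x : ℕ → Vec d} {y : Vec d}, Tendsto x atTop (𝓝 y) →
      Tendsto (fun j => k j (x j)) atTop (𝓝 (h y)) := fun hx =>
    hk.tendsto_comp hh.continuousAt hx
  induction n with
  | zero => exact tendsto_const_nhds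
  | succ n ih =>
    have h1 := (Phase.contDiff_fst (d := d)).continuous.continuousAt.tendsto.comp ih
    have h2 := (Phase.contDiff_snd (d := d)).continuous.continuousAt.tendsto.comp ih
    have hw := ((h2.const_smul (Real.exp (-(lam * γ / 2)))).add_const
      (√(1 - Real.exp (-(lam * γ / 2)) ^ 2) • G n ω)).sub ((key h1).const_smul (lam / 2))
    have hx := h1.add (hw.const_smul lam)
    have hv := ((hw.sub ((key hx).const_smul (lam / 2))).const_smul
      (Real.exp (-(lam * γ / 2)))).add_const (√(1 - Real.exp (-(lam * γ / 2)) ^ 2) • G' n ω)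
    exact (Phase.contDiff_toLp (d := d)).continuous.continuousAt.tendsto.comp (hx.prodMk_nhds hv)

theorem le_of_ae_inner_fderiv_ge {d : ℕ} (hd : 0 < d) {h : Vec d → Vec d} {K : ℝ≥0}
    (hK : LipschitzWith K h) {m : ℝ}
    (hae : ∀ᵐ x : Vec d, ∀ ξ, m * ‖ξ‖ ^ 2 ≤ inner ℝ (fderiv ℝ h x ξ) ξ) : m ≤ K := by
  have : Nonempty (Fin d) := ⟨⟨0, hd⟩⟩
  obtain ⟨x, hx⟩ := hae.exists
  obtain ⟨ξ, hξ⟩ := exists_ne (0 : Vec d)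
  have hξ' : 0 < ‖ξ‖ ^ 2 := by positivity
  have h1 : inner ℝ (fderiv ℝ h x ξ) ξ ≤ K * ‖ξ‖ ^ 2 :=
    calc inner ℝ (fderiv ℝ h x ξ) ξ ≤ ‖fderiv ℝ h x ξ‖ * ‖ξ‖ := real_inner_le_norm _ _
      _ ≤ (K * ‖ξ‖) * ‖ξ‖ := by
        gcongr
        exact (fderiv ℝ h x).le_of_opNorm_le (norm_fderiv_le_of_lipschitz ℝ hK) ξ
      _ = K * ‖ξ‖ ^ 2 := by ring
  exact le_of_mul_le_mul_right ((hx ξ).trans h1) hξ'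

/-- The condition γ ≥ 2√M becomes 4b ≤ aγ, and λ ≤ m/(33γ³) becomes 33λγ ≤ m b². -/
theorem obaboParams_of_step_le {m M gam lam : ℝ} (hm : 0 < m) (hmM : m ≤ M) (hM2 : 2 ≤ M)
    (hgam : 2 * √M ≤ gam) (hlam : 0 < lam) (hstep : lam ≤ m / (33 * gam ^ 3)) :
    ObaboParams (1 / M) (1 / gam) gam m M lam := by
  have hM0 : 0 < M := by linarith
  have hsM : 0 < √M := Real.sqrt_pos.2 hM0
  have hg : 0 < gam := by linarith
  have hg2 : 4 * M ≤ gam ^ 2 := by nlinarith [Real.sq_sqrt hM0.le]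
  refine ⟨hm, hmM, hM2, by field_simp, by field_simp, hg, ?_, hlam, ?_⟩
  · rw [mul_one_div, one_div_mul_eq_div, div_le_div_iff₀ hg hM0]
    linarith
  · rw [le_div_iff₀ (by positivity)] at hstep
    rw [one_div, inv_pow, ← div_eq_mul_inv, le_div_iff₀ (by positivity)]
    linarith

/-- With y = 1 - e^{-2λγ} in [0, 1] one has 1 - η² = 1 - e^{-λγ} ≤ y ≤ √y. -/
theorem one_sub_exp_sq_le_sqrt {lam γ : ℝ} (hlam : 0 < lam) (hγ : 0 < γ) :
    4 * (1 - Real.exp (-(lam * γ / 2)) ^ 2) ≤ 8 * √(1 - Real.exp (-(2 * lam * γ))) := by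
  have hp := mul_pos hlam hγ
  have h1 : Real.exp (-(lam * γ / 2)) ^ 2 = Real.exp (-(lam * γ)) := by
    rw [← Real.exp_nat_mul]
    ring_nf
  have h2 : Real.exp (-(2 * lam * γ)) ≤ Real.exp (-(lam * γ)) := Real.exp_le_exp.2 (by linarith)
  have h3 : Real.exp (-(2 * lam * γ)) ≤ 1 := Real.exp_le_one_iff.2 (by linarith)
  have h4 := Real.sq_sqrt (sub_nonneg.2 h3)
  have h5 := Real.sqrt_nonneg (1 - Real.exp (-(2 * lam * γ)))
  have h6 : √(1 - Real.exp (-(2 * lam * γ))) ≤ 1 :=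
    Real.sqrt_le_one.2 (by linarith [Real.exp_pos (-(2 * lam * γ))])
  rw [h1]
  nlinarith

theorem mainTheorem5 {d : ℕ} (u : Vec d → ℝ) (m L l : ℝ)
    -- standing assumptions on the potential, `h = ∇u`
    (hu : Differentiable ℝ u) (hm : 0 < m) (hL : 0 < L) (hl : 0 < l)
    (hconv : ∀ x y : Vec d, 2 * m * ‖x - y‖ ^ 2 ≤ inner ℝ (gradient u x - gradient u y) (x - y))
    (hlip : ∀ x y : Vec d,
      ‖gradient u x - gradient u y‖ ≤ L * (1 + ‖x‖ + ‖y‖) ^ l * ‖x - y‖)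
    -- step size, friction, Lipschitz constant of the tamed drift
    (lam gam M : ℝ) (hlam : 0 < lam)
    (hM : (lipConst (tamedDrift (gradient u) m L l lam) : ℝ) ≤ M) (hM2 : 2 ≤ M)
    (hgam : 2 * √M ≤ gam) (hstep : lam ≤ m / (33 * gam ^ 3))
    (a b κ r C₁ : ℝ) (ha : a = 1 / M) (hb : b = 1 / gam) (hκ : κ = m / (3 * gam))
    (hr : r = √(1 - lam * κ)) (hC₁ : C₁ = 8 * √(1 - Real.exp (-(2 * lam * gam))))
    -- initial condition and independent standard Gaussian inputs
    {Ω : Type*} [MeasurableSpace Ω] (P : Measure Ω) [IsProbabilityMeasure P]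
    (z₀ : Ω → Phase d) (G G' : ℕ → Ω → Vec d) (hz₀ : Measurable z₀)
    (hGm : ∀ k, Measurable (G k)) (hGm' : ∀ k, Measurable (G' k))
    (hG : ∀ k, P.map (G k) = stdGaussian (Vec d))
    (hG' : ∀ k, P.map (G' k) = stdGaussian (Vec d))
    (hindep : iIndepFun (fun i : ℕ ⊕ ℕ => Sum.elim G G' i) P)
    (hindep₀ : IndepFun z₀ (fun ω (i : ℕ ⊕ ℕ) => Sum.elim G G' i ω) P)
    (C₀ : ℝ) (hLSI : SatisfiesLSI (P.map z₀) C₀) (n : ℕ) :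
    SatisfiesLSI
      (P.map fun ω =>
        shear a b (obaboChain (tamedDrift (gradient u) m L l lam) lam gam z₀ G G' n ω))
      ((1 - lam * κ) ^ n * √(1 + a) * C₀ + (1 - r ^ (2 * n)) / (1 - r ^ 2) * C₁) := by
  obtain ⟨K₀, hK₀⟩ := exists_lipschitzWith_tamedDrift hm hL hl hlam hlip
  set T := tamedDrift (gradient u) m L l lam with hT
  have hTM : LipschitzWith M.toNNReal T :=
    (lipschitzWith_lipConst hK₀).weaken (NNReal.coe_le_coe.1 (hM.trans (Real.le_coe_toNNReal M)))
  have hMc : (M.toNNReal : ℝ) = M := Real.coe_toNNReal M (by linarith)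
  have hchain : ∀ k : Vec d → Vec d, Measurable k →
      Measurable fun ω => shear a b (obaboChain k lam gam z₀ G G' n ω) := fun k hk =>
    (contDiff_shear a b).continuous.measurable.comp
      (measurable_obaboChain hk lam gam hz₀ hGm hGm' n)
  rcases Nat.eq_zero_or_pos d with rfl | hd
  · have : Subsingleton (Phase 0) :=
      (WithLp.ofLp_injective 2).subsingleton
    have := Measure.isProbabilityMeasure_map (μ := P)
      (hchain T hTM.continuous.measurable).aemeasurable
    exact satisfiesLSI_of_subsingleton _ _
  have hae := ae_fderiv_tamedDrift_bounds hd hu hm hL hl hlam hconv hlip hTM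
  have hmM : m ≤ M := hMc ▸ le_of_ae_inner_fderiv_ge hd hTM (hae.mono fun x hx ξ => (hx.2 ξ).1)
  rw [← hT, hMc] at hae
  have hp := obaboParams_of_step_le hm hmM hM2 hgam hlam hstep
  rw [← ha, ← hb] at hp
  have hκ' : κ = m * b / 3 := by
    rw [hκ, hb]
    field_simp
  have hlκ : lam * κ < 1 := by
    have h1 : lam * gam * b = lam := by rw [mul_assoc, mul_comm gam, hp.b_mul, mul_one]
    have h2 : m * b ^ 2 ≤ 1 := by
      have h3 := mul_le_mul_of_nonneg_right hmM (sq_nonneg b)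
      have h4 := mul_le_mul_of_nonneg_left hp.b_sq_lt.le (by linarith : 0 ≤ M)
      linarith [hp.a_mul, mul_comm M a]
    have h5 : lam * κ = lam * gam * (m * b ^ 2) / 3 := by
      rw [hκ']
      linear_combination (-(m * b / 3)) * h1
    rw [h5]
    nlinarith [hp.lam_mul_γ_le, mul_pos hlam hp.γ_pos]
  have hr2 : r ^ 2 = 1 - lam * κ := by
    rw [hr]
    exact Real.sq_sqrt (by linarith)
  have hr0 : 0 ≤ r := hr ▸ Real.sqrt_nonneg _
  have hκ0 : 0 < κ := by
    have := hp.b_pos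
    rw [hκ']
    positivity
  have hr1 : r ^ 2 ≠ 1 := by
    have := mul_pos hlam hκ0
    linarith
  have pz := Measure.isProbabilityMeasure_map (μ := P) hz₀.aemeasurable
  have : Nonempty (Fin d) := ⟨⟨0, hd⟩⟩
  have : Nontrivial (Phase d) := (WithLp.toLp_injective 2).nontrivial
  -- Positive dimension makes the phase space nontrivial; the sign is needed to multiply gradient
  -- bounds by the constant.
  have hC₀ : 0 ≤ C₀ := hLSI.nonneg
  have hgeom : (1 - r ^ (2 * n)) / (1 - r ^ 2) = ∑ i ∈ Finset.range n, (r ^ 2) ^ i := by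
    rw [geom_sum_eq hr1, pow_mul, ← neg_sub, ← neg_sub (r ^ 2) 1, neg_div_neg_eq]
  -- The smooth drifts keep the same m and 2M - m, so the bound for their chains does not depend on
  -- j.
  choose k hkC hkT hkm hkc using fun j : ℕ =>
    exists_contDiff_approx hTM (by linarith : 0 < 2 * M - m) hae (Nat.one_div_pos_of_nat (n := j))
  have hlim : TendstoUniformly k T atTop := by
    rw [Metric.tendstoUniformly_iff]
    intro ε hε
    have h0 : Tendsto (fun j : ℕ => (M.toNNReal : ℝ) * (1 / ((j : ℝ) + 1))) atTop (𝓝 0) := by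
      simpa using tendsto_one_div_add_atTop_nhds_zero_nat.const_mul (M.toNNReal : ℝ)
    filter_upwards [h0.eventually_lt_const hε] with j hj x
    rw [dist_comm, dist_eq_norm]
    exact (hkT j x).trans_lt hj
  refine satisfiesLSI_of_tendsto (fun j => hchain (k j) (hkC j).continuous.measurable)
    (hchain T hTM.continuous.measurable)
    (fun ω => (contDiff_shear a b).continuous.continuousAt.tendsto.comp
      (tendsto_obaboChain hTM.continuous hlim lam gam z₀ G G' n ω)) fun j => ?_
  rw [hgeom, ← hr2]
  exact satisfiesLSI_obaboChain hp (hkC j) (hkm j) (hkc j) hr0 (by rw [hr2, hκ']) hz₀ hGm hGm'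
    hG hG' hindep hindep₀ hC₀ hLSI (hC₁ ▸ one_sub_exp_sq_le_sqrt hlam hp.γ_pos) n
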